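/- **Tangent categories.** A tangent structure $\mathbb T=(T,p,0,+,\ell,c)$ on a category $\mathcal C$ consists of a functor $T:\mathcal C\to\mathcal C$ and natural transformations $p:T\Rightarrow\mathrm{id}$, $0:\mathrm{id}\Rightarrow T$, $+:T_2\Rightarrow T$ (where $T_2X=TX\times_X TX$), $\ell:T\Rightarrow T^2$, $c:T^2\Rightarrow T^2$ such that, for every object $X$: 1. all finite pullback powers $TX\times_X\cdots\times_X TX$ of $p_X$ exist and are preserved by all iterates $T^m$; 2. $p_X$ is a commutative monoid in $\mathcal C_{/X}$ with unit $0_X$ and addition $+_X$; 3. $T(p_X)\circ\ell_X=0_X\circ p_X$, $\;+_{TX}\circ\langle\ell_X\pi_1,\ell_X\pi_2\rangle=\ell_X\circ +_X$, $\;0_{TX}\circ 0_X=\ell_X\circ 0_X$; 4. $p_{TX}\circ c_X=T(p_X)$, $\;+_{TX}\circ\langle c_X\circ T(\pi_1),c_X\circ T(\pi_2)\rangle=c_X\circ T(+_X)$, $\;c_X\circ T(0_X)=0_{TX}$; 5. $c_X^2=\mathrm{id}$, $\;c_X\ell_X=\ell_X$, $\;T(\ell_X)\circ\ell_X=\ell_{TX}\circ\ell_X$,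 $\;T(c_X)\circ c_{TX}\circ T(c_X)=c_{TX}\circ T(c_X)\circ c_{TX}$, $\;c_{TX}\circ T(c_X)\circ\ell_{TX}=T(\ell_X)\circ c_X$; 6. $T(+_X)\circ\langle\ell_X\pi_1,0_{TX}\pi_2\rangle:T_2X\to T^2X$ is an equalizer of $T(p_X)$ and $0_X\circ p_X\circ p_{TX}:T^2X\rightrightarrows TX$. A morphism $(\mathcal C,\mathbb T)\to(\mathcal D,\mathbb S)$ of tangent categories, $\mathbb S=(S,q,0',\oplus,\ell',c')$, is a functor $F:\mathcal C\to\mathcal D$ with a natural transformation $\alpha:F\circ T\Rightarrow S\circ F$ such that, for every $X$: $q_{FX}\circ\alpha_X=F(p_X)$; $\alpha_X\circ F(0_X)=0'_{FX}$; $\alpha_X\circ F(+_X)=\oplus_{FX}\circ\langle\alpha_X F(\pi_1),\alpha_X F(\pi_2)\rangle$; $\ell'_{FX}\circ\alpha_X=S(\alpha_X)\circ\alpha_{TX}\circ F(\ell_X)$; $c'_{FX}\circ S(\alpha_X)\circ\alpha_{TX}=S(\alpha_X)\circ\alpha_{TX}\circ F(c_X)$. It is strong if $\alpha$ is an isomorphism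 and $F$ preserves the pullbacks in (1) (including their images under the $T^m$) and the equalizers in (6). **The Zariski tangent structure.** For a scheme $S$ and an $S$-scheme $Z$ let $T_{Z/S}=\operatorname{Spec}\operatorname{Sym}(\Omega^1_{Z/S})$, an $S$-scheme. It is obtained by gluing the schemes $\operatorname{Spec}\operatorname{Sym}_B(\Omega^1_{B/A})$ for affine opens $\operatorname{Spec}B\subseteq Z$ lying over affine opens $\operatorname{Spec}A\subseteq S$. With $W[\varepsilon]=W\times\operatorname{Spec}\mathbb Z[\varepsilon]/(\varepsilon^2)$, the morphism $T_{Z/S}[\varepsilon]\to Z$ given on affine opens by $b\mapsto b+(\mathrm db)\varepsilon$ is universal: it induces bijections $\operatorname{Hom}_S(W,T_{Z/S})\cong\operatorname{Hom}_S(W[\varepsilon],Z)$. The maps are given affine-locally on rings as follows. - $T(k)$, for $k:Z\to Z'$ over $S$: $b\mapsto k^\#b$, $\mathrm db\mapsto\mathrm d(k^\#b)$. - $p:T_{Z/S}\to Z$: $b\mapsto b$. - $0:Z\to T_{Z/S}$: $b\mapsto b$, $\mathrm db\mapsto 0$. - $+$: $b\mapsto b\otimes1$, $\mathrm db\mapsto\mathrm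 db\otimes1+1\otimes\mathrm db$. - $\ell$: $b\mapsto b$, $\mathrm db\mapsto0$, $\delta b\mapsto0$, $\delta\mathrm db\mapsto\mathrm db$. - $c$: $b\mapsto b$, $\mathrm db\mapsto\delta b$, $\delta b\mapsto\mathrm db$, $\delta\mathrm db\mapsto\delta\mathrm db$. Here $\delta$ denotes the differential of the outer application of $T$ in $T^2$; thus $\ell$ corresponds to $T[\varepsilon_1][\varepsilon_2]\to Z$, $b\mapsto b+(\mathrm db)\varepsilon_1\varepsilon_2$, and $c$ interchanges $\varepsilon_1$ and $\varepsilon_2$. **Proposition.** Let $f:X\to Y$ be a morphism of schemes. The data just described are tangent structures on $\mathrm{Sch}_{/X}$ and on $\mathrm{Sch}_{/Y}$. Let $f^*=(-)\times_YX:\mathrm{Sch}_{/Y}\to\mathrm{Sch}_{/X}$, and let ${}_fT_Z:f^*T_{Z/Y}\to T_{f^*Z/X}$ be the canonical morphism, given affine-locally by $b\otimes a\mapsto b\otimes a$, $\mathrm d(b\otimes a)\mapsto\mathrm db\otimes a$ (equivalently, the one that corresponds to the morphism $(f^*T_{Z/Y})[\varepsilon]\to f^*Z$ over $X$, $b\otimes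 a\mapsto(b+(\mathrm db)\varepsilon)\otimes a$). Then $(f^*,{}_fT)$ is a strong morphism of tangent categories from $\mathrm{Sch}_{/Y}$ to $\mathrm{Sch}_{/X}$; in particular ${}_fT$ is a natural isomorphism. -/

import Mathlib

open CategoryTheory Limits AlgebraicGeometry

universe u

noncomputable section

namespace ZariskiTangent

/-- `Sym_B(Ω_{B/A})` -/
def symKaehler {A B : CommRingCat.{u}} (φ : A ⟶ B) : CommRingCat.{u} :=
  letI := φ.hom.toAlgebra
  CommRingCat.of (SymmetricAlgebra B Ω[B⁄A])

variable {A B : CommRingCat.{u}} (φ : A ⟶ B)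

/-- The structure map `B ⟶ Sym_B(Ω_{B/A})`, `b ↦ b`. -/
def symKaehlerIncl : B ⟶ symKaehler φ :=
  letI := φ.hom.toAlgebra
  CommRingCat.ofHom (algebraMap B (SymmetricAlgebra B Ω[B⁄A]))

/-- The element `db` of `Sym_B(Ω_{B/A})`. -/
def symKaehlerD (b : B) : symKaehler φ :=
  letI := φ.hom.toAlgebra
  SymmetricAlgebra.ι B Ω[B⁄A] (KaehlerDifferential.D A B b)

/-- The universal ring homomorphism `B → Sym_B(Ω_{B/A})[ε]`, `b ↦ b + (db)ε`. -/
def symKaehlerUniv : B →+* DualNumber (symKaehler φ) where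
  toFun b := (symKaehlerIncl φ b, symKaehlerD φ b)
  map_one' := by
    let := φ.hom.toAlgebra
    refine TrivSqZeroExt.ext (map_one _) ?_
    change SymmetricAlgebra.ι B Ω[B⁄A] (KaehlerDifferential.D A B 1) = 0
    simp
  map_mul' x y := by
    let := φ.hom.toAlgebra
    refine TrivSqZeroExt.ext (map_mul _ _ _) ?_
    refine Eq.trans ?_ (DualNumber.snd_mul _ _).symm
    change SymmetricAlgebra.ι B Ω[B⁄A] (KaehlerDifferential.D A B (x * y)) =
      algebraMap B (SymmetricAlgebra B Ω[B⁄A]) x *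
        SymmetricAlgebra.ι B Ω[B⁄A] (KaehlerDifferential.D A B y) +
      SymmetricAlgebra.ι B Ω[B⁄A] (KaehlerDifferential.D A B x) *
        algebraMap B (SymmetricAlgebra B Ω[B⁄A]) y
    simp [Algebra.smul_def, mul_comm]
  map_zero' := by
    let := φ.hom.toAlgebra
    refine TrivSqZeroExt.ext (map_zero _) ?_
    change SymmetricAlgebra.ι B Ω[B⁄A] (KaehlerDifferential.D A B 0) = 0
    simp
  map_add' x y := by
    let := φ.hom.toAlgebra
    refine TrivSqZeroExt.ext (map_add _ _ _) ?_
    change SymmetricAlgebra.ι B Ω[B⁄A] (KaehlerDifferential.D A B (x + y)) =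
      SymmetricAlgebra.ι B Ω[B⁄A] (KaehlerDifferential.D A B x) +
      SymmetricAlgebra.ι B Ω[B⁄A] (KaehlerDifferential.D A B y)
    simp

lemma symKaehlerD_base (a : A) : symKaehlerD φ (φ a) = 0 := by
  let := φ.hom.toAlgebra
  change SymmetricAlgebra.ι B Ω[B⁄A] (KaehlerDifferential.D A B (algebraMap A B a)) = 0
  simp

/-- A ring homomorphism `h : B → R[ε]`, `b ↦ g b + (δ b)ε`, such that `δ` vanishes on `A`, gives
`Sym_B(Ω_{B/A}) ⟶ R`, `b ↦ g b`, `db ↦ δ b`. -/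
def symKaehlerDesc {R : CommRingCat.{u}} (h : B →+* DualNumber R)
    (hh : ∀ a : A, (h (φ a)).snd = 0) : symKaehler φ ⟶ R :=
  letI := φ.hom.toAlgebra
  letI : Algebra B R := ((TrivSqZeroExt.fstHom R R R).toRingHom.comp h).toAlgebra
  letI : Algebra A R := ((algebraMap B R).comp φ.hom).toAlgebra
  haveI : IsScalarTower A B R := .of_algebraMap_eq' rfl
  letI δ : Derivation A B R :=
    { toFun b := (h b).snd
      map_add' x y := by simp
      map_smul' a x := by
        have : a • x = φ a * x := rfl
        rw [this, map_mul]
        simp only [TrivSqZeroExt.snd_mul, hh]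
        simp
        rfl
      map_one_eq_zero' := by simp
      leibniz' x y := by
        change (h (x * y)).snd = (h x).fst * (h y).snd + (h y).fst * (h x).snd
        rw [map_mul, DualNumber.snd_mul, mul_comm (h y).fst] }
  CommRingCat.ofHom (SymmetricAlgebra.lift δ.liftKaehlerDifferential).toRingHom

lemma symKaehlerDesc_incl {R : CommRingCat.{u}} (h : B →+* DualNumber R)
    (hh : ∀ a : A, (h (φ a)).snd = 0) (b : B) :
    symKaehlerDesc φ h hh (symKaehlerIncl φ b) = (h b).fst := by
  let := φ.hom.toAlgebra
  let : Algebra B R := ((TrivSqZeroExt.fstHom R R R).toRingHom.comp h).toAlgebra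
  exact AlgHom.commutes (SymmetricAlgebra.lift (R := B) (A := R) (M := Ω[B⁄A]) _) b

lemma symKaehlerDesc_d {R : CommRingCat.{u}} (h : B →+* DualNumber R)
    (hh : ∀ a : A, (h (φ a)).snd = 0) (b : B) :
    symKaehlerDesc φ h hh (symKaehlerD φ b) = (h b).snd := by
  let := φ.hom.toAlgebra
  let : Algebra B R := ((TrivSqZeroExt.fstHom R R R).toRingHom.comp h).toAlgebra
  let : Algebra A R := ((algebraMap B R).comp φ.hom).toAlgebra
  have : IsScalarTower A B R := .of_algebraMap_eq' rfl
  refine (SymmetricAlgebra.lift_ι_apply (R := B) (A := R) (M := Ω[B⁄A]) _ _).trans ?_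
  exact Derivation.liftKaehlerDifferential_comp_D _ _

variable {φ} in
lemma symKaehler_hom_ext {R : CommRingCat.{u}} {x y : symKaehler φ ⟶ R}
    (h₁ : ∀ b, x (symKaehlerIncl φ b) = y (symKaehlerIncl φ b))
    (h₂ : ∀ b, x (symKaehlerD φ b) = y (symKaehlerD φ b)) : x = y := by
  let := φ.hom.toAlgebra
  let : Algebra B R := (symKaehlerIncl φ ≫ x).hom.toAlgebra
  let x' : SymmetricAlgebra B Ω[B⁄A] →ₐ[B] R := { x.hom with commutes' := fun b => rfl }
  let y' : SymmetricAlgebra B Ω[B⁄A] →ₐ[B] R :=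
    { y.hom with commutes' := fun b => (h₁ b).symm }
  have : x' = y' := by
    refine SymmetricAlgebra.algHom_ext ?_
    refine LinearMap.ext_on (KaehlerDifferential.span_range_derivation A B) ?_
    rintro _ ⟨b, rfl⟩
    exact h₂ b
  ext c
  exact congr($this c)


variable {A' B' : CommRingCat.{u}} {φ} {φ' : A' ⟶ B'}

/-- The ring homomorphism `Sym_B(Ω_{B/A}) ⟶ Sym_{B'}(Ω_{B'/A'})`, `b ↦ b`, `db ↦ db` induced by a
commutative square. -/
def symKaehlerMap (a : A ⟶ A') (b : B ⟶ B') (w : φ ≫ b = a ≫ φ') :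
    symKaehler φ ⟶ symKaehler φ' :=
  symKaehlerDesc φ ((symKaehlerUniv φ').comp b.hom) (fun x => by
    have : b (φ x) = φ' (a x) := congr($w x)
    change symKaehlerD φ' (b (φ x)) = 0
    rw [this, symKaehlerD_base])

lemma symKaehlerMap_incl (a : A ⟶ A') (b : B ⟶ B') (w : φ ≫ b = a ≫ φ') (x : B) :
    symKaehlerMap a b w (symKaehlerIncl φ x) = symKaehlerIncl φ' (b x) :=
  symKaehlerDesc_incl ..

lemma symKaehlerMap_d (a : A ⟶ A') (b : B ⟶ B') (w : φ ≫ b = a ≫ φ') (x : B) :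
    symKaehlerMap a b w (symKaehlerD φ x) = symKaehlerD φ' (b x) :=
  symKaehlerDesc_d ..

lemma symKaehlerIncl_map (a : A ⟶ A') (b : B ⟶ B') (w : φ ≫ b = a ≫ φ') :
    symKaehlerIncl φ ≫ symKaehlerMap a b w = b ≫ symKaehlerIncl φ' := by
  ext x
  exact symKaehlerMap_incl a b w x

/-- The ring homomorphism `S[ε] → R[ε]` induced by `S → R`. -/
def dualMap {S R : Type u} [CommRing S] [CommRing R] (x : S →+* R) :
    DualNumber S →+* DualNumber R where
  toFun c := (x c.fst, x c.snd)
  map_one' := TrivSqZeroExt.ext (map_one x) (map_zero x)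
  map_zero' := TrivSqZeroExt.ext (map_zero x) (map_zero x)
  map_add' c d := TrivSqZeroExt.ext (map_add x _ _) (map_add x _ _)
  map_mul' c d := by
    refine TrivSqZeroExt.ext (map_mul x _ _) ?_
    rw [DualNumber.snd_mul]
    change x (c * d).snd = _
    rw [DualNumber.snd_mul, map_add, map_mul, map_mul]
    rfl

lemma isNilpotent_ker_fst (R : Type u) [CommRing R] :
    IsNilpotent (RingHom.ker ((TrivSqZeroExt.fstHom R R R).toRingHom)) :=

  ⟨2, TrivSqZeroExt.kerIdeal_sq R R⟩

lemma exists_dual_lift {B B' R : Type u} [CommRing B] [CommRing B'] [CommRing R] {b : B →+* B'}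
    (hb : b.FormallyEtale) (k : B →+* DualNumber R) (y : B' →+* R)
    (h : ∀ c, (k c).fst = y (b c)) :
    ∃ g : B' →+* DualNumber R, (∀ c, g (b c) = k c) ∧ ∀ c, (g c).fst = y c := by
  let := b.toAlgebra
  have : Algebra.FormallyEtale B B' := hb
  let := k.toAlgebra
  let : Algebra B R := (y.comp b).toAlgebra
  let y' : B' →ₐ[B] R := { y with commutes' _ := rfl }
  let q : DualNumber R →ₐ[B] R :=
    { (TrivSqZeroExt.fstHom R R R).toRingHom with commutes' c := h c }
  have hq : Function.Surjective q := fun r => ⟨(r, 0), rfl⟩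
  have hq' : IsNilpotent (RingHom.ker (q : DualNumber R →+* R)) := isNilpotent_ker_fst R
  refine ⟨Algebra.FormallySmooth.liftOfSurjective y' q hq hq', fun c => ?_, fun c => ?_⟩
  · exact AlgHom.commutes (Algebra.FormallySmooth.liftOfSurjective y' q hq hq') c
  · exact Algebra.FormallySmooth.liftOfSurjective_apply y' q hq hq' c

lemma dual_lift_unique {A A' R : Type u} [CommRing A] [CommRing A'] [CommRing R] {a : A →+* A'}
    (ha : a.FormallyUnramified) (g₁ g₂ : A' →+* DualNumber R)
    (h : ∀ c, g₁ (a c) = g₂ (a c)) (h' : ∀ c, (g₁ c).fst = (g₂ c).fst) : g₁ = g₂ := by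
  let := a.toAlgebra
  have : Algebra.FormallyUnramified A A' := ha
  let := (g₁.comp a).toAlgebra
  let g₁' : A' →ₐ[A] DualNumber R := { g₁ with commutes' _ := rfl }
  let g₂' : A' →ₐ[A] DualNumber R := { g₂ with commutes' c := (h c).symm }
  have : g₁' = g₂' := Algebra.FormallyUnramified.ext' _ (isNilpotent_ker_fst R) g₁' g₂' h'
  ext1 c
  exact congr($this c)

lemma isPushout_symKaehlerMap (a : A ⟶ A') (b : B ⟶ B') (w : φ ≫ b = a ≫ φ')
    (ha : a.hom.Etale) (hb : b.hom.Etale) :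
    IsPushout (symKaehlerIncl φ) b (symKaehlerMap a b w) (symKaehlerIncl φ') := by
  -- the lift along the formally etale map `b`
  have key {R : CommRingCat.{u}} (x : symKaehler φ ⟶ R) (y : B' ⟶ R)
      (h : symKaehlerIncl φ ≫ x = b ≫ y) : ∃ g : B' →+* DualNumber R,
      (∀ c, (g c).fst = y c) ∧ (∀ c, (g (b c)).snd = x (symKaehlerD φ c)) ∧
      ∀ c, (g (φ' c)).snd = 0 := by
    have hxy (c) : x (symKaehlerIncl φ c) = y (b c) := congr($h c)
    obtain ⟨g, h₁, h₂⟩ := exists_dual_lift hb.1 ((dualMap x.hom).comp (symKaehlerUniv φ)) y.hom hxy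
    refine ⟨g, h₂, fun c => congr($(h₁ c).snd), fun c => ?_⟩
    have : g.comp φ'.hom = (TrivSqZeroExt.inlHom R R).comp (y.hom.comp φ'.hom) := by
      refine dual_lift_unique ha.formallyUnramified _ _ (fun c => ?_) (fun c => h₂ _)
      have hw : φ' (a c) = b (φ c) := congr($w.symm c)
      change g (φ' (a c)) = TrivSqZeroExt.inl (y (φ' (a c)))
      rw [hw, h₁]
      refine TrivSqZeroExt.ext (hxy _) ?_
      change x (symKaehlerD φ (φ c)) = 0
      rw [symKaehlerD_base, map_zero]
    exact congr(($this c).snd)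
  refine ⟨⟨symKaehlerIncl_map a b w⟩, ⟨PushoutCocone.IsColimit.mk _
    (fun s => symKaehlerDesc φ' (key s.inl s.inr s.condition).choose
      (key s.inl s.inr s.condition).choose_spec.2.2) ?_ ?_ ?_⟩⟩
  · intro s
    obtain ⟨h₁, h₂, h₃⟩ := (key s.inl s.inr s.condition).choose_spec
    refine symKaehler_hom_ext (fun c => ?_) (fun c => ?_)
    · have : s.inl (symKaehlerIncl φ c) = s.inr (b c) := congr($s.condition c)
      rw [CommRingCat.comp_apply, symKaehlerMap_incl, symKaehlerDesc_incl, h₁, this]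
    · rw [CommRingCat.comp_apply, symKaehlerMap_d, symKaehlerDesc_d, h₂]
  · intro s
    obtain ⟨h₁, h₂, h₃⟩ := (key s.inl s.inr s.condition).choose_spec
    ext c
    rw [CommRingCat.comp_apply, symKaehlerDesc_incl, h₁]
  · intro s m hm₁ hm₂
    obtain ⟨h₁, h₂, h₃⟩ := (key s.inl s.inr s.condition).choose_spec
    have hm (c) : m (symKaehlerIncl φ' c) = s.inr c := congr($hm₂ c)
    have hd (c) : m (symKaehlerD φ' (b c)) = s.inl (symKaehlerD φ c) := by
      rw [← symKaehlerMap_d a b w]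
      exact congr($hm₁ _)
    have : (dualMap m.hom).comp (symKaehlerUniv φ') = (key s.inl s.inr s.condition).choose := by
      refine dual_lift_unique (R := s.pt) (a := b.hom) ?_ _ _ (fun c => ?_) (fun c => ?_)
      · exact hb.formallyUnramified
      · exact TrivSqZeroExt.ext ((hm _).trans (h₁ _).symm) ((hd _).trans (h₂ _).symm)
      · exact (hm c).trans (h₁ c).symm
    refine symKaehler_hom_ext (fun c => ?_) (fun c => ?_)
    · rw [hm, symKaehlerDesc_incl, h₁]
    · rw [symKaehlerDesc_d]
      exact congr(($this c).snd)

/-! ### Gluing -/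

/-- The pairs `(U, V)` of affine open subsets `U ⊆ Z` and `V ⊆ S` with `f(U) ⊆ V`. -/
structure AffinePair {Z S : Scheme.{u}} (f : Z ⟶ S) : Type u where
  U : Z.Opens
  V : S.Opens
  hU : IsAffineOpen U
  hV : IsAffineOpen V
  le : U ≤ f ⁻¹ᵁ V

namespace AffinePair

variable {Z S : Scheme.{u}} {f : Z ⟶ S}

instance : Preorder (AffinePair f) where
  le i j := i.U ≤ j.U ∧ i.V ≤ j.V
  le_refl i := ⟨le_rfl, le_rfl⟩
  le_trans _ _ _ h h' := ⟨h.1.trans h'.1, h.2.trans h'.2⟩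

lemma exists_mem (z : Z) (W : Z.Opens) (W' : S.Opens) (hz : z ∈ W) (hz' : f z ∈ W') :
    ∃ i : AffinePair f, z ∈ i.U ∧ i.U ≤ W ∧ i.V ≤ W' := by
  obtain ⟨V, hV, hzV, hVW⟩ := TopologicalSpace.Opens.isBasis_iff_nbhd.mp S.isBasis_affineOpens hz'
  obtain ⟨U, hU, hzU, hUW⟩ := TopologicalSpace.Opens.isBasis_iff_nbhd.mp Z.isBasis_affineOpens
    (show z ∈ W ⊓ f ⁻¹ᵁ V from ⟨hz, hzV⟩)
  exact ⟨⟨U, V, hU, hV, hUW.trans inf_le_right⟩, hzU, hUW.trans inf_le_left, hVW⟩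

/-- The ring homomorphism `Γ(S, V) ⟶ Γ(Z, U)`. -/
abbrev ringHom (i : AffinePair f) : Γ(S, i.V) ⟶ Γ(Z, i.U) := f.appLE i.V i.U i.le

variable (f) in
/-- The open cover of `Z` by the affine open subsets lying over affine open subsets of `S`. -/
abbrev cover : Z.OpenCover where
  I₀ := AffinePair f
  X i := Spec Γ(Z, i.U)
  f i := i.hU.fromSpec
  mem₀ := by
    rw [Scheme.presieve₀_mem_precoverage_iff]
    refine ⟨fun z => ?_, inferInstance⟩
    obtain ⟨i, hi, -, -⟩ := exists_mem (f := f) z ⊤ ⊤ trivial trivial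
    exact ⟨i, by rwa [i.hU.range_fromSpec]⟩

/-- The inclusion of the affine scheme `U` into the affine scheme `U'`. -/
abbrev trans {i j : AffinePair f} (h : i ≤ j) : Spec Γ(Z, i.U) ⟶ Spec Γ(Z, j.U) :=
  Spec.map (Z.presheaf.map (homOfLE h.1).op)

lemma trans_fromSpec {i j : AffinePair f} (h : i ≤ j) :
    trans h ≫ j.hU.fromSpec = i.hU.fromSpec :=
  j.hU.map_fromSpec i.hU _

instance {i j : AffinePair f} (h : i ≤ j) : IsOpenImmersion (trans h) := by
  have : IsOpenImmersion (trans h ≫ j.hU.fromSpec) := by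
    rw [trans_fromSpec]; infer_instance
  exact IsOpenImmersion.of_comp _ j.hU.fromSpec

instance : Scheme.Cover.LocallyDirected (cover f) where
  trans {i j} h := trans (leOfHom h)
  trans_id i := by
    refine (cancel_mono (IsAffineOpen.fromSpec i.hU)).mp ?_
    exact (trans_fromSpec _).trans (Category.id_comp _).symm
  trans_comp {i j k} h h' := by
    refine (cancel_mono (IsAffineOpen.fromSpec k.hU)).mp ?_
    rw [Category.assoc, trans_fromSpec, trans_fromSpec, trans_fromSpec]
  w {i j} h := trans_fromSpec _
  directed {i j} x := by
    let g : pullback ((cover f).f i) ((cover f).f j) ⟶ Z := pullback.fst _ _ ≫ (cover f).f i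
    have hi : g x ∈ i.U := by
      have : g x ∈ i.hU.fromSpec.opensRange := ⟨pullback.fst ((cover f).f i) ((cover f).f j) x, rfl⟩
      rwa [i.hU.opensRange_fromSpec] at this
    have hj : g x ∈ j.U := by
      have : g x ∈ j.hU.fromSpec.opensRange :=
        ⟨pullback.snd ((cover f).f i) ((cover f).f j) x, by
          have := pullback.condition (f := (cover f).f i) (g := (cover f).f j)
          exact congr($this.symm x)⟩
      rwa [j.hU.opensRange_fromSpec] at this
    obtain ⟨k, hk, hkU, hkV⟩ := exists_mem (f := f) (g x) (i.U ⊓ j.U) (i.V ⊓ j.V) ⟨hi, hj⟩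
      ⟨i.le hi, j.le hj⟩
    have hki : k ≤ i := ⟨hkU.trans inf_le_left, hkV.trans inf_le_left⟩
    have hkj : k ≤ j := ⟨hkU.trans inf_le_right, hkV.trans inf_le_right⟩
    rw [← k.hU.opensRange_fromSpec] at hk
    obtain ⟨y, hy⟩ := hk
    refine ⟨k, homOfLE hki, homOfLE hkj, y, ?_⟩
    have : IsOpenImmersion g := inferInstance
    apply g.isOpenEmbedding.injective
    refine Eq.trans ?_ hy
    have key : pullback.lift (f := (cover f).f i) (g := (cover f).f j) (trans hki) (trans hkj)
        ((trans_fromSpec hki).trans (trans_fromSpec hkj).symm) ≫ g = k.hU.fromSpec := by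
      rw [pullback.lift_fst_assoc]
      exact trans_fromSpec hki
    exact congr($key y)
  property_trans {i j} h := inferInstanceAs (IsOpenImmersion (trans (leOfHom h)))

lemma etale_presheaf_map {i j : AffinePair f} (h : i ≤ j) :
    (Z.presheaf.map (homOfLE h.1).op).hom.Etale := by
  have : Etale (trans h) := inferInstance
  rwa [HasRingHomProperty.Spec_iff (P := @Etale)] at this

lemma etale_presheaf_map' {i j : AffinePair f} (h : i ≤ j) :
    (S.presheaf.map (homOfLE h.2).op).hom.Etale := by
  have : IsOpenImmersion (Spec.map (S.presheaf.map (homOfLE h.2).op)) := by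
    have : IsOpenImmersion (Spec.map (S.presheaf.map (homOfLE h.2).op) ≫ j.hV.fromSpec) := by
      rw [j.hV.map_fromSpec i.hV]; infer_instance
    exact IsOpenImmersion.of_comp _ j.hV.fromSpec
  have : Etale (Spec.map (S.presheaf.map (homOfLE h.2).op)) := inferInstance
  rwa [HasRingHomProperty.Spec_iff (P := @Etale)] at this

lemma ringHom_map {i j : AffinePair f} (h : i ≤ j) :
    j.ringHom ≫ Z.presheaf.map (homOfLE h.1).op = S.presheaf.map (homOfLE h.2).op ≫ i.ringHom := by
  rw [Scheme.Hom.appLE_map, Scheme.Hom.map_appLE]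

variable (f) in
/-- The affine schemes `Spec Sym(Ω_{U/V})` over `U`, indexed by the pairs `(U, V)`, with the
transition maps induced by restriction of functions. -/
def gluingData : (cover f).RelativeGluingData where
  functor :=
    { obj (i : AffinePair f) := Spec (symKaehler i.ringHom)
      map {i j} h := Spec.map (symKaehlerMap _ _ (ringHom_map (leOfHom h)))
      map_id i := by
        refine (congrArg Spec.map (symKaehler_hom_ext (y := 𝟙 _) (fun b => ?_) (fun b => ?_))).trans
          (Spec.map_id _)
        · rw [symKaehlerMap_incl]
          exact congr(symKaehlerIncl i.ringHom ($(Z.presheaf.map_id _) b))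
        · rw [symKaehlerMap_d]
          exact congr(symKaehlerD i.ringHom ($(Z.presheaf.map_id _) b))
      map_comp {i j k} h h' := by
        have hc : Z.presheaf.map (homOfLE (leOfHom (h ≫ h')).1).op =
            Z.presheaf.map (homOfLE (leOfHom h').1).op ≫
              Z.presheaf.map (homOfLE (leOfHom h).1).op := by
          rw [← Z.presheaf.map_comp]; rfl
        rw [← Spec.map_comp]
        refine congrArg Spec.map (symKaehler_hom_ext (fun b => ?_) (fun b => ?_))
        · rw [CommRingCat.comp_apply, symKaehlerMap_incl, symKaehlerMap_incl, symKaehlerMap_incl]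
          exact congr(symKaehlerIncl i.ringHom ($hc b))
        · rw [CommRingCat.comp_apply, symKaehlerMap_d, symKaehlerMap_d, symKaehlerMap_d]
          exact congr(symKaehlerD i.ringHom ($hc b)) }
  natTrans :=
    { app (i : AffinePair f) := Spec.map (symKaehlerIncl i.ringHom)
      naturality {i j} h := by
        change Spec.map _ ≫ Spec.map _ = Spec.map _ ≫ Spec.map _
        rw [← Spec.map_comp, ← Spec.map_comp, symKaehlerIncl_map] }
  equifibered {i j} h := by
    exact (isPullback_SpecMap_of_isPushout _ _ _ _ (isPushout_symKaehlerMap _ _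
      (ringHom_map (leOfHom h)) (etale_presheaf_map' (leOfHom h))
      (etale_presheaf_map (leOfHom h))))

end AffinePair

open AffinePair

variable {Z S : Scheme.{u}} (f : Z ⟶ S)

/-- The tangent scheme `T_{Z/S} = Spec Sym(Ω_{Z/S})` of a morphism of schemes `Z ⟶ S`. -/
abbrev tangentScheme : Scheme.{u} := (gluingData f).glued

/-- The projection `T_{Z/S} ⟶ Z`. -/
def tangentProj : tangentScheme f ⟶ Z := (gluingData f).toBase

variable {f} in
/-- The open immersion `Spec Sym(Ω_{U/V}) ⟶ T_{Z/S}`. -/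
def chart (i : AffinePair f) : Spec (symKaehler i.ringHom) ⟶ tangentScheme f :=
  (gluingData f).cover.f i

lemma isPullback_chart (i : AffinePair f) :
    IsPullback (Spec.map (symKaehlerIncl i.ringHom)) (chart i) i.hU.fromSpec (tangentProj f) :=
  (gluingData f).isPullback_natTrans_ι_toBase i

instance (i : AffinePair f) : IsOpenImmersion (chart i) :=
  MorphismProperty.of_isPullback (isPullback_chart f i) inferInstance

lemma map_chart {i j : AffinePair f} (h : i ≤ j) :
    Spec.map (symKaehlerMap _ _ (ringHom_map h)) ≫ chart j = chart i :=
  Scheme.Cover.trans_map (gluingData f).cover (homOfLE h : (show (cover f).I₀ from i) ⟶ j)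

/-! ### Dual numbers -/

/-- `D = Spec ℤ[ε]`. -/
abbrev dualSpec : Scheme.{u} := Spec (.of (DualNumber (ULift.{u} ℤ)))

/-- `R ⟶ R[ε]`. -/
def dualIncl (R : CommRingCat.{u}) : R ⟶ CommRingCat.of (DualNumber R) :=
  CommRingCat.ofHom (TrivSqZeroExt.inlHom R R)

/-- `R[ε] ⟶ R`, `ε ↦ 0`. -/
def dualFst (R : CommRingCat.{u}) : CommRingCat.of (DualNumber R) ⟶ R :=
  CommRingCat.ofHom (TrivSqZeroExt.fstHom R R R).toRingHom

/-- `ℤ[ε] ⟶ R[ε]`. -/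
def dualInt (R : CommRingCat.{u}) :
    CommRingCat.of (DualNumber (ULift.{u} ℤ)) ⟶ CommRingCat.of (DualNumber R) :=
  CommRingCat.ofHom (dualMap ((Int.castRingHom R).comp ULift.ringEquiv.toRingHom))

/-- The ring homomorphism `R[ε] → Q`, `r + r'ε ↦ g r + g r' * e`, for `e * e = 0`. -/
def dualDesc {R Q : Type u} [CommRing R] [CommRing Q] (g : R →+* Q) (e : Q) (he : e * e = 0) :
    DualNumber R →+* Q where
  toFun x := g x.fst + g x.snd * e
  map_one' := by simp
  map_zero' := by simp
  map_add' x y := by simp; ring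
  map_mul' x y := by
    simp only [TrivSqZeroExt.fst_mul, DualNumber.snd_mul, map_mul, map_add]
    linear_combination (-g x.snd * g y.snd) * he

lemma dual_hom_ext' {R Q : CommRingCat.{u}} {x y : CommRingCat.of (DualNumber R) ⟶ Q}
    (h₁ : dualIncl R ≫ x = dualIncl R ≫ y)
    (h₂ : x (DualNumber.eps : DualNumber R) = y (DualNumber.eps : DualNumber R)) : x = y := by
  have h₁' (r : R) :
      x (TrivSqZeroExt.inl r : DualNumber R) = y (TrivSqZeroExt.inl r : DualNumber R) :=
    congr($h₁ r)
  refine CommRingCat.hom_ext (RingHom.ext fun c => ?_)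
  change x c = y c
  have hc : c = (TrivSqZeroExt.inl (TrivSqZeroExt.fst c) : DualNumber R) +
      (TrivSqZeroExt.inl (TrivSqZeroExt.snd c) : DualNumber R) * DualNumber.eps := by
    refine TrivSqZeroExt.ext ?_ ?_ <;> simp
  rw [hc, map_add, map_add, map_mul, map_mul, h₁', h₁', h₂]

lemma dualInt_eps (R : CommRingCat.{u}) : dualInt R (DualNumber.eps : DualNumber (ULift.{u} ℤ)) =
    (DualNumber.eps : DualNumber R) :=
  TrivSqZeroExt.ext (map_zero _) (map_one _)

lemma isPushout_dual (R : CommRingCat.{u}) :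
    IsPushout (CommRingCat.isInitial.to R)
      (dualIncl (.of (ULift.{u} ℤ))) (dualIncl R) (dualInt R) := by
  refine ⟨⟨CommRingCat.isInitial.hom_ext _ _⟩, ⟨PushoutCocone.IsColimit.mk _
    (fun s => CommRingCat.ofHom (dualDesc s.inl.hom
      (s.inr (DualNumber.eps : DualNumber (ULift.{u} ℤ))) ?_)) ?_ ?_ ?_⟩⟩
  · rw [← map_mul, DualNumber.eps_mul_eps, map_zero]
  · intro s
    refine CommRingCat.hom_ext (RingHom.ext fun c => ?_)
    change s.inl c + s.inl 0 * _ = s.inl c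
    simp
  · intro s
    refine dual_hom_ext' (R := .of (ULift.{u} ℤ)) (CommRingCat.isInitial.hom_ext _ _) ?_
    rw [CommRingCat.comp_apply, dualInt_eps]
    change s.inl 0 + s.inl 1 * _ = _
    simp
  · intro s m h₁ h₂
    refine dual_hom_ext' ?_ ?_
    · refine h₁.trans (CommRingCat.hom_ext (RingHom.ext fun c => ?_))
      change s.inl c = s.inl c + s.inl 0 * _
      simp
    · have : m (dualInt R (DualNumber.eps : DualNumber (ULift.{u} ℤ))) =
        s.inr (DualNumber.eps : DualNumber (ULift.{u} ℤ)) := congr($h₂ _)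
      rw [dualInt_eps] at this
      rw [this]
      change _ = s.inl 0 + s.inl 1 * _
      simp

/-- `Spec R[ε]` is the product of `Spec R` and `D`. -/
def isLimitSpecDual (R : CommRingCat.{u}) :
    IsLimit (BinaryFan.mk (Spec.map (dualIncl R)) (Spec.map (dualInt R) : _ ⟶ dualSpec.{u})) :=
  isProductOfIsTerminalIsPullback _ _ _ _ specULiftZIsTerminal
    (isPullback_SpecMap_of_isPushout _ _ _ _ (isPushout_dual R)).isLimit

/-- `Spec R[ε] ≅ Spec R × D`. -/
def specDualIso (R : CommRingCat.{u}) :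
    Spec (.of (DualNumber R)) ≅ Spec R ⨯ dualSpec.{u} :=
  (isLimitSpecDual R).conePointUniqueUpToIso (limit.isLimit _)

lemma specDualIso_hom_fst (R : CommRingCat.{u}) :
    (specDualIso R).hom ≫ prod.fst = Spec.map (dualIncl R) :=
  (isLimitSpecDual R).conePointUniqueUpToIso_hom_comp (limit.isLimit _) ⟨.left⟩

lemma specDualIso_hom_snd (R : CommRingCat.{u}) :
    (specDualIso R).hom ≫ prod.snd = Spec.map (dualInt R) :=
  (isLimitSpecDual R).conePointUniqueUpToIso_hom_comp (limit.isLimit _) ⟨.right⟩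

/-- The point `ε = 0` of `D`. -/
def dualZero (W : Scheme.{u}) : W ⟶ dualSpec.{u} :=
  specULiftZIsTerminal.from W ≫ Spec.map (dualFst (.of (ULift.{u} ℤ)))

lemma comp_dualZero {W W' : Scheme.{u}} (k : W ⟶ W') : k ≫ dualZero W' = dualZero W := by
  rw [dualZero, ← Category.assoc, specULiftZIsTerminal.hom_ext (k ≫ _)]
  rfl

/-- The section `W ⟶ W × D`, `ε ↦ 0`. -/
def zeroSec (W : Scheme.{u}) : W ⟶ W ⨯ dualSpec.{u} := prod.lift (𝟙 W) (dualZero W)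

lemma zeroSec_map {W W' : Scheme.{u}} (k : W ⟶ W') :
    zeroSec W ≫ prod.map k (𝟙 _) = k ≫ zeroSec W' := by
  ext <;> simp [zeroSec, comp_dualZero]

lemma SpecMap_dualFst_iso (R : CommRingCat.{u}) :
    Spec.map (dualFst R) ≫ (specDualIso R).hom = zeroSec (Spec R) := by
  ext1
  · rw [Category.assoc, specDualIso_hom_fst, ← Spec.map_comp, zeroSec, prod.lift_fst]
    exact Spec.map_id R
  · rw [Category.assoc, specDualIso_hom_snd, ← Spec.map_comp, zeroSec, prod.lift_snd, dualZero,
      specULiftZIsTerminal.hom_ext (specULiftZIsTerminal.from _)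
        (Spec.map (CommRingCat.isInitial.to R)), ← Spec.map_comp]
    congr 1

lemma zeroSec_fst (W : Scheme.{u}) : zeroSec W ≫ prod.fst = 𝟙 W := prod.lift_fst _ _

/-- `Spec R[ε] ⟶ Spec R'[ε]` -/
lemma map_specDualIso {R R' : CommRingCat.{u}} (g : R ⟶ R') :
    Spec.map (CommRingCat.ofHom (dualMap g.hom)) ≫ (specDualIso R).hom =
      (specDualIso R').hom ≫ prod.map (Spec.map g) (𝟙 _) := by
  ext1
  · rw [Category.assoc, specDualIso_hom_fst, Category.assoc, prod.map_fst,
      reassoc_of% @specDualIso_hom_fst, ← Spec.map_comp, ← Spec.map_comp]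
    congr 1
    refine CommRingCat.hom_ext (RingHom.ext fun c => TrivSqZeroExt.ext rfl (map_zero g.hom))
  · rw [Category.assoc, specDualIso_hom_snd, Category.assoc, prod.map_snd, Category.comp_id,
      specDualIso_hom_snd, ← Spec.map_comp]
    congr 1
    refine dual_hom_ext' (R := .of (ULift.{u} ℤ)) (CommRingCat.isInitial.hom_ext _ _) ?_
    rw [CommRingCat.comp_apply, dualInt_eps, dualInt_eps]
    exact TrivSqZeroExt.ext (map_zero g.hom) (map_one g.hom)

lemma zeroSec_surjective (R : CommRingCat.{u}) : Function.Surjective (zeroSec (Spec R)) := by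
  rw [← SpecMap_dualFst_iso]
  have h : Function.Surjective (Spec.map (dualFst R)) := by
    refine (PrimeSpectrum.isHomeomorph_comap (dualFst R).hom
      (fun x => ⟨1, one_pos, TrivSqZeroExt.inl x, by rw [pow_one]; rfl⟩) (fun x hx => ?_)).surjective
    refine ⟨2, ?_⟩
    have hx : x ∈ TrivSqZeroExt.kerIdeal R R := hx
    have := Ideal.pow_mem_pow hx 2
    rwa [TrivSqZeroExt.kerIdeal_sq] at this
  intro x
  obtain ⟨y, rfl⟩ := (specDualIso R).hom.surjective x
  obtain ⟨z, rfl⟩ := h y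
  exact ⟨z, rfl⟩

lemma exists_lift_of_zeroSec {R : CommRingCat.{u}} {Z P : Scheme.{u}}
    (g : Spec R ⨯ dualSpec.{u} ⟶ Z) (j : P ⟶ Z) [IsOpenImmersion j] (k : Spec R ⟶ P)
    (h : zeroSec _ ≫ g = k ≫ j) : ∃ g' : Spec R ⨯ dualSpec.{u} ⟶ P, g' ≫ j = g := by
  refine ⟨IsOpenImmersion.lift j g ?_, IsOpenImmersion.lift_fac _ _ _⟩
  rintro _ ⟨x, rfl⟩
  obtain ⟨y, rfl⟩ := zeroSec_surjective R x
  refine ⟨k y, ?_⟩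
  exact congr($h.symm y)

/-! ### The universal property of the tangent scheme -/

section Affine

variable {A B : CommRingCat.{u}} (φ : A ⟶ B)

/-- The universal morphism `Spec Sym(Ω_{B/A}) × D ⟶ Spec B`, `b ↦ b + (db)ε`. -/
def affineUniv : Spec (symKaehler φ) ⨯ dualSpec.{u} ⟶ Spec B :=
  (specDualIso _).inv ≫ Spec.map (CommRingCat.ofHom (symKaehlerUniv φ))

lemma specDualIso_affineUniv : (specDualIso _).hom ≫ affineUniv φ =
    Spec.map (CommRingCat.ofHom (symKaehlerUniv φ)) :=
  (specDualIso _).hom_inv_id_assoc _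

lemma zeroSec_affineUniv : zeroSec _ ≫ affineUniv φ = Spec.map (symKaehlerIncl φ) := by
  rw [← SpecMap_dualFst_iso, Category.assoc, specDualIso_affineUniv, ← Spec.map_comp]
  rfl

lemma affineUniv_comp :
    affineUniv φ ≫ Spec.map φ = prod.fst ≫ Spec.map (symKaehlerIncl φ) ≫ Spec.map φ := by
  rw [← cancel_epi (specDualIso _).hom, reassoc_of% @specDualIso_affineUniv, reassoc_of% @specDualIso_hom_fst,
    ← Spec.map_comp, ← Spec.map_comp, ← Spec.map_comp]
  congr 1
  exact CommRingCat.hom_ext (RingHom.ext fun c => TrivSqZeroExt.ext rfl (symKaehlerD_base φ c))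

variable {φ} in
lemma map_affineUniv {A' B' : CommRingCat.{u}} {φ' : A' ⟶ B'} (a : A ⟶ A') (b : B ⟶ B')
    (w : φ ≫ b = a ≫ φ') :
    prod.map (Spec.map (symKaehlerMap a b w)) (𝟙 _) ≫ affineUniv φ =
      affineUniv φ' ≫ Spec.map b := by
  rw [← cancel_epi (specDualIso _).hom, ← Category.assoc, ← map_specDualIso, Category.assoc,
    specDualIso_affineUniv, reassoc_of% @specDualIso_affineUniv, ← Spec.map_comp, ← Spec.map_comp]
  congr 1
  exact CommRingCat.hom_ext (RingHom.ext fun c =>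
    TrivSqZeroExt.ext (symKaehlerMap_incl a b w c) (symKaehlerMap_d a b w c))

variable {φ} in
lemma affineUniv_unique {R : CommRingCat.{u}} {h h' : Spec R ⟶ Spec (symKaehler φ)}
    (e : prod.map h (𝟙 _) ≫ affineUniv φ = prod.map h' (𝟙 _) ≫ affineUniv φ) : h = h' := by
  obtain ⟨h, rfl⟩ := Spec.map_surjective h
  obtain ⟨h', rfl⟩ := Spec.map_surjective h'
  rw [← cancel_epi (specDualIso _).hom, ← Category.assoc, ← map_specDualIso, Category.assoc,
    specDualIso_affineUniv, ← Category.assoc _ (prod.map _ _), ← map_specDualIso, Category.assoc,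
    specDualIso_affineUniv, ← Spec.map_comp, ← Spec.map_comp] at e
  have e' := Spec.map_injective e
  congr 1
  exact symKaehler_hom_ext (fun c => congr(($e' c).fst)) (fun c => congr(($e' c).snd))

lemma affineUniv_exists {R : CommRingCat.{u}} (g : Spec R ⨯ dualSpec.{u} ⟶ Spec B)
    (hg : g ≫ Spec.map φ = prod.fst ≫ zeroSec _ ≫ g ≫ Spec.map φ) :
    ∃ h : Spec R ⟶ Spec (symKaehler φ), prod.map h (𝟙 _) ≫ affineUniv φ = g := by
  obtain ⟨k, hk⟩ := Spec.map_surjective ((specDualIso R).hom ≫ g)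
  rw [← cancel_epi (specDualIso _).hom, ← Category.assoc, ← hk, reassoc_of% @specDualIso_hom_fst,
    ← SpecMap_dualFst_iso, Category.assoc, ← Category.assoc (specDualIso R).hom, ← hk,
    ← Spec.map_comp, ← Spec.map_comp, ← Spec.map_comp] at hg
  have hg' := Spec.map_injective hg
  refine ⟨Spec.map (symKaehlerDesc φ k.hom fun a => congr(($hg' a).snd)), ?_⟩
  rw [← cancel_epi (specDualIso _).hom, ← Category.assoc, ← map_specDualIso, Category.assoc,
    specDualIso_affineUniv, ← Spec.map_comp, ← hk]
  congr 1
  exact CommRingCat.hom_ext (RingHom.ext fun c => TrivSqZeroExt.ext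
    (symKaehlerDesc_incl φ k.hom _ c) (symKaehlerDesc_d φ k.hom _ c))

end Affine

lemma prod_hom_ext_of_cover {W Q : Scheme.{u}} (𝒱 : W.OpenCover) {a b : W ⨯ dualSpec.{u} ⟶ Q}
    (h : ∀ i, prod.map (𝒱.f i) (𝟙 _) ≫ a = prod.map (𝒱.f i) (𝟙 _) ≫ b) : a = b := by
  refine Scheme.Cover.hom_ext (𝒱.pullback₁ prod.fst) _ _ fun (i : 𝒱.I₀) => ?_
  have : pullback.fst (prod.fst : W ⨯ dualSpec.{u} ⟶ W) (𝒱.f i) =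
      prod.lift (pullback.snd prod.fst (𝒱.f i)) (pullback.fst prod.fst (𝒱.f i) ≫ prod.snd) ≫
        prod.map (𝒱.f i) (𝟙 _) := by
    apply Limits.prod.hom_ext
    · rw [Category.assoc, prod.map_fst, prod.lift_fst_assoc, pullback.condition]
    · rw [Category.assoc, prod.map_snd, prod.lift_snd_assoc, Category.comp_id]
  change pullback.fst (prod.fst : W ⨯ dualSpec.{u} ⟶ W) (𝒱.f i) ≫ a =
    pullback.fst (prod.fst : W ⨯ dualSpec.{u} ⟶ W) (𝒱.f i) ≫ b
  rw [this, Category.assoc, Category.assoc, h]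

variable {f} in
lemma prod_chart_hom_ext {Q : Scheme.{u}} {a b : tangentScheme f ⨯ dualSpec.{u} ⟶ Q}
    (h : ∀ i : AffinePair f, prod.map (chart i) (𝟙 _) ≫ a = prod.map (chart i) (𝟙 _) ≫ b) :
    a = b :=
  prod_hom_ext_of_cover (gluingData f).cover h

variable {f} in
lemma chart_hom_ext {Q : Scheme.{u}} {a b : tangentScheme f ⟶ Q}
    (h : ∀ i : AffinePair f, chart i ≫ a = chart i ≫ b) : a = b :=
  Scheme.Cover.hom_ext (gluingData f).cover _ _ h

/-- The universal morphism over the open subscheme `Spec Sym(Ω_{U/V}) × D`. -/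
def tangentUnivAux (i : AffinePair f) :
    pullback (prod.fst : tangentScheme f ⨯ dualSpec.{u} ⟶ _) (chart i) ⟶ Z :=
  prod.lift (pullback.snd prod.fst (chart i)) (pullback.fst prod.fst (chart i) ≫ prod.snd) ≫
    affineUniv _ ≫ i.hU.fromSpec

lemma tangentUnivAux_compat {i j : ((gluingData f).cover.pullback₁
      (prod.fst : tangentScheme f ⨯ dualSpec.{u} ⟶ _)).I₀} (h : i ⟶ j) :
    Scheme.Cover.trans ((gluingData f).cover.pullback₁
      (prod.fst : tangentScheme f ⨯ dualSpec.{u} ⟶ _)) h ≫ tangentUnivAux f j =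
      tangentUnivAux f i := by
  let i' : AffinePair f := i
  let j' : AffinePair f := j
  have h' : i' ≤ j' := leOfHom h
  let τ := Spec.map (symKaehlerMap _ _ (ringHom_map h'))
  have e : (prod.lift (pullback.snd (prod.fst (X := tangentScheme f) (Y := dualSpec.{u}))
      (chart i')) (pullback.fst prod.fst (chart i') ≫ prod.snd) ≫ prod.map τ (𝟙 _)) =
      pullback.map prod.fst (chart i') prod.fst (chart j') (𝟙 _) τ (𝟙 _) (by simp)
        (by rw [Category.comp_id]; exact (map_chart f h').symm) ≫
      prod.lift (pullback.snd prod.fst (chart j'))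
        (pullback.fst prod.fst (chart j') ≫ prod.snd) := by
    apply Limits.prod.hom_ext
    · rw [Category.assoc, Category.assoc, prod.map_fst, prod.lift_fst_assoc, prod.lift_fst,
        pullback.lift_snd]
    · rw [Category.assoc, Category.assoc, prod.map_snd, prod.lift_snd_assoc, prod.lift_snd,
        pullback.lift_fst_assoc, Category.comp_id, Category.comp_id]
  refine (Category.assoc _ _ _).symm.trans ((congr($e.symm ≫ _)).trans ?_)
  rw [Category.assoc, reassoc_of% @map_affineUniv]
  exact congr(_ ≫ _ ≫ $(trans_fromSpec h'))

/-- The universal morphism `T_{Z/S} × D ⟶ Z`, given by `b ↦ b + (db)ε` on affine open subsets. -/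
def tangentUniv : tangentScheme f ⨯ dualSpec.{u} ⟶ Z :=
  Scheme.OpenCover.glueMorphismsOfLocallyDirected ((gluingData f).cover.pullback₁ prod.fst)
    (tangentUnivAux f) (tangentUnivAux_compat f)

lemma chart_tangentUniv (i : AffinePair f) :
    prod.map (chart i) (𝟙 _) ≫ tangentUniv f = affineUniv _ ≫ i.hU.fromSpec := by
  have e : prod.map (chart i) (𝟙 _) =
      pullback.lift (f := prod.fst) (g := chart i) (prod.map (chart i) (𝟙 dualSpec.{u})) prod.fst
        (by simp) ≫ ((gluingData f).cover.pullback₁ prod.fst).f i :=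
    (pullback.lift_fst _ _ _).symm
  refine (congr($e ≫ _)).trans ((Category.assoc _ _ _).trans ((congrArg _
    (Scheme.OpenCover.map_glueMorphismsOfLocallyDirected _ _ (tangentUnivAux_compat f) _)).trans ?_))
  refine (Category.assoc _ _ _).symm.trans ((congrArg (· ≫ _) ?_).trans (Category.id_comp _))
  apply Limits.prod.hom_ext
  · rw [Category.assoc, prod.lift_fst, pullback.lift_snd, Category.id_comp]
  · rw [Category.assoc, prod.lift_snd, pullback.lift_fst_assoc, prod.map_snd, Category.id_comp,
      Category.comp_id]

lemma zeroSec_tangentUniv : zeroSec _ ≫ tangentUniv f = tangentProj f := by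
  refine chart_hom_ext fun i => ?_
  rw [← (isPullback_chart f i).w, ← reassoc_of% @zeroSec_map, chart_tangentUniv, reassoc_of% @zeroSec_affineUniv]

lemma tangentUniv_comp : tangentUniv f ≫ f = prod.fst ≫ tangentProj f ≫ f := by
  refine prod_chart_hom_ext fun i => ?_
  rw [reassoc_of% @chart_tangentUniv, ← IsAffineOpen.SpecMap_appLE_fromSpec f i.hV i.hU i.le,
    reassoc_of% affineUniv_comp, IsAffineOpen.SpecMap_appLE_fromSpec f i.hV i.hU i.le,
    prod.map_fst_assoc, reassoc_of% (isPullback_chart f i).w]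

lemma exists_local {W : Scheme.{u}} (g : W ⟶ Z) (x : W) :
    ∃ (R : CommRingCat.{u}) (k : Spec R ⟶ W) (_ : IsOpenImmersion k) (i : AffinePair f)
      (k' : Spec R ⟶ Spec Γ(Z, i.U)), x ∈ Set.range k ∧ k ≫ g = k' ≫ i.hU.fromSpec := by
  obtain ⟨i, hi, -, -⟩ := exists_mem (f := f) (g x) ⊤ ⊤ trivial trivial
  obtain ⟨U, hU, hxU, hUi⟩ := TopologicalSpace.Opens.isBasis_iff_nbhd.mp W.isBasis_affineOpens
    (show x ∈ g ⁻¹ᵁ i.U from hi)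
  have hU : IsAffineOpen U := hU
  refine ⟨Γ(W, U), hU.fromSpec, inferInstance, i, Spec.map (g.appLE i.U U hUi), ?_, ?_⟩
  · rwa [hU.range_fromSpec]
  · rw [IsAffineOpen.SpecMap_appLE_fromSpec]

/-- An open cover from a choice of affine open neighbourhoods. -/
abbrev coverOfLocal {W : Scheme.{u}} (R : W → CommRingCat.{u}) (k : ∀ x, Spec (R x) ⟶ W)
    (hk : ∀ x, IsOpenImmersion (k x)) (hx : ∀ x, x ∈ Set.range (k x)) : W.OpenCover where
  I₀ := W
  X x := Spec (R x)
  f := k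
  mem₀ := by
    rw [Scheme.presieve₀_mem_precoverage_iff]
    exact ⟨fun x => ⟨x, hx x⟩, hk⟩

variable {f} in
lemma tangentUniv_unique {W : Scheme.{u}} {h h' : W ⟶ tangentScheme f}
    (e : prod.map h (𝟙 _) ≫ tangentUniv f = prod.map h' (𝟙 _) ≫ tangentUniv f) : h = h' := by
  have e₀ : h ≫ tangentProj f = h' ≫ tangentProj f := by
    rw [← zeroSec_tangentUniv, ← reassoc_of% @zeroSec_map, ← reassoc_of% @zeroSec_map, e]
  choose R k hk i k' hx hkk using exists_local f (h ≫ tangentProj f)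
  refine Scheme.Cover.hom_ext (coverOfLocal R k hk hx) _ _ fun (x : W) => ?_
  change k x ≫ h = k x ≫ h'
  obtain ⟨m, hm₁, hm₂⟩ := (isPullback_chart f (i x)).exists_lift (k' x) (k x ≫ h)
    (by rw [Category.assoc, hkk])
  obtain ⟨m', hm'₁, hm'₂⟩ := (isPullback_chart f (i x)).exists_lift (k' x) (k x ≫ h')
    (by rw [Category.assoc, ← e₀, hkk])
  rw [← hm₂, ← hm'₂]
  congr 1
  refine affineUniv_unique ?_
  rw [← cancel_mono (i x).hU.fromSpec, Category.assoc, Category.assoc, ← chart_tangentUniv,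
    prod.map_map_assoc, prod.map_map_assoc, hm₂, hm'₂, Category.comp_id]
  have e' := prod.map (k x) (𝟙 _) ≫= e
  rwa [prod.map_map_assoc, prod.map_map_assoc, Category.comp_id] at e'

variable {f} in
lemma tangentUniv_exists {W : Scheme.{u}} (g : W ⨯ dualSpec.{u} ⟶ Z)
    (hg : g ≫ f = prod.fst ≫ zeroSec _ ≫ g ≫ f) :
    ∃ h : W ⟶ tangentScheme f, prod.map h (𝟙 _) ≫ tangentUniv f = g := by
  choose R k hk i k' hx hkk using exists_local f (zeroSec _ ≫ g)
  have key (x : W) : ∃ h : Spec (R x) ⟶ tangentScheme f,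
      prod.map h (𝟙 _) ≫ tangentUniv f = prod.map (k x) (𝟙 _) ≫ g := by
    obtain ⟨g', hg'⟩ := exists_lift_of_zeroSec (prod.map (k x) (𝟙 _) ≫ g) (i x).hU.fromSpec (k' x)
      (by rw [reassoc_of% @zeroSec_map, hkk])
    have hs : Spec.map (i x).ringHom ≫ (i x).hV.fromSpec = (i x).hU.fromSpec ≫ f :=
      IsAffineOpen.SpecMap_appLE_fromSpec f _ _ _
    obtain ⟨h, hh⟩ := affineUniv_exists (i x).ringHom g' (by
      rw [← cancel_mono (i x).hV.fromSpec]
      simp only [Category.assoc]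
      rw [hs, reassoc_of% hg', hg, prod.map_fst_assoc, reassoc_of% @zeroSec_fst])
    refine ⟨h ≫ chart (i x), ?_⟩
    rw [← hg', ← hh, Category.assoc, ← chart_tangentUniv, prod.map_map_assoc, Category.comp_id]
  choose h hh using key
  let 𝒱 := coverOfLocal R k hk hx
  have hglue (x y : W) : pullback.fst (k x) (k y) ≫ h x = pullback.snd (k x) (k y) ≫ h y := by
    refine tangentUniv_unique ?_
    have (a : W) {P : Scheme.{u}} (b : P ⟶ Spec (R a)) :
        prod.map (b ≫ h a) (𝟙 _) ≫ tangentUniv f = prod.map (b ≫ k a) (𝟙 _) ≫ g := by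
      have := prod.map b (𝟙 _) ≫= hh a
      rwa [prod.map_map_assoc, prod.map_map_assoc, Category.comp_id] at this
    rw [this, this, pullback.condition]
  refine ⟨Scheme.Cover.glueMorphisms 𝒱 h hglue, ?_⟩
  refine prod_hom_ext_of_cover 𝒱 fun (x : W) => ?_
  rw [prod.map_map_assoc, Scheme.Cover.ι_glueMorphisms 𝒱 h hglue x, Category.comp_id]
  exact hh x

/-! ### Addition of tangent vectors -/

/-- If `x, y : B → R[ε]` have the same constant term, this is `b ↦ x₀ b + (x₁ b + y₁ b)ε`. -/
def dualAdd {B R : Type u} [CommRing B] [CommRing R] (x y : B →+* DualNumber R)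
    (h : ∀ b, (x b).fst = (y b).fst) : B →+* DualNumber R where
  toFun b := TrivSqZeroExt.inl (x b).fst + TrivSqZeroExt.inr ((x b).snd + (y b).snd)
  map_one' := by ext <;> simp
  map_zero' := by ext <;> simp
  map_add' b b' := by ext <;> simp; ring
  map_mul' b b' := by ext <;> simp [h b, h b']; ring

section AffineAdd

variable {A B : CommRingCat.{u}} (φ : A ⟶ B)

/-- For `α, β : Sym_B(Ω_{B/A}) → R` that agree on `B`, the homomorphism `Sym_B(Ω_{B/A}) → R`
with `b ↦ α b` and `db ↦ α(db) + β(db)`. -/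
def symKaehlerAdd {R : CommRingCat.{u}} (α β : symKaehler φ ⟶ R)
    (h : symKaehlerIncl φ ≫ α = symKaehlerIncl φ ≫ β) : symKaehler φ ⟶ R :=
  symKaehlerDesc φ
    (dualAdd ((dualMap α.hom).comp (symKaehlerUniv φ)) ((dualMap β.hom).comp (symKaehlerUniv φ))
      fun b => congr($h b))
    fun a => by
      change TrivSqZeroExt.snd (TrivSqZeroExt.inl _ + TrivSqZeroExt.inr
        (α (symKaehlerD φ (φ a)) + β (symKaehlerD φ (φ a))) : DualNumber R) = 0
      rw [symKaehlerD_base]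
      simp

lemma symKaehlerAdd_incl {R : CommRingCat.{u}} (α β : symKaehler φ ⟶ R)
    (h : symKaehlerIncl φ ≫ α = symKaehlerIncl φ ≫ β) (b : B) :
    symKaehlerAdd φ α β h (symKaehlerIncl φ b) = α (symKaehlerIncl φ b) := by
  refine (symKaehlerDesc_incl φ _ _ b).trans ?_
  change TrivSqZeroExt.fst (TrivSqZeroExt.inl _ + TrivSqZeroExt.inr _ : DualNumber R) = _
  simp
  rfl

lemma symKaehlerAdd_d {R : CommRingCat.{u}} (α β : symKaehler φ ⟶ R)
    (h : symKaehlerIncl φ ≫ α = symKaehlerIncl φ ≫ β) (b : B) :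
    symKaehlerAdd φ α β h (symKaehlerD φ b) = α (symKaehlerD φ b) + β (symKaehlerD φ b) := by
  refine (symKaehlerDesc_d φ _ _ b).trans ?_
  change TrivSqZeroExt.snd (TrivSqZeroExt.inl _ + TrivSqZeroExt.inr _ : DualNumber R) = _
  simp
  rfl

lemma symKaehlerIncl_add {R : CommRingCat.{u}} (α β : symKaehler φ ⟶ R)
    (h : symKaehlerIncl φ ≫ α = symKaehlerIncl φ ≫ β) :
    symKaehlerIncl φ ≫ symKaehlerAdd φ α β h = symKaehlerIncl φ ≫ α :=
  CommRingCat.hom_ext (RingHom.ext fun b => symKaehlerAdd_incl φ α β h b)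

/-- The ring homomorphism `C ⟶ Γ(W)` corresponding to `W ⟶ Spec C`. -/
def globalHom {C : CommRingCat.{u}} {W : Scheme.{u}} (a : W ⟶ Spec C) : C ⟶ Γ(W, ⊤) :=
  (Scheme.ΓSpecIso C).inv ≫ a.appTop

lemma toSpecΓ_globalHom {C : CommRingCat.{u}} {W : Scheme.{u}} (a : W ⟶ Spec C) :
    W.toSpecΓ ≫ Spec.map (globalHom a) = a := by
  rw [globalHom, Spec.map_comp, ← Scheme.toSpecΓ_naturality_assoc]
  simp

lemma globalHom_comp_specMap {C C' : CommRingCat.{u}} {W : Scheme.{u}} (a : W ⟶ Spec C)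
    (g : C' ⟶ C) : globalHom (a ≫ Spec.map g) = g ≫ globalHom a := by
  simp [globalHom, Scheme.ΓSpecIso_inv_naturality_assoc]

lemma globalHom_comp {C : CommRingCat.{u}} {W W' : Scheme.{u}} (k : W' ⟶ W) (a : W ⟶ Spec C) :
    globalHom (k ≫ a) = globalHom a ≫ k.appTop := by
  simp [globalHom]

/-- The sum of two `W`-points of `Spec Sym_B(Ω_{B/A})` over the same `W`-point of `Spec B`. -/
def affineAdd {W : Scheme.{u}} (a b : W ⟶ Spec (symKaehler φ))
    (h : a ≫ Spec.map (symKaehlerIncl φ) = b ≫ Spec.map (symKaehlerIncl φ)) :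
    W ⟶ Spec (symKaehler φ) :=
  W.toSpecΓ ≫ Spec.map (symKaehlerAdd φ (globalHom a) (globalHom b)
    (by rw [← globalHom_comp_specMap, h, globalHom_comp_specMap]))

lemma affineAdd_incl {W : Scheme.{u}} (a b : W ⟶ Spec (symKaehler φ))
    (h : a ≫ Spec.map (symKaehlerIncl φ) = b ≫ Spec.map (symKaehlerIncl φ)) :
    affineAdd φ a b h ≫ Spec.map (symKaehlerIncl φ) = a ≫ Spec.map (symKaehlerIncl φ) := by
  rw [affineAdd, Category.assoc, ← Spec.map_comp, symKaehlerIncl_add, Spec.map_comp,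
    ← Category.assoc, toSpecΓ_globalHom]

lemma comp_affineAdd {W W' : Scheme.{u}} (k : W' ⟶ W) (a b : W ⟶ Spec (symKaehler φ))
    (h : a ≫ Spec.map (symKaehlerIncl φ) = b ≫ Spec.map (symKaehlerIncl φ)) :
    k ≫ affineAdd φ a b h =
      affineAdd φ (k ≫ a) (k ≫ b) (by rw [Category.assoc, h, Category.assoc]) := by
  rw [affineAdd, affineAdd, ← Category.assoc, Scheme.toSpecΓ_naturality, Category.assoc,
    ← Spec.map_comp]
  congr 2
  refine symKaehler_hom_ext (fun c => ?_) (fun c => ?_)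
  · rw [CommRingCat.comp_apply, symKaehlerAdd_incl, symKaehlerAdd_incl, globalHom_comp,
      CommRingCat.comp_apply]
  · rw [CommRingCat.comp_apply, symKaehlerAdd_d, symKaehlerAdd_d, globalHom_comp, globalHom_comp,
      CommRingCat.comp_apply, CommRingCat.comp_apply, map_add]

variable {φ} in
lemma affineAdd_comp {A' B' : CommRingCat.{u}} {φ' : A' ⟶ B'} (α : A ⟶ A') (β : B ⟶ B')
    (w : φ ≫ β = α ≫ φ') {W : Scheme.{u}} (a b : W ⟶ Spec (symKaehler φ'))
    (h : a ≫ Spec.map (symKaehlerIncl φ') = b ≫ Spec.map (symKaehlerIncl φ'))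
    (h' : (a ≫ Spec.map (symKaehlerMap α β w)) ≫ Spec.map (symKaehlerIncl φ) =
      (b ≫ Spec.map (symKaehlerMap α β w)) ≫ Spec.map (symKaehlerIncl φ)) :
    affineAdd φ' a b h ≫ Spec.map (symKaehlerMap α β w) =
      affineAdd φ (a ≫ Spec.map (symKaehlerMap α β w)) (b ≫ Spec.map (symKaehlerMap α β w)) h' := by
  rw [affineAdd, affineAdd, Category.assoc, ← Spec.map_comp]
  congr 2
  refine symKaehler_hom_ext (fun c => ?_) (fun c => ?_)
  · rw [CommRingCat.comp_apply, symKaehlerMap_incl, symKaehlerAdd_incl, symKaehlerAdd_incl,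
      globalHom_comp_specMap, CommRingCat.comp_apply, symKaehlerMap_incl]
  · rw [CommRingCat.comp_apply, symKaehlerMap_d, symKaehlerAdd_d, symKaehlerAdd_d,
      globalHom_comp_specMap, globalHom_comp_specMap, CommRingCat.comp_apply,
      CommRingCat.comp_apply, symKaehlerMap_d]

end AffineAdd

variable {f} in
/-- The restriction of a `W`-point of `T_{Z/S}` to the preimage of `U`. -/
def restr {W : Scheme.{u}} (a : W ⟶ tangentScheme f) (g : W ⟶ Z) (h : a ≫ tangentProj f = g)
    (i : AffinePair f) : pullback g i.hU.fromSpec ⟶ Spec (symKaehler i.ringHom) :=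
  (isPullback_chart f i).lift (pullback.snd _ _) (pullback.fst _ _ ≫ a)
    (by rw [Category.assoc, h, pullback.condition])

variable {f} in
lemma restr_chart {W : Scheme.{u}} (a : W ⟶ tangentScheme f) (g : W ⟶ Z)
    (h : a ≫ tangentProj f = g) (i : AffinePair f) :
    restr a g h i ≫ chart i = pullback.fst _ _ ≫ a :=
  (isPullback_chart f i).lift_snd _ _ _

variable {f} in
lemma restr_incl {W : Scheme.{u}} (a : W ⟶ tangentScheme f) (g : W ⟶ Z)
    (h : a ≫ tangentProj f = g) (i : AffinePair f) :
    restr a g h i ≫ Spec.map (symKaehlerIncl i.ringHom) = pullback.snd _ _ :=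
  (isPullback_chart f i).lift_fst _ _ _

variable {f} in
/-- The sum of two `W`-points of `T_{Z/S}` over a `W`-point `g` of `Z`, on the preimage of `U`. -/
def addAux {W : Scheme.{u}} (a b : W ⟶ tangentScheme f) (g : W ⟶ Z)
    (ha : a ≫ tangentProj f = g) (hb : b ≫ tangentProj f = g) (i : AffinePair f) :
    pullback g i.hU.fromSpec ⟶ tangentScheme f :=
  affineAdd i.ringHom (restr a g ha i) (restr b g hb i) (by rw [restr_incl, restr_incl]) ≫ chart i

variable {f} in
lemma addAux_compat {W : Scheme.{u}} (a b : W ⟶ tangentScheme f) (g : W ⟶ Z)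
    (ha : a ≫ tangentProj f = g) (hb : b ≫ tangentProj f = g)
    {i j : ((AffinePair.cover f).pullback₁ g).I₀} (h : i ⟶ j) :
    Scheme.Cover.trans ((AffinePair.cover f).pullback₁ g) h ≫ addAux a b g ha hb j =
      addAux a b g ha hb i := by
  let i' : AffinePair f := i
  let j' : AffinePair f := j
  have h' : i' ≤ j' := leOfHom h
  let t : pullback g i'.hU.fromSpec ⟶ pullback g j'.hU.fromSpec :=
    pullback.map g i'.hU.fromSpec g j'.hU.fromSpec (𝟙 _) (trans h') (𝟙 _) (by simp)
      (by rw [Category.comp_id]; exact (trans_fromSpec h').symm)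
  have key (a : W ⟶ tangentScheme f) (ha : a ≫ tangentProj f = g) :
      t ≫ restr a g ha j' = restr a g ha i' ≫ Spec.map (symKaehlerMap _ _ (ringHom_map h')) := by
    refine (isPullback_chart f j').hom_ext ?_ ?_
    · rw [Category.assoc, restr_incl, pullback.lift_snd, Category.assoc, ← Spec.map_comp,
        symKaehlerIncl_map, Spec.map_comp, ← Category.assoc, restr_incl]
    · rw [Category.assoc, restr_chart, pullback.lift_fst_assoc, Category.comp_id, Category.assoc,
        map_chart f h', restr_chart]
  change t ≫ addAux a b g ha hb j' = addAux a b g ha hb i'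
  have h₀ : (restr a g ha i' ≫ Spec.map (symKaehlerMap _ _ (ringHom_map h'))) ≫
      Spec.map (symKaehlerIncl j'.ringHom) =
      (restr b g hb i' ≫ Spec.map (symKaehlerMap _ _ (ringHom_map h'))) ≫
      Spec.map (symKaehlerIncl j'.ringHom) := by
    rw [← key a ha, ← key b hb, Category.assoc, Category.assoc, restr_incl, restr_incl]
  have h₁ := affineAdd_comp _ _ (ringHom_map h') (restr a g ha i') (restr b g hb i')
    (by rw [restr_incl, restr_incl]) h₀
  rw [addAux, addAux, ← Category.assoc, comp_affineAdd]
  simp only [key]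
  rw [← h₁, Category.assoc, map_chart f h']

variable {f} in
/-- The sum of two `W`-points of `T_{Z/S}` over the same `W`-point of `Z`; it is given by
`b ↦ b`, `db ↦ db ⊗ 1 + 1 ⊗ db` on affine open subsets. -/
def addHom {W : Scheme.{u}} (a b : W ⟶ tangentScheme f)
    (h : a ≫ tangentProj f = b ≫ tangentProj f) : W ⟶ tangentScheme f :=
  Scheme.OpenCover.glueMorphismsOfLocallyDirected
    ((AffinePair.cover f).pullback₁ (a ≫ tangentProj f))
    (addAux a b _ rfl h.symm) (addAux_compat a b _ rfl h.symm)

variable {f} in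
lemma fst_addHom {W : Scheme.{u}} (a b : W ⟶ tangentScheme f)
    (h : a ≫ tangentProj f = b ≫ tangentProj f) (i : AffinePair f) :
    pullback.fst (a ≫ tangentProj f) i.hU.fromSpec ≫ addHom a b h =
      addAux a b _ rfl h.symm i :=
  Scheme.OpenCover.map_glueMorphismsOfLocallyDirected _ _ (addAux_compat a b _ rfl h.symm) _

variable {f} in
lemma addHom_proj {W : Scheme.{u}} (a b : W ⟶ tangentScheme f)
    (h : a ≫ tangentProj f = b ≫ tangentProj f) :
    addHom a b h ≫ tangentProj f = a ≫ tangentProj f := by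
  refine Scheme.Cover.hom_ext ((AffinePair.cover f).pullback₁ (a ≫ tangentProj f)) _ _
    fun (i : AffinePair f) => ?_
  change pullback.fst (a ≫ tangentProj f) i.hU.fromSpec ≫ _ =
    pullback.fst (a ≫ tangentProj f) i.hU.fromSpec ≫ _
  rw [← Category.assoc, fst_addHom, addAux, Category.assoc, ← (isPullback_chart f i).w,
    ← Category.assoc, affineAdd_incl, restr_incl, pullback.condition]

/-! ### Tangent categories -/

/-- The data `(T, p, 0, +, ℓ, c)` of a tangent structure on a category, without the axioms. -/
structure TangentData (C : Type*) [Category C] where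
  /-- The tangent functor. -/
  T : C ⥤ C
  /-- The projections `TX ⟶ X`. -/
  p (X : C) : T.obj X ⟶ X
  hasPullback (X : C) : HasPullback (p X) (p X)
  /-- The zero sections. -/
  zero (X : C) : X ⟶ T.obj X
  /-- The additions `TX ×_X TX ⟶ TX`. -/
  add (X : C) : pullback (p X) (p X) ⟶ T.obj X
  /-- The vertical lifts. -/
  lift (X : C) : T.obj X ⟶ T.obj (T.obj X)
  /-- The canonical flips. -/
  flip (X : C) : T.obj (T.obj X) ⟶ T.obj (T.obj X)

namespace TangentData

attribute [instance] hasPullback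

variable {C D : Type*} [Category C] [Category D] (𝕋 : TangentData C) (𝕊 : TangentData D)

/-- The sum `+ ∘ ⟨a, b⟩` of two generalized elements of `TX` over the same element of `X`. -/
def sum {W X : C} (a b : W ⟶ 𝕋.T.obj X) (h : a ≫ 𝕋.p X = b ≫ 𝕋.p X) : W ⟶ 𝕋.T.obj X :=
  pullback.lift a b h ≫ 𝕋.add X

/-- The iterates `T^n` of the tangent functor. -/
def iter : ℕ → C ⥤ C
  | 0 => 𝟭 C
  | n + 1 => iter n ⋙ 𝕋.T

/-- The diagram whose limit is the `n`-fold pullback power of `p_X : TX ⟶ X`. -/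
def powerDiagram (n : ℕ) (X : C) : WidePullbackShape (Fin n) ⥤ C :=
  WidePullbackShape.wideCospan X (fun _ => 𝕋.T.obj X) (fun _ => 𝕋.p X)

/-- The pair `T(p_X), 0_X ∘ p_X ∘ p_{TX} : T²X ⇉ TX`. -/
def verticalPair (X : C) : WalkingParallelPair ⥤ C :=
  parallelPair (𝕋.T.map (𝕋.p X)) (𝕋.p (𝕋.T.obj X) ≫ 𝕋.p X ≫ 𝕋.zero X)

/-- The axioms of a tangent structure. -/
structure IsTangentStructure : Prop where
  p_naturality {X Y : C} (g : X ⟶ Y) : 𝕋.T.map g ≫ 𝕋.p Y = 𝕋.p X ≫ g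
  hasLimit_power (n : ℕ) (X : C) : HasLimit (𝕋.powerDiagram n X)
  preservesLimit_power (m n : ℕ) (X : C) :
    PreservesLimit (𝕋.powerDiagram n X) (𝕋.iter m)
  zero_naturality {X Y : C} (g : X ⟶ Y) : 𝕋.zero X ≫ 𝕋.T.map g = g ≫ 𝕋.zero Y
  add_naturality {X Y : C} (g : X ⟶ Y) :
    𝕋.add X ≫ 𝕋.T.map g = pullback.lift (pullback.fst _ _ ≫ 𝕋.T.map g)
      (pullback.snd _ _ ≫ 𝕋.T.map g) (by
        rw [Category.assoc, Category.assoc, p_naturality, pullback.condition_assoc]) ≫ 𝕋.add Y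
  lift_naturality {X Y : C} (g : X ⟶ Y) :
    𝕋.lift X ≫ 𝕋.T.map (𝕋.T.map g) = 𝕋.T.map g ≫ 𝕋.lift Y
  flip_naturality {X Y : C} (g : X ⟶ Y) :
    𝕋.flip X ≫ 𝕋.T.map (𝕋.T.map g) = 𝕋.T.map (𝕋.T.map g) ≫ 𝕋.flip Y
  /- `p_X` is a commutative monoid in `C/X` with unit `0_X` and addition `+_X`. -/
  zero_p (X : C) : 𝕋.zero X ≫ 𝕋.p X = 𝟙 X
  add_p (X : C) : 𝕋.add X ≫ 𝕋.p X = pullback.fst _ _ ≫ 𝕋.p X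
  sum_zero {W X : C} (a : W ⟶ 𝕋.T.obj X) :
    𝕋.sum a ((a ≫ 𝕋.p X) ≫ 𝕋.zero X) (by
      rw [Category.assoc, zero_p, Category.comp_id]) = a
  sum_comm {W X : C} (a b : W ⟶ 𝕋.T.obj X) (h : a ≫ 𝕋.p X = b ≫ 𝕋.p X) :
    𝕋.sum a b h = 𝕋.sum b a h.symm
  sum_assoc {W X : C} (a b c : W ⟶ 𝕋.T.obj X) (h : a ≫ 𝕋.p X = b ≫ 𝕋.p X)
    (h' : b ≫ 𝕋.p X = c ≫ 𝕋.p X) :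
    𝕋.sum (𝕋.sum a b h) c (by
      rw [sum, Category.assoc, add_p, pullback.lift_fst_assoc, h, h']) =
    𝕋.sum a (𝕋.sum b c h') (by
      rw [sum, Category.assoc, add_p, pullback.lift_fst_assoc, h])
  /- `(ℓ_X, 0_X)` is a morphism of additive bundles. -/
  lift_p (X : C) : 𝕋.lift X ≫ 𝕋.T.map (𝕋.p X) = 𝕋.p X ≫ 𝕋.zero X
  lift_add (X : C) :
    ∃ h : (pullback.fst (𝕋.p X) (𝕋.p X) ≫ 𝕋.lift X) ≫ 𝕋.p (𝕋.T.obj X) =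
        (pullback.snd (𝕋.p X) (𝕋.p X) ≫ 𝕋.lift X) ≫ 𝕋.p (𝕋.T.obj X),
      𝕋.sum (pullback.fst (𝕋.p X) (𝕋.p X) ≫ 𝕋.lift X) (pullback.snd (𝕋.p X) (𝕋.p X) ≫ 𝕋.lift X) h =
        𝕋.add X ≫ 𝕋.lift X
  lift_zero (X : C) : 𝕋.zero X ≫ 𝕋.zero (𝕋.T.obj X) = 𝕋.zero X ≫ 𝕋.lift X
  /- `(c_X, id_{TX})` is a morphism of additive bundles from `T(p_X)` to `p_{TX}`. -/
  flip_p (X : C) : 𝕋.flip X ≫ 𝕋.p (𝕋.T.obj X) = 𝕋.T.map (𝕋.p X)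
  flip_add (X : C) :
    𝕋.sum (𝕋.T.map (pullback.fst (𝕋.p X) (𝕋.p X)) ≫ 𝕋.flip X)
      (𝕋.T.map (pullback.snd (𝕋.p X) (𝕋.p X)) ≫ 𝕋.flip X) (by
        rw [Category.assoc, Category.assoc, flip_p, ← Functor.map_comp, ← Functor.map_comp,
          pullback.condition]) = 𝕋.T.map (𝕋.add X) ≫ 𝕋.flip X
  flip_zero (X : C) : 𝕋.T.map (𝕋.zero X) ≫ 𝕋.flip X = 𝕋.zero (𝕋.T.obj X)
  /- The coherence relations of `ℓ` and `c`. -/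
  flip_flip (X : C) : 𝕋.flip X ≫ 𝕋.flip X = 𝟙 _
  lift_flip (X : C) : 𝕋.lift X ≫ 𝕋.flip X = 𝕋.lift X
  lift_lift (X : C) : 𝕋.lift X ≫ 𝕋.T.map (𝕋.lift X) = 𝕋.lift X ≫ 𝕋.lift (𝕋.T.obj X)
  flip_hexagon (X : C) :
    𝕋.T.map (𝕋.flip X) ≫ 𝕋.flip (𝕋.T.obj X) ≫ 𝕋.T.map (𝕋.flip X) =
      𝕋.flip (𝕋.T.obj X) ≫ 𝕋.T.map (𝕋.flip X) ≫ 𝕋.flip (𝕋.T.obj X)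
  lift_flip_pentagon (X : C) :
    𝕋.lift (𝕋.T.obj X) ≫ 𝕋.T.map (𝕋.flip X) ≫ 𝕋.flip (𝕋.T.obj X) =
      𝕋.flip X ≫ 𝕋.T.map (𝕋.lift X)
  /- The universality of the vertical lift: `T(+) ∘ ⟨ℓ ∘ π₁, 0_{TX} ∘ π₂⟩` is an equalizer of
  `T(p_X)` and `0_X ∘ p_X ∘ p_{TX}`; here `v = ⟨ℓ ∘ π₁, 0_{TX} ∘ π₂⟩`. -/
  universality (X : C) :
    ∃ v : pullback (𝕋.p X) (𝕋.p X) ⟶ 𝕋.T.obj (pullback (𝕋.p X) (𝕋.p X)),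
      v ≫ 𝕋.T.map (pullback.fst _ _) = pullback.fst _ _ ≫ 𝕋.lift X ∧
      v ≫ 𝕋.T.map (pullback.snd _ _) = pullback.snd _ _ ≫ 𝕋.zero (𝕋.T.obj X) ∧
      ∃ h : (v ≫ 𝕋.T.map (𝕋.add X)) ≫ 𝕋.T.map (𝕋.p X) =
          (v ≫ 𝕋.T.map (𝕋.add X)) ≫ 𝕋.p (𝕋.T.obj X) ≫ 𝕋.p X ≫ 𝕋.zero X,
        Nonempty (IsLimit (Fork.ofι (v ≫ 𝕋.T.map (𝕋.add X)) h))

variable {𝕋 𝕊}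

/-- The compatibilities that make `(F, α)` a morphism of tangent categories. -/
structure IsTangentMorphism (𝕋 : TangentData C) (𝕊 : TangentData D) (F : C ⥤ D)
    (α : 𝕋.T ⋙ F ⟶ F ⋙ 𝕊.T) : Prop where
  app_p (X : C) : α.app X ≫ 𝕊.p (F.obj X) = F.map (𝕋.p X)
  zero_app (X : C) : F.map (𝕋.zero X) ≫ α.app X = 𝕊.zero (F.obj X)
  add_app (X : C) :
    F.map (𝕋.add X) ≫ α.app X =
      𝕊.sum (F.map (pullback.fst (𝕋.p X) (𝕋.p X)) ≫ α.app X)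
        (F.map (pullback.snd (𝕋.p X) (𝕋.p X)) ≫ α.app X) (by
          rw [Category.assoc, Category.assoc, app_p, ← Functor.map_comp, ← Functor.map_comp,
            pullback.condition])
  lift_app (X : C) :
    F.map (𝕋.lift X) ≫ α.app (𝕋.T.obj X) ≫ 𝕊.T.map (α.app X) = α.app X ≫ 𝕊.lift (F.obj X)
  flip_app (X : C) :
    F.map (𝕋.flip X) ≫ α.app (𝕋.T.obj X) ≫ 𝕊.T.map (α.app X) =
      (α.app (𝕋.T.obj X) ≫ 𝕊.T.map (α.app X)) ≫ 𝕊.flip (F.obj X)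

/-- `(F, α)` is a strong morphism of tangent categories: `α` is invertible, and `F` preserves the
pullback powers of the projections (and their images under `T^m`) and the equalizers that
belong to the tangent structure. -/
structure IsStrongTangentMorphism (𝕋 : TangentData C) (𝕊 : TangentData D) (F : C ⥤ D)
    (α : 𝕋.T ⋙ F ⟶ F ⋙ 𝕊.T) : Prop extends IsTangentMorphism 𝕋 𝕊 F α where
  isIso : IsIso α
  preservesLimit_power (m n : ℕ) (X : C) :
    PreservesLimit (𝕋.powerDiagram n X ⋙ 𝕋.iter m) F
  preservesLimit_pullback (X : C) : PreservesLimit (cospan (𝕋.p X) (𝕋.p X)) F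
  preservesLimit_verticalPair (X : C) : PreservesLimit (𝕋.verticalPair X) F

end TangentData

/-! ### The Zariski tangent structure -/

section Zariski

variable (S : Scheme.{u})

/-- The functor `W ↦ W[ε] = W × D` on `S`-schemes. -/
def dualFunctor : Over S ⥤ Over S where
  obj W := Over.mk ((prod.fst : W.left ⨯ dualSpec.{u} ⟶ W.left) ≫ W.hom)
  map k := Over.homMk (prod.map k.left (𝟙 _)) (by simp)

variable {S}

/-- `T_{Z/S}` as an `S`-scheme. -/
abbrev tangentObj (Z : Over S) : Over S := Over.mk (tangentProj Z.hom ≫ Z.hom)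

/-- The universal morphism `T_{Z/S}[ε] ⟶ Z`, `b ↦ b + (db)ε`. -/
def tangentEval (Z : Over S) : (dualFunctor S).obj (tangentObj Z) ⟶ Z :=
  Over.homMk (tangentUniv Z.hom) ((tangentUniv_comp Z.hom).trans (by rfl))

lemma tangentEval_bijective (W Z : Over S) :
    Function.Bijective fun h : W ⟶ tangentObj Z => (dualFunctor S).map h ≫ tangentEval Z := by
  constructor
  · intro h h' e
    exact Over.OverMorphism.ext (tangentUniv_unique congr(($e).left))
  · intro g
    have hg : g.left ≫ Z.hom = prod.fst ≫ W.hom := Over.w g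
    obtain ⟨h, hh⟩ := tangentUniv_exists (f := Z.hom) g.left
      (hg.trans (congr(prod.fst ≫ zeroSec W.left ≫ $hg).trans
        congr(prod.fst ≫ $(prod.lift_fst_assoc _ _ _ |>.trans (Category.id_comp W.hom)))).symm)
    have hZ : h ≫ tangentProj Z.hom = zeroSec W.left ≫ g.left := by
      rw [← zeroSec_tangentUniv, ← reassoc_of% @zeroSec_map]
      exact congr(_ ≫ $hh)
    refine ⟨Over.homMk h ?_, Over.OverMorphism.ext hh⟩
    change h ≫ tangentProj Z.hom ≫ Z.hom = W.hom
    refine (Category.assoc _ _ _).symm.trans (congr($hZ ≫ _).trans ?_)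
    exact (Category.assoc _ _ _).trans (congr(_ ≫ $hg).trans ((prod.lift_fst_assoc _ _ _).trans
      (Category.id_comp _)))

/-- Morphisms `W ⟶ T_{Z/S}` of `S`-schemes correspond to morphisms `W[ε] ⟶ Z`. -/
def tangentEquiv (W Z : Over S) : ((dualFunctor S).obj W ⟶ Z) ≃ (W ⟶ tangentObj Z) :=
  (Equiv.ofBijective _ (tangentEval_bijective W Z)).symm

lemma map_tangentEquiv {W Z : Over S} (g : (dualFunctor S).obj W ⟶ Z) :
    (dualFunctor S).map (tangentEquiv W Z g) ≫ tangentEval Z = g :=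
  (Equiv.ofBijective _ (tangentEval_bijective W Z)).apply_symm_apply g

lemma tangentEquiv_naturality (W' W Z : Over S) (k : W' ⟶ W) (g : (dualFunctor S).obj W ⟶ Z) :
    tangentEquiv W' Z ((dualFunctor S).map k ≫ g) = k ≫ tangentEquiv W Z g := by
  apply (tangentEval_bijective W' Z).1
  simp only [map_tangentEquiv, Functor.map_comp, Category.assoc]

variable (S) in
/-- The tangent functor on `S`-schemes. For `k : Z ⟶ Z'` the morphism `T(k)`, which is given by
`b ↦ k b`, `db ↦ d(k b)`, corresponds to `T_{Z/S}[ε] ⟶ Z ⟶ Z'`. -/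
def tangentFunctor : Over S ⥤ Over S where
  obj := tangentObj
  map {Z Z'} k := tangentEquiv (tangentObj Z) Z' (tangentEval Z ≫ k)
  map_id Z := by
    apply (tangentEval_bijective _ _).1
    refine (map_tangentEquiv _).trans ((Category.comp_id _).trans ?_)
    exact ((congrArg (· ≫ tangentEval Z) ((dualFunctor S).map_id _)).trans
      (Category.id_comp _)).symm
  map_comp {Z Z' Z''} k k' := by
    apply (tangentEval_bijective _ _).1
    simp only [map_tangentEquiv, Functor.map_comp, Category.assoc, reassoc_of% @map_tangentEquiv]

lemma map_tangentFunctor_map {Z Z' : Over S} (k : Z ⟶ Z') :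
    (dualFunctor S).map ((tangentFunctor S).map k) ≫ tangentEval Z' = tangentEval Z ≫ k :=
  map_tangentEquiv _

/-- The projection `W[ε] ⟶ W`. -/
def dualProj (W : Over S) : (dualFunctor S).obj W ⟶ W := Over.homMk prod.fst

/-- The morphism `D × D ⟶ D`, `ε ↦ ε₁ε₂`. -/
def dualMul : dualSpec.{u} ⨯ dualSpec.{u} ⟶ dualSpec.{u} :=
  (specDualIso _).inv ≫ Spec.map (CommRingCat.ofHom (dualDesc
    ((dualIncl (.of (DualNumber (ULift.{u} ℤ)))).hom.comp (dualIncl (.of (ULift.{u} ℤ))).hom)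
    (TrivSqZeroExt.inr DualNumber.eps : DualNumber (DualNumber (ULift.{u} ℤ)))
    (TrivSqZeroExt.inr_mul_inr _ _ _)))

/-- The morphism `W[ε₁][ε₂] ⟶ W[ε]`, `ε ↦ ε₁ε₂`. -/
def dualDiag (W : Over S) :
    (dualFunctor S).obj ((dualFunctor S).obj W) ⟶ (dualFunctor S).obj W :=
  Over.homMk (show (W.left ⨯ dualSpec.{u}) ⨯ dualSpec.{u} ⟶ W.left ⨯ dualSpec.{u} from
    prod.lift (prod.fst ≫ prod.fst) (prod.map prod.snd (𝟙 _) ≫ dualMul))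
    ((prod.lift_fst_assoc _ _ _).trans (Category.assoc _ _ _))

/-- The morphism `W[ε₁][ε₂] ⟶ W[ε₁][ε₂]` that interchanges `ε₁` and `ε₂`. -/
def dualSwap (W : Over S) :
    (dualFunctor S).obj ((dualFunctor S).obj W) ⟶ (dualFunctor S).obj ((dualFunctor S).obj W) :=
  Over.homMk (show (W.left ⨯ dualSpec.{u}) ⨯ dualSpec.{u} ⟶ (W.left ⨯ dualSpec.{u}) ⨯ dualSpec.{u}
    from prod.lift (prod.map prod.fst (𝟙 _)) (prod.fst ≫ prod.snd))
    ((prod.lift_fst_assoc _ _ _).trans (prod.map_fst_assoc _ _ _))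

/-- The projection `p : T_{Z/S} ⟶ Z`, `b ↦ b`. -/
def tangentP (Z : Over S) : tangentObj Z ⟶ Z := Over.homMk (tangentProj Z.hom)

/-- The zero section `Z ⟶ T_{Z/S}`, `b ↦ b`, `db ↦ 0`: it corresponds to `Z[ε] ⟶ Z`,
`b ↦ b + 0ε`. -/
def tangentZero (Z : Over S) : Z ⟶ tangentObj Z := tangentEquiv _ _ (dualProj Z)

/-- The addition `T_{Z/S} ×_Z T_{Z/S} ⟶ T_{Z/S}`, `b ↦ b`, `db ↦ db ⊗ 1 + 1 ⊗ db`. -/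
def tangentAdd (Z : Over S) : pullback (tangentP Z) (tangentP Z) ⟶ tangentObj Z :=
  Over.homMk (addHom (pullback.fst (tangentP Z) (tangentP Z)).left
    (pullback.snd (tangentP Z) (tangentP Z)).left
    congr(($(pullback.condition (f := tangentP Z) (g := tangentP Z))).left)) (by
      change _ ≫ tangentProj Z.hom ≫ Z.hom = _
      refine (Category.assoc _ _ _).symm.trans (congr($(addHom_proj _ _ _) ≫ _).trans ?_)
      exact (Category.assoc _ _ _).trans (Over.w (pullback.fst (tangentP Z) (tangentP Z))))

/-- The vertical lift `T ⟶ T²`, `b ↦ b`, `db ↦ 0`, `δb ↦ 0`, `δdb ↦ db`: it corresponds to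
`T_{Z/S}[ε₁][ε₂] ⟶ Z`, `b ↦ b + (db)ε₁ε₂`. -/
def tangentLift (Z : Over S) : tangentObj Z ⟶ tangentObj (tangentObj Z) :=
  tangentEquiv _ _ (tangentEquiv _ _ (dualDiag _ ≫ tangentEval Z))

/-- The canonical flip `T² ⟶ T²`, `b ↦ b`, `db ↦ δb`, `δb ↦ db`, `δdb ↦ δdb`: it corresponds to
`T²[ε₁][ε₂] ⟶ Z`, `b ↦ b + (db)ε₁ + (δb)ε₂ + (δdb)ε₁ε₂`. -/
def tangentFlip (Z : Over S) : tangentObj (tangentObj Z) ⟶ tangentObj (tangentObj Z) :=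
  tangentEquiv _ _ (tangentEquiv _ _
    (dualSwap _ ≫ (dualFunctor S).map (tangentEval (tangentObj Z)) ≫ tangentEval Z))

variable (S) in
/-- The Zariski tangent structure on `S`-schemes. -/
def zariski : TangentData (Over S) where
  T := tangentFunctor S
  p := tangentP
  hasPullback _ := inferInstance
  zero := tangentZero
  add := tangentAdd
  lift := tangentLift
  flip := tangentFlip

end Zariski

section BaseChange

/-- The morphism `(T_{Z/Y} ×_Y X) × D ⟶ Z ×_Y X`, `b ⊗ a ↦ (b + (db)ε) ⊗ a`. -/
def baseChangeUniv {X Y Z : Scheme.{u}} (g : Z ⟶ Y) (f : X ⟶ Y) :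
    pullback (tangentProj g ≫ g) f ⨯ dualSpec.{u} ⟶ pullback g f :=
  pullback.lift (prod.map (pullback.fst _ _) (𝟙 _) ≫ tangentUniv g) (prod.fst ≫ pullback.snd _ _)
    (by rw [Category.assoc, tangentUniv_comp, prod.map_fst_assoc, Category.assoc,
      pullback.condition])

lemma baseChangeUniv_naturality {X Y Z Z' : Scheme.{u}} (g : Z ⟶ Y) (g' : Z' ⟶ Y) (f : X ⟶ Y)
    (k : Z ⟶ Z') (h : tangentScheme g ⟶ tangentScheme g')
    (hk : prod.map h (𝟙 _) ≫ tangentUniv g' = tangentUniv g ≫ k)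
    (wh : (pullback.fst (tangentProj g ≫ g) f ≫ h) ≫ tangentProj g' ≫ g' =
      pullback.snd (tangentProj g ≫ g) f ≫ f)
    (wk : (pullback.fst g f ≫ k) ≫ g' = pullback.snd g f ≫ f) :
    prod.map (pullback.lift (pullback.fst _ _ ≫ h) (pullback.snd _ _) wh) (𝟙 _) ≫
      baseChangeUniv g' f =
    baseChangeUniv g f ≫ pullback.lift (pullback.fst _ _ ≫ k) (pullback.snd _ _) wk := by
  apply pullback.hom_ext
  · rw [Category.assoc, Category.assoc, baseChangeUniv, baseChangeUniv, pullback.lift_fst,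
      pullback.lift_fst, pullback.lift_fst_assoc, prod.map_map_assoc, pullback.lift_fst,
      Category.assoc, ← hk, prod.map_map_assoc]
  · rw [Category.assoc, Category.assoc, baseChangeUniv, baseChangeUniv, pullback.lift_snd,
      pullback.lift_snd, pullback.lift_snd, prod.map_fst_assoc, pullback.lift_snd]

variable {X Y : Scheme.{u}} (f : X ⟶ Y)

/-- The morphism `(f^*T_{Z/Y})[ε] ⟶ f^*Z`, `b ⊗ a ↦ (b + (db)ε) ⊗ a`. -/
def baseChangeEval (Z : Over Y) :
    (dualFunctor X).obj ((Over.pullback f).obj (tangentObj Z)) ⟶ (Over.pullback f).obj Z :=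
  Over.homMk (baseChangeUniv Z.hom f) (pullback.lift_snd _ _ _)

/-- The base change morphism `f^*T_{Z/Y} ⟶ T_{f^*Z/X}`, `b ⊗ a ↦ b ⊗ a`, `d(b ⊗ a) ↦ db ⊗ a`. -/
def baseChange : (zariski Y).T ⋙ Over.pullback f ⟶ Over.pullback f ⋙ (zariski X).T where
  app Z := tangentEquiv _ _ (baseChangeEval f Z)
  naturality Z Z' k := by
    apply (tangentEval_bijective _ _).1
    refine (congr($((dualFunctor X).map_comp _ _) ≫ _)).trans ?_
    refine Eq.trans ?_ (congr($((dualFunctor X).map_comp _ _) ≫ _)).symm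
    refine (Category.assoc _ _ _).trans ((congrArg _ (map_tangentEquiv _)).trans ?_)
    refine Eq.trans ?_ ((Category.assoc _ _ _).trans
      (congrArg _ (map_tangentFunctor_map ((Over.pullback f).map k)))).symm
    refine Eq.trans ?_ ((Category.assoc _ _ _).symm.trans
      (congrArg (· ≫ (Over.pullback f).map k) (map_tangentEquiv (baseChangeEval f Z)))).symm
    exact Over.OverMorphism.ext (baseChangeUniv_naturality Z.hom Z'.hom f k.left
      ((tangentFunctor Y).map k).left congr($(map_tangentFunctor_map k).left) _ _)

end BaseChange
end ZariskiTangent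

end

noncomputable section

namespace ZariskiTangent

open AffinePair

set_option linter.unusedSectionVars false

/-! Everything is read through the universal property. With `D = Spec ℤ[ε]`, the functor `W ↦ W[ε] =
W × D` is left adjoint to `Z ↦ T_{Z/S}`; `flat` sends `W ⟶ T_{Z/S}` to its transpose `W[ε] ⟶ Z`. On
transposes, composing with `p` is restriction to `ε = 0`, while composing with `0`, `ℓ` or `c` is
precomposition with the projection `W[ε] ⟶ W`, with `ε ↦ ε₁ε₂` or with the interchange of `ε₁` and
`ε₂`. An axiom without addition thus becomes an equality of morphisms between products `W × D × … ×
D`. Such morphisms are determined by their component in `W` and some square-zero functions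
(`dual_ext`), so only identities between monomials in the `ε`s remain.

Addition is built by gluing and has to be made accessible first. Let `D(ι) = Spec ℤ[ε_i]/(ε_i ε_j)`.
For nonempty finite `ι`, `W × D(ι)` is, in the category of schemes, the amalgamated sum along `W` of
copies of `W × D`, one for each `i` (`multi_hom_ext`, `exists_multi`). Indeed `W ⟶ W × D(ι)` is
surjective on points for affine `W`, so morphisms into `Z` may locally be compared inside one affine
open of `Z`, and there the claim is that `R[ε_i]` is the fibre product over `R` of copies of `R[ε]`.
Tangent vectors at a common point are therefore the restrictions to the axes of a single morphism on
`W × D(ι)`. Their sum is its restriction along the diagonal (`map_addHom_tangentUniv`), and more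
generally directions `c` and `d` add to `c + d` (`flat_sum`). The monoid laws become those of `ℤ^ι`,
and `ℓ` and `c` are additive because the maps of `D` behind them extend to `D(2)`.

For the universality of the vertical lift, the dual statement is that `W × D × D ⟶ W × D(2)`, `ε_0 ↦
ε₁ε₂`, `ε_1 ↦ ε₂`, is a coequalizer: `R[ε_0, ε_1]` is the subring of `R[ε₁][ε₂]` of elements without
`ε₁`-term (`vertSec_hom_ext`, `exists_vertSec_comp`). The candidate equalizer is precomposition with
this morphism (`flat_flat_vertical`), and equalizing the two arrows means that the restriction to
`ε₂ = 0` does not depend on `ε₁`.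

All preservation of limits is formal, since `T`, its iterates and `f^*` are right adjoints. Finally
the left adjoint of `f^*`, which composes the structure morphism with `f`, commutes with `- × D`.
Hence their right adjoints commute, which is the base change isomorphism; its compatibilities are
again checked on transposes. -/

/-! ### Coordinates -/

/-- The element `ε` of `Γ(W)` that belongs to a `W`-point of `D`. -/
def dualCoord {W : Scheme.{u}} (a : W ⟶ dualSpec.{u}) : Γ(W, ⊤) :=
  globalHom a (DualNumber.eps : DualNumber (ULift.{u} ℤ))

lemma dualCoord_comp {V W : Scheme.{u}} (k : V ⟶ W) (a : W ⟶ dualSpec.{u}) :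
    dualCoord (k ≫ a) = k.appTop (dualCoord a) := by
  rw [dualCoord, globalHom_comp]
  rfl

lemma dualCoord_mul_self {W : Scheme.{u}} (a : W ⟶ dualSpec.{u}) :
    dualCoord a * dualCoord a = 0 := by
  rw [dualCoord, ← map_mul, DualNumber.eps_mul_eps, map_zero]

/-- `ℤ[ε]` is generated by `ε` over the initial ring. Together with `dualPoint` this identifies the
`W`-points of `D` with the functions on `W` of square zero. -/
lemma dualCoord_ext {W : Scheme.{u}} {a b : W ⟶ dualSpec.{u}} (h : dualCoord a = dualCoord b) :
    a = b := by
  rw [← toSpecΓ_globalHom a, ← toSpecΓ_globalHom b]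
  congr 2
  exact dual_hom_ext' (R := .of (ULift.{u} ℤ)) (CommRingCat.isInitial.hom_ext _ _) h

lemma globalHom_specMap {C R : CommRingCat.{u}} (g : C ⟶ R) (c : C) :
    globalHom (Spec.map g) c = (Scheme.ΓSpecIso R).inv (g c) := by
  have := globalHom_comp_specMap (𝟙 (Spec R)) g
  rw [Category.id_comp] at this
  rw [this, globalHom, Scheme.Hom.id_appTop, Category.comp_id]
  rfl

lemma dualCoord_specMap {R : CommRingCat.{u}} (g : .of (DualNumber (ULift.{u} ℤ)) ⟶ R) :
    dualCoord (Spec.map g) =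
      (Scheme.ΓSpecIso R).inv (g (DualNumber.eps : DualNumber (ULift.{u} ℤ))) :=
  globalHom_specMap g _

@[simp]
lemma dualCoord_dualZero (W : Scheme.{u}) : dualCoord (dualZero W) = 0 := by
  rw [dualZero, dualCoord_comp, dualCoord_specMap]
  have : dualFst (.of (ULift.{u} ℤ)) (DualNumber.eps : DualNumber (ULift.{u} ℤ)) = 0 := rfl
  rw [this, map_zero, map_zero]

/-- The `W`-point of `D` that belongs to an element of `Γ(W)` with square zero. -/
def dualPoint {W : Scheme.{u}} (e : Γ(W, ⊤)) (he : e * e = 0) : W ⟶ dualSpec.{u} :=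
  W.toSpecΓ ≫ Spec.map (CommRingCat.ofHom
    (dualDesc ((Int.castRingHom Γ(W, ⊤)).comp ULift.ringEquiv.toRingHom) e he))

lemma globalHom_toSpecΓ {C : CommRingCat.{u}} {W : Scheme.{u}} (g : C ⟶ Γ(W, ⊤)) :
    globalHom (W.toSpecΓ ≫ Spec.map g) = g := by
  rw [globalHom_comp, globalHom, ← Scheme.ΓSpecIso_inv_naturality]
  simp

@[simp]
lemma dualCoord_dualPoint {W : Scheme.{u}} (e : Γ(W, ⊤)) (he : e * e = 0) :
    dualCoord (dualPoint e he) = e := by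
  rw [dualPoint, dualCoord, globalHom_toSpecΓ]
  change Int.castRingHom _ _ + Int.castRingHom _ _ * e = e
  simp

lemma specDualIso_inv_mul {R : CommRingCat.{u}} (a b x y z : DualNumber R) (h : x = y * z)
    (ha : a = y) (hb : b = z) :
    (Scheme.ΓSpecIso (.of (DualNumber R))).inv x =
      (Scheme.ΓSpecIso (.of (DualNumber R))).inv a *
        (Scheme.ΓSpecIso (.of (DualNumber R))).inv b := by
  subst ha hb h
  exact map_mul (Scheme.ΓSpecIso (.of (DualNumber R))).inv.hom _ _

/-- Replaces the definition of `dualMul` through `ℤ[ε][ε]` by its coordinate `ε₁ε₂`, the form needed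
for generalized elements. -/
lemma dualMul_eq : dualMul.{u} = dualPoint (dualCoord prod.fst * dualCoord prod.snd)
    (by rw [mul_mul_mul_comm, dualCoord_mul_self, zero_mul]) := by
  rw [← cancel_epi (specDualIso _).hom]
  apply dualCoord_ext
  rw [dualCoord_comp (specDualIso _).hom (dualPoint _ _), dualCoord_dualPoint]
  refine Eq.trans ?_ (map_mul (specDualIso _).hom.appTop.hom _ _).symm
  refine Eq.trans ?_ (congrArg₂ (· * ·) (dualCoord_comp _ _) (dualCoord_comp _ _))
  rw [specDualIso_hom_fst, specDualIso_hom_snd, dualMul, Iso.hom_inv_id_assoc, dualCoord_specMap,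
    dualCoord_specMap, dualCoord_specMap]
  refine specDualIso_inv_mul (R := .of (DualNumber (ULift.{u} ℤ))) _ _ _
    (TrivSqZeroExt.inl (DualNumber.eps : DualNumber (ULift.{u} ℤ)))
    (DualNumber.eps : DualNumber (DualNumber (ULift.{u} ℤ))) ?_ rfl
    (dualInt_eps _)
  change (TrivSqZeroExt.inl _ + TrivSqZeroExt.inl _ * TrivSqZeroExt.inr DualNumber.eps :
    DualNumber (DualNumber (ULift.{u} ℤ))) =
    TrivSqZeroExt.inl (DualNumber.eps : DualNumber (ULift.{u} ℤ)) *
      TrivSqZeroExt.inr (1 : DualNumber (ULift.{u} ℤ))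
  exact TrivSqZeroExt.ext (by simp) (by simp)

lemma dualCoord_lift_dualMul {W : Scheme.{u}} (a b : W ⟶ dualSpec.{u}) :
    dualCoord (prod.lift a b ≫ dualMul) = dualCoord a * dualCoord b := by
  rw [dualCoord_comp, dualMul_eq, dualCoord_dualPoint, map_mul, ← dualCoord_comp,
    ← dualCoord_comp, prod.lift_fst, prod.lift_snd]

/-! ### The first infinitesimal neighbourhood in several variables -/

/-- The ring `R[ε_i : i ∈ ι]/(ε_i ε_j)`. -/
abbrev MultiDual (ι : Type) (R : Type u) [CommRing R] : Type u := TrivSqZeroExt R (ι → R)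

namespace MultiDual

variable {ι : Type} [Fintype ι] [DecidableEq ι]

/-- The element `ε_i`. -/
def eps {R : Type u} [CommRing R] (i : ι) : MultiDual ι R := TrivSqZeroExt.inr (Pi.single i 1)

lemma eps_mul_eps {R : Type u} [CommRing R] (i j : ι) :
    (eps i : MultiDual ι R) * eps j = 0 := TrivSqZeroExt.inr_mul_inr _ _ _

/-- `R ⟶ R[ε_i]`. -/
def incl (ι : Type) (R : CommRingCat.{u}) : R ⟶ CommRingCat.of (MultiDual ι R) :=
  CommRingCat.ofHom (TrivSqZeroExt.inlHom R (ι → R))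

/-- The ring homomorphism `R[ε_i] → Q`, `ε_i ↦ e_i`, for `e_i * e_j = 0`. -/
def desc {R Q : Type u} [CommRing R] [CommRing Q] (g : R →+* Q) (e : ι → Q)
    (he : ∀ i j, e i * e j = 0) : MultiDual ι R →+* Q where
  toFun x := g x.fst + ∑ i, g (x.snd i) * e i
  map_one' := by simp
  map_zero' := by simp
  map_add' x y := by simp [add_mul, Finset.sum_add_distrib]; ring
  map_mul' x y := by
    have h : (∑ i, g (x.snd i) * e i) * (∑ i, g (y.snd i) * e i) = 0 := by
      rw [Finset.sum_mul_sum]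
      refine Finset.sum_eq_zero fun i _ => Finset.sum_eq_zero fun j _ => ?_
      rw [mul_mul_mul_comm, he, mul_zero]
    simp only [TrivSqZeroExt.fst_mul, TrivSqZeroExt.snd_mul, map_mul, map_add, Pi.add_apply,
      Pi.smul_apply, smul_eq_mul, MulOpposite.smul_eq_mul_unop, MulOpposite.unop_op, add_mul,
      Finset.sum_add_distrib]
    have h₁ : ∑ i, g x.fst * g (y.snd i) * e i = g x.fst * ∑ i, g (y.snd i) * e i := by
      rw [Finset.mul_sum]; exact Finset.sum_congr rfl fun i _ => by ring
    have h₂ : ∑ i, g (x.snd i) * g y.fst * e i = (∑ i, g (x.snd i) * e i) * g y.fst := by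
      rw [Finset.sum_mul]; exact Finset.sum_congr rfl fun i _ => by ring
    rw [h₁, h₂]
    linear_combination -h

lemma desc_inl {R Q : Type u} [CommRing R] [CommRing Q] (g : R →+* Q) (e : ι → Q)
    (he : ∀ i j, e i * e j = 0) (r : R) :
    desc g e he (TrivSqZeroExt.inl r : MultiDual ι R) = g r := by
  change g r + ∑ i, g 0 * e i = g r
  simp

lemma desc_eps {R Q : Type u} [CommRing R] [CommRing Q] (g : R →+* Q) (e : ι → Q)
    (he : ∀ i j, e i * e j = 0) (i : ι) : desc g e he (eps i : MultiDual ι R) = e i := by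
  change g 0 + ∑ j, g ((Pi.single i 1 : ι → R) j) * e j = e i
  rw [Finset.sum_eq_single i]
  · simp
  · intro j _ hj
    simp [hj]
  · simp

lemma eq_sum {R : Type u} [CommRing R] (c : MultiDual ι R) :
    c = TrivSqZeroExt.inl c.fst + ∑ i, TrivSqZeroExt.inl (c.snd i) * eps i := by
  have h : ∑ i, (TrivSqZeroExt.inl (c.snd i) : MultiDual ι R) * eps i =
      TrivSqZeroExt.inr c.snd := by
    have h' (i : ι) : (TrivSqZeroExt.inl (c.snd i) : MultiDual ι R) * eps i =
        TrivSqZeroExt.inr (Pi.single i (c.snd i)) := by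
      rw [eps, TrivSqZeroExt.inl_mul_inr, ← Pi.single_smul, smul_eq_mul, mul_one]
    simp only [h', ← TrivSqZeroExt.inr_sum, Finset.univ_sum_single]
  rw [h, TrivSqZeroExt.inl_fst_add_inr_snd_eq]

lemma hom_ext {R : Type u} {Q : CommRingCat.{u}} [CommRing R]
    {x y : CommRingCat.of (MultiDual ι R) ⟶ Q}
    (h₁ : ∀ r : R, x (TrivSqZeroExt.inl r : MultiDual ι R) =
      y (TrivSqZeroExt.inl r : MultiDual ι R))
    (h₂ : ∀ i, x (eps i : MultiDual ι R) = y (eps i : MultiDual ι R)) : x = y := by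
  refine CommRingCat.hom_ext (RingHom.ext fun c => ?_)
  have h₁' (r : R) : x.hom (TrivSqZeroExt.inl r) = y.hom (TrivSqZeroExt.inl r) := h₁ r
  have h₂' (i : ι) : x.hom (eps i : MultiDual ι R) = y.hom (eps i : MultiDual ι R) := h₂ i
  rw [eq_sum (R := R) (ι := ι) c]
  simp only [map_add, map_sum, map_mul, h₁', h₂']

/-- The ring homomorphism `S[ε_i] → R[ε_i]` induced by `S → R`. -/
def map {S R : Type u} [CommRing S] [CommRing R] (x : S →+* R) :
    MultiDual ι S →+* MultiDual ι R where
  toFun c := (x c.fst, fun i => x (c.snd i))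
  map_one' := TrivSqZeroExt.ext (map_one x) (funext fun _ => map_zero x)
  map_zero' := TrivSqZeroExt.ext (map_zero x) (funext fun _ => map_zero x)
  map_add' c d := TrivSqZeroExt.ext (map_add x _ _) (funext fun _ => map_add x _ _)
  map_mul' c d := by
    refine TrivSqZeroExt.ext (map_mul x _ _) (funext fun i => ?_)
    rw [TrivSqZeroExt.snd_mul]
    change x ((c * d).snd i) = x c.fst * x (d.snd i) + x (c.snd i) * x d.fst
    simp [mul_comm]

lemma map_eps {S R : Type u} [CommRing S] [CommRing R] (x : S →+* R) (i : ι) :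
    map x (eps i : MultiDual ι S) = eps i :=
  TrivSqZeroExt.ext (map_zero x) (funext fun j => by
    change x ((Pi.single i 1 : ι → S) j) = (Pi.single i 1 : ι → R) j
    rw [Pi.single_apply, Pi.single_apply]
    split_ifs <;> simp)

/-- `ℤ[ε_i] ⟶ R[ε_i]`. -/
def int (ι : Type) (R : CommRingCat.{u}) :
    CommRingCat.of (MultiDual ι (ULift.{u} ℤ)) ⟶ CommRingCat.of (MultiDual ι R) :=
  CommRingCat.ofHom (map ((Int.castRingHom R).comp ULift.ringEquiv.toRingHom))

lemma hom_ext_int {Q : CommRingCat.{u}} {x y : CommRingCat.of (MultiDual ι (ULift.{u} ℤ)) ⟶ Q}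
    (h : ∀ i, x (eps i : MultiDual ι (ULift.{u} ℤ)) = y (eps i : MultiDual ι (ULift.{u} ℤ))) :
    x = y := by
  refine hom_ext (fun r => ?_) h
  have : incl ι (.of (ULift.{u} ℤ)) ≫ x = incl ι (.of (ULift.{u} ℤ)) ≫ y :=
    CommRingCat.isInitial.hom_ext _ _
  exact congr($this r)

lemma int_eps (R : CommRingCat.{u}) (i : ι) :
    int ι R (eps i : MultiDual ι (ULift.{u} ℤ)) = (eps i : MultiDual ι R) :=
  map_eps _ i

/-- `R[ε_i] = R ⊗ ℤ[ε_i]`: a homomorphism out of it is one on `R` together with elements `e_i` whose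
products vanish. -/
lemma isPushout (R : CommRingCat.{u}) :
    IsPushout (CommRingCat.isInitial.to R) (incl ι (.of (ULift.{u} ℤ))) (incl ι R) (int ι R) := by
  have he (s : PushoutCocone (CommRingCat.isInitial.to R) (incl ι (.of (ULift.{u} ℤ)))) (i j : ι) :
      s.inr (eps i : MultiDual ι (ULift.{u} ℤ)) * s.inr (eps j : MultiDual ι (ULift.{u} ℤ)) = 0 := by
    refine (map_mul s.inr.hom (eps i : MultiDual ι (ULift.{u} ℤ)) (eps j)).symm.trans ?_
    rw [eps_mul_eps, map_zero]
  refine ⟨⟨CommRingCat.isInitial.hom_ext _ _⟩, ⟨PushoutCocone.IsColimit.mk _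
    (fun s => CommRingCat.ofHom (desc s.inl.hom
      (fun i => s.inr (eps i : MultiDual ι (ULift.{u} ℤ))) (he s))) ?_ ?_ ?_⟩⟩
  · intro s
    exact CommRingCat.hom_ext (RingHom.ext fun c => desc_inl _ _ (he s) c)
  · intro s
    refine hom_ext_int fun i => ?_
    exact congr(desc s.inl.hom _ (he s) $(int_eps R i)).trans
      (desc_eps (R := R) s.inl.hom _ (he s) i)
  · intro s m h₁ h₂
    refine hom_ext (fun r => ?_) (fun i => ?_)
    · exact congr($h₁ r).trans (desc_inl _ _ (he s) r).symm
    · refine Eq.trans ?_ (desc_eps (R := R) s.inl.hom _ (he s) i).symm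
      exact congr(m $(int_eps R i)).symm.trans congr($h₂ _)

end MultiDual

/-- `D(ι) = Spec ℤ[ε_i : i ∈ ι]/(ε_i ε_j)`. -/
abbrev multiSpec (ι : Type) : Scheme.{u} := Spec (.of (MultiDual ι (ULift.{u} ℤ)))

section Multi

open MultiDual

variable (ι : Type) [Fintype ι] [DecidableEq ι]

/-- `Spec R[ε_i]` is the product of `Spec R` and `D(ι)`. -/
def isLimitSpecMulti (R : CommRingCat.{u}) : IsLimit (BinaryFan.mk
    (Spec.map (MultiDual.incl ι R)) (Spec.map (MultiDual.int ι R) : _ ⟶ multiSpec.{u} ι)) :=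
  isProductOfIsTerminalIsPullback _ _ _ _ specULiftZIsTerminal
    (isPullback_SpecMap_of_isPushout _ _ _ _ (MultiDual.isPushout R)).isLimit

/-- `Spec R[ε_i] ≅ Spec R × D(ι)`. -/
def specMultiIso (R : CommRingCat.{u}) :
    Spec (.of (MultiDual ι R)) ≅ Spec R ⨯ multiSpec.{u} ι :=
  (isLimitSpecMulti ι R).conePointUniqueUpToIso (limit.isLimit _)

lemma specMultiIso_hom_fst (R : CommRingCat.{u}) :
    (specMultiIso ι R).hom ≫ prod.fst = Spec.map (MultiDual.incl ι R) :=
  (isLimitSpecMulti ι R).conePointUniqueUpToIso_hom_comp (limit.isLimit _) ⟨.left⟩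

lemma specMultiIso_hom_snd (R : CommRingCat.{u}) :
    (specMultiIso ι R).hom ≫ prod.snd = Spec.map (MultiDual.int ι R) :=
  (isLimitSpecMulti ι R).conePointUniqueUpToIso_hom_comp (limit.isLimit _) ⟨.right⟩

variable {ι}

/-- The elements `ε_i` of `Γ(W)` that belong to a `W`-point of `D(ι)`. -/
def multiCoord {W : Scheme.{u}} (a : W ⟶ multiSpec.{u} ι) (i : ι) : Γ(W, ⊤) :=
  globalHom a (MultiDual.eps i : MultiDual ι (ULift.{u} ℤ))

lemma multiCoord_comp {V W : Scheme.{u}} (k : V ⟶ W) (a : W ⟶ multiSpec.{u} ι) (i : ι) :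
    multiCoord (k ≫ a) i = k.appTop (multiCoord a i) := by
  rw [multiCoord, globalHom_comp]
  rfl

lemma multiCoord_mul {W : Scheme.{u}} (a : W ⟶ multiSpec.{u} ι) (i j : ι) :
    multiCoord a i * multiCoord a j = 0 := by
  refine (map_mul (globalHom a).hom (MultiDual.eps i : MultiDual ι (ULift.{u} ℤ))
    (MultiDual.eps j)).symm.trans ?_
  rw [MultiDual.eps_mul_eps, map_zero]

lemma multiCoord_ext {W : Scheme.{u}} {a b : W ⟶ multiSpec.{u} ι}
    (h : ∀ i, multiCoord a i = multiCoord b i) : a = b := by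
  rw [← toSpecΓ_globalHom a, ← toSpecΓ_globalHom b]
  congr 2
  exact MultiDual.hom_ext_int h

/-- The `W`-point of `D(ι)` that belongs to elements of `Γ(W)` whose products vanish. -/
def multiPoint {W : Scheme.{u}} (e : ι → Γ(W, ⊤)) (he : ∀ i j, e i * e j = 0) :
    W ⟶ multiSpec.{u} ι :=
  W.toSpecΓ ≫ Spec.map (CommRingCat.ofHom
    (MultiDual.desc ((Int.castRingHom Γ(W, ⊤)).comp ULift.ringEquiv.toRingHom) e he))

lemma multiCoord_specMap {R : CommRingCat.{u}} (g : .of (MultiDual ι (ULift.{u} ℤ)) ⟶ R) (i : ι) :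
    multiCoord (Spec.map g) i =
      (Scheme.ΓSpecIso R).inv (g (MultiDual.eps i : MultiDual ι (ULift.{u} ℤ))) :=
  globalHom_specMap g _

@[simp]
lemma multiCoord_multiPoint {W : Scheme.{u}} (e : ι → Γ(W, ⊤)) (he : ∀ i j, e i * e j = 0)
    (i : ι) : multiCoord (multiPoint e he) i = e i := by
  rw [multiPoint, multiCoord, globalHom_toSpecΓ]
  exact MultiDual.desc_eps (R := ULift.{u} ℤ) _ e he i

end Multi

/-! ### Infinitesimal neighbourhoods of a scheme -/

section Neighbourhoods

variable {ι : Type} [Fintype ι] [DecidableEq ι] {V V' W W' Z : Scheme.{u}}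

lemma appTop_comp_apply (k : V ⟶ V') (k' : V' ⟶ W) (x : Γ(W, ⊤)) :
    (k ≫ k').appTop x = k.appTop (k'.appTop x) := by
  rw [Scheme.Hom.comp_appTop]
  rfl

/-- The `V`-point of `W × D(ι)` that belongs to a `V`-point of `W` and elements of `Γ(V)` whose
products vanish. -/
def multiLift (k : V ⟶ W) (e : ι → Γ(V, ⊤)) (he : ∀ i j, e i * e j = 0) :
    V ⟶ W ⨯ multiSpec.{u} ι :=
  prod.lift k (multiPoint e he)

lemma comp_mul_eq_zero (h : V' ⟶ V) {e : ι → Γ(V, ⊤)} (he : ∀ i j, e i * e j = 0) (i j : ι) :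
    h.appTop (e i) * h.appTop (e j) = 0 := by
  rw [← map_mul, he, map_zero]

lemma comp_multiLift (h : V' ⟶ V) (k : V ⟶ W) (e : ι → Γ(V, ⊤)) (he : ∀ i j, e i * e j = 0) :
    h ≫ multiLift k e he =
      multiLift (h ≫ k) (fun i => h.appTop (e i)) (comp_mul_eq_zero h he) := by
  apply Limits.prod.hom_ext
  · rw [Category.assoc, multiLift, multiLift, prod.lift_fst, prod.lift_fst]
  · rw [Category.assoc, multiLift, multiLift, prod.lift_snd, prod.lift_snd]
    exact multiCoord_ext fun i => by simp [multiCoord_comp]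

lemma multiLift_map (h : W ⟶ W') (k : V ⟶ W) (e : ι → Γ(V, ⊤)) (he : ∀ i j, e i * e j = 0) :
    multiLift k e he ≫ prod.map h (𝟙 _) = multiLift (k ≫ h) e he := by
  simp [multiLift]

lemma multiLift_congr {k k' : V ⟶ W} {e e' : ι → Γ(V, ⊤)} {he : ∀ i j, e i * e j = 0}
    {he' : ∀ i j, e' i * e' j = 0} (hk : k = k') (hee : ∀ i, e i = e' i) :
    multiLift k e he = multiLift k' e' he' := by
  obtain rfl : e = e' := funext hee
  subst hk
  rfl

/-- The dictionary between rings and schemes: `linHom`, `multiFst` and `vertHom` are instances of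
`MultiDual.desc`, and this lemma turns them into `linSec`, `multiZero` and `vertSec`. -/
lemma specMap_desc {R Q : CommRingCat.{u}} (k : R ⟶ Q) (e : ι → Q) (he : ∀ i j, e i * e j = 0) :
    Spec.map (CommRingCat.ofHom (MultiDual.desc k.hom e he)) ≫ (specMultiIso ι R).hom =
      multiLift (Spec.map k) (fun i => (Scheme.ΓSpecIso Q).inv (e i))
        (fun i j => by rw [← map_mul, he, map_zero]) := by
  apply Limits.prod.hom_ext
  · rw [Category.assoc, specMultiIso_hom_fst, ← Spec.map_comp, multiLift, prod.lift_fst]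
    congr 1
    exact CommRingCat.hom_ext (RingHom.ext fun r => MultiDual.desc_inl _ _ he r)
  · rw [Category.assoc, specMultiIso_hom_snd, ← Spec.map_comp, multiLift, prod.lift_snd]
    refine multiCoord_ext fun i => ?_
    rw [multiCoord_specMap, multiCoord_multiPoint]
    congr 1
    exact congr(MultiDual.desc k.hom e he $(MultiDual.int_eps R i)).trans
      (MultiDual.desc_eps k.hom e he i)

/-- The element `ε` of `Γ(W × D)`. -/
def dualGen (W : Scheme.{u}) : Γ(W ⨯ dualSpec.{u}, ⊤) := dualCoord prod.snd

lemma dualGen_mul_self (W : Scheme.{u}) : dualGen W * dualGen W = 0 := dualCoord_mul_self _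

lemma map_dualGen (k : V ⟶ W) : (prod.map k (𝟙 _)).appTop (dualGen W) = dualGen V := by
  rw [dualGen, ← dualCoord_comp, prod.map_snd, Category.comp_id]
  rfl

lemma zeroSec_dualGen (W : Scheme.{u}) : (zeroSec W).appTop (dualGen W) = 0 := by
  rw [dualGen, ← dualCoord_comp, zeroSec, prod.lift_snd, dualCoord_dualZero]

lemma specDualIso_dualGen (R : CommRingCat.{u}) :
    (specDualIso R).hom.appTop (dualGen (Spec R)) =
      (Scheme.ΓSpecIso (.of (DualNumber R))).inv (DualNumber.eps : DualNumber R) := by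
  rw [dualGen, ← dualCoord_comp, specDualIso_hom_snd, dualCoord_specMap, dualInt_eps]

/-- The morphism `W × D ⟶ W × D(ι)`, `ε_i ↦ v_i ε`. -/
def linSec (W : Scheme.{u}) (v : ι → ℤ) : W ⨯ dualSpec.{u} ⟶ W ⨯ multiSpec.{u} ι :=
  multiLift prod.fst (fun i => v i • dualGen W) (fun i j => by
    rw [smul_mul_smul_comm, dualGen_mul_self, smul_zero])

lemma map_linSec (k : V ⟶ W) (v : ι → ℤ) :
    prod.map k (𝟙 _) ≫ linSec W v = linSec V v ≫ prod.map k (𝟙 _) := by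
  rw [linSec, linSec, comp_multiLift, multiLift_map]
  refine multiLift_congr (by simp) fun i => ?_
  rw [map_zsmul, map_dualGen]

/-- The morphism `W ⟶ W × D(ι)`, `ε_i ↦ 0`. -/
def multiZero (ι : Type) [Fintype ι] [DecidableEq ι] (W : Scheme.{u}) :
    W ⟶ W ⨯ multiSpec.{u} ι :=
  multiLift (𝟙 W) (fun _ => 0) (by simp)

lemma zeroSec_linSec (W : Scheme.{u}) (v : ι → ℤ) :
    zeroSec W ≫ linSec W v = multiZero ι W := by
  rw [linSec, comp_multiLift]
  refine multiLift_congr (zeroSec_fst W) fun i => ?_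
  rw [map_zsmul, zeroSec_dualGen, smul_zero]

lemma multiZero_map (k : V ⟶ W) :
    multiZero ι V ≫ prod.map k (𝟙 _) = k ≫ multiZero ι W := by
  rw [multiZero, multiZero, comp_multiLift, multiLift_map]
  exact multiLift_congr (by simp) fun i => (map_zero k.appTop.hom).symm

/-- The morphism `W × D × D ⟶ W × D(2)`, `ε_0 ↦ ε₁ε₂`, `ε_1 ↦ ε₂`. -/
def vertSec (W : Scheme.{u}) :
    (W ⨯ dualSpec.{u}) ⨯ dualSpec.{u} ⟶ W ⨯ multiSpec.{u} (Fin 2) :=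
  multiLift (prod.fst ≫ prod.fst)
    (fun i => (if i = 0 then (prod.fst : (W ⨯ dualSpec.{u}) ⨯ dualSpec.{u} ⟶ _).appTop (dualGen W) else 1) * dualGen (W ⨯ dualSpec.{u}))
    (fun i j => by rw [mul_mul_mul_comm, dualGen_mul_self, mul_zero])

lemma map_vertSec (k : V ⟶ W) :
    prod.map (prod.map k (𝟙 _)) (𝟙 _) ≫ vertSec W = vertSec V ≫ prod.map k (𝟙 _) := by
  rw [vertSec, vertSec, comp_multiLift, multiLift_map]
  refine multiLift_congr (by simp) fun i => ?_
  rw [map_mul, map_dualGen]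
  congr 1
  split_ifs
  · rw [← appTop_comp_apply, prod.map_fst, appTop_comp_apply, map_dualGen]
  · exact map_one _

end Neighbourhoods

/-! ### Infinitesimal neighbourhoods of affine schemes -/

section AffineNeighbourhoods

variable {ι : Type} [Fintype ι] [DecidableEq ι]

/-- The ring homomorphism `R[ε_i] → R[ε]`, `ε_i ↦ v_i ε`. -/
def linHom (R : CommRingCat.{u}) (v : ι → ℤ) : MultiDual ι R →+* DualNumber R :=
  MultiDual.desc (dualIncl R).hom (fun i => v i • (DualNumber.eps : DualNumber R)) (fun i j => by
    refine (smul_mul_smul_comm (v i) (DualNumber.eps : DualNumber R) (v j) _).trans ?_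
    rw [DualNumber.eps_mul_eps, smul_zero])

lemma linHom_fst (R : CommRingCat.{u}) (v : ι → ℤ) (c : MultiDual ι R) :
    (linHom R v c).fst = c.fst := by
  change TrivSqZeroExt.fst (TrivSqZeroExt.inl c.fst + ∑ i, TrivSqZeroExt.inl (c.snd i) *
    (v i • (DualNumber.eps : DualNumber R)) : DualNumber R) = c.fst
  simp [TrivSqZeroExt.fst_sum]

lemma linHom_snd (R : CommRingCat.{u}) (v : ι → ℤ) (c : MultiDual ι R) :
    (linHom R v c).snd = ∑ i, v i • c.snd i := by
  change TrivSqZeroExt.snd (TrivSqZeroExt.inl c.fst + ∑ i, TrivSqZeroExt.inl (c.snd i) *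
    (v i • (DualNumber.eps : DualNumber R)) : DualNumber R) = ∑ i, v i • c.snd i
  simp [mul_comm, TrivSqZeroExt.snd_sum]

lemma specMap_linHom (R : CommRingCat.{u}) (v : ι → ℤ) :
    Spec.map (CommRingCat.ofHom (linHom R v)) ≫ (specMultiIso ι R).hom =
      (specDualIso R).hom ≫ linSec (Spec R) v := by
  refine (specMap_desc (dualIncl R) _ _).trans ?_
  rw [linSec, comp_multiLift]
  refine multiLift_congr (specDualIso_hom_fst R).symm fun i => ?_
  rw [map_zsmul, map_zsmul, specDualIso_dualGen]

/-- `R[ε_i] ⟶ R`, `ε_i ↦ 0`. -/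
def multiFst (ι : Type) (R : CommRingCat.{u}) : CommRingCat.of (MultiDual ι R) ⟶ R :=
  CommRingCat.ofHom (TrivSqZeroExt.fstHom R R (ι → R)).toRingHom

lemma specMap_multiFst (R : CommRingCat.{u}) :
    Spec.map (multiFst ι R) ≫ (specMultiIso ι R).hom = multiZero ι (Spec R) := by
  have h : multiFst ι R = CommRingCat.ofHom (MultiDual.desc (𝟙 R : R ⟶ R).hom
      (fun _ : ι => (0 : R)) (by simp)) := by
    refine MultiDual.hom_ext (fun r => ?_) (fun i => ?_)
    · exact (MultiDual.desc_inl (𝟙 R : R ⟶ R).hom (fun _ : ι => (0 : R)) (by simp) r).symm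
    · exact (MultiDual.desc_eps (𝟙 R : R ⟶ R).hom (fun _ : ι => (0 : R)) (by simp) i).symm
  rw [h, specMap_desc]
  exact multiLift_congr (Spec.map_id R) fun i => map_zero _

/-- `multiFst` is a split surjection whose kernel squares to zero, so it induces a homeomorphism of
spectra. Hence a morphism out of `Spec R[ε_i]` lands in an open subscheme as soon as its restriction
to `Spec R` does. -/
lemma specMap_multiFst_surjective (R : CommRingCat.{u}) :
    Function.Surjective (Spec.map (multiFst ι R)) := by
  refine (PrimeSpectrum.isHomeomorph_comap (multiFst ι R).hom
    (fun x => ⟨1, one_pos, TrivSqZeroExt.inl x, by rw [pow_one]; rfl⟩) (fun x hx => ?_)).surjective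
  refine ⟨2, ?_⟩
  have hx : x ∈ TrivSqZeroExt.kerIdeal R (ι → R) := hx
  have := Ideal.pow_mem_pow hx 2
  rwa [TrivSqZeroExt.kerIdeal_sq] at this

/-- Factoring through an open immersion is a condition on points only, so it can be tested after a
surjection. -/
lemma exists_lift_of_surjective {W₀ W Z P : Scheme.{u}} (i : W₀ ⟶ W)
    (hi : Function.Surjective i) (g : W ⟶ Z) (j : P ⟶ Z) [IsOpenImmersion j] (k : W₀ ⟶ P)
    (h : i ≫ g = k ≫ j) : ∃ g' : W ⟶ P, g' ≫ j = g := by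
  refine ⟨IsOpenImmersion.lift j g ?_, IsOpenImmersion.lift_fac _ _ _⟩
  rintro _ ⟨x, rfl⟩
  obtain ⟨y, rfl⟩ := hi x
  exact ⟨k y, congr($h.symm y)⟩

/-- Two morphisms from `Spec R[ε_i]` into a scheme agree if their restriction to `Spec R` factors
through an affine open subscheme and they agree on enough other closed subschemes. -/
lemma specMulti_hom_ext {R B : CommRingCat.{u}} {Z : Scheme.{u}} (j : Spec B ⟶ Z)
    [IsOpenImmersion j] (k : Spec R ⟶ Spec B) {s s' : Spec (.of (MultiDual ι R)) ⟶ Z}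
    (hs : Spec.map (multiFst ι R) ≫ s = k ≫ j) (hs' : Spec.map (multiFst ι R) ≫ s' = k ≫ j)
    {κ : Type*} (Q : κ → CommRingCat.{u}) (q : ∀ i, .of (MultiDual ι R) ⟶ Q i)
    (hq : ∀ c c' : MultiDual ι R, c.fst = c'.fst → (∀ i, q i c = q i c') → c = c')
    (h : ∀ i, Spec.map (q i) ≫ s = Spec.map (q i) ≫ s') : s = s' := by
  -- Both morphisms factor through `Spec B`, hence are homomorphisms `B ⟶ R[ε_i]`; by `hq` the
  -- constant term and the `q i` together separate elements of `R[ε_i]`.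
  obtain ⟨t, rfl⟩ := exists_lift_of_surjective _ (specMap_multiFst_surjective R) s j k hs
  obtain ⟨t', rfl⟩ := exists_lift_of_surjective _ (specMap_multiFst_surjective R) s' j k hs'
  obtain ⟨x, rfl⟩ := Spec.map_surjective t
  obtain ⟨y, rfl⟩ := Spec.map_surjective t'
  have e : x ≫ multiFst ι R = y ≫ multiFst ι R := Spec.map_injective (by
    rw [Spec.map_comp, Spec.map_comp, ← cancel_mono j, Category.assoc, hs, Category.assoc, hs'])
  have e' (i : κ) : x ≫ q i = y ≫ q i := Spec.map_injective (by
    rw [Spec.map_comp, Spec.map_comp, ← cancel_mono j, Category.assoc, h, Category.assoc])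
  congr 2
  exact CommRingCat.hom_ext (RingHom.ext fun b => hq _ _ congr($e b) fun i => congr($(e' i) b))

end AffineNeighbourhoods

/-! ### Gluing of morphisms out of a product -/

section Glue

variable {W E Q : Scheme.{u}} (𝒱 : W.OpenCover)

/-- The cover of `W × E` pulled back from `𝒱` consists, up to isomorphism, of the `𝒱.X i × E`. -/
lemma pullback_fst_eq_lift_map (i : 𝒱.I₀) :
    pullback.fst (prod.fst : W ⨯ E ⟶ W) (𝒱.f i) =
      prod.lift (pullback.snd prod.fst (𝒱.f i)) (pullback.fst prod.fst (𝒱.f i) ≫ prod.snd) ≫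
        prod.map (𝒱.f i) (𝟙 _) := by
  apply Limits.prod.hom_ext
  · rw [Category.assoc, prod.map_fst, prod.lift_fst_assoc, pullback.condition]
  · rw [Category.assoc, prod.map_snd, prod.lift_snd_assoc, Category.comp_id]

lemma prod_hom_ext_of_openCover {a b : W ⨯ E ⟶ Q}
    (h : ∀ i, prod.map (𝒱.f i) (𝟙 _) ≫ a = prod.map (𝒱.f i) (𝟙 _) ≫ b) : a = b := by
  refine Scheme.Cover.hom_ext (𝒱.pullback₁ prod.fst) _ _ fun (i : 𝒱.I₀) => ?_
  change pullback.fst (prod.fst : W ⨯ E ⟶ W) (𝒱.f i) ≫ a =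
    pullback.fst (prod.fst : W ⨯ E ⟶ W) (𝒱.f i) ≫ b
  rw [pullback_fst_eq_lift_map, Category.assoc, Category.assoc, h]

lemma exists_glue_prod (s : ∀ i, 𝒱.X i ⨯ E ⟶ Q)
    (h : ∀ i j, prod.map (pullback.fst (𝒱.f i) (𝒱.f j)) (𝟙 _) ≫ s i =
      prod.map (pullback.snd (𝒱.f i) (𝒱.f j)) (𝟙 _) ≫ s j) :
    ∃ g : W ⨯ E ⟶ Q, ∀ i, prod.map (𝒱.f i) (𝟙 _) ≫ g = s i := by
  let t (i : 𝒱.I₀) : pullback (prod.fst : W ⨯ E ⟶ W) (𝒱.f i) ⟶ 𝒱.X i ⨯ E :=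
    prod.lift (pullback.snd _ _) (pullback.fst _ _ ≫ prod.snd)
  have ht (i : 𝒱.I₀) : t i ≫ prod.fst = pullback.snd _ _ := prod.lift_fst _ _
  have ht' (i : 𝒱.I₀) : t i ≫ prod.snd = pullback.fst _ _ ≫ prod.snd := prod.lift_snd _ _
  -- Points of `𝒱.X i × E` and `𝒱.X j × E` with the same image in `W × E` come from one point of
  -- `(𝒱.X i ×_W 𝒱.X j) × E`, where `h` applies.
  have key {P : Scheme.{u}} (i j : 𝒱.I₀) (a : P ⟶ 𝒱.X i ⨯ E) (b : P ⟶ 𝒱.X j ⨯ E)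
      (hf : (a ≫ prod.fst) ≫ 𝒱.f i = (b ≫ prod.fst) ≫ 𝒱.f j)
      (hs : a ≫ prod.snd = b ≫ prod.snd) : a ≫ s i = b ≫ s j := by
    let c : P ⟶ pullback (𝒱.f i) (𝒱.f j) ⨯ E :=
      prod.lift (pullback.lift (a ≫ prod.fst) (b ≫ prod.fst) hf) (a ≫ prod.snd)
    have ha : a = c ≫ prod.map (pullback.fst _ _) (𝟙 _) := by
      apply Limits.prod.hom_ext
      · rw [Category.assoc, prod.map_fst, prod.lift_fst_assoc, pullback.lift_fst]
      · rw [Category.assoc, prod.map_snd, Category.comp_id, prod.lift_snd]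
    have hb : b = c ≫ prod.map (pullback.snd _ _) (𝟙 _) := by
      apply Limits.prod.hom_ext
      · rw [Category.assoc, prod.map_fst, prod.lift_fst_assoc, pullback.lift_snd]
      · rw [Category.assoc, prod.map_snd, Category.comp_id, prod.lift_snd, hs]
    rw [ha, hb, Category.assoc, Category.assoc, h]
  have key' {P : Scheme.{u}} (i j : 𝒱.I₀) (a : P ⟶ pullback prod.fst (𝒱.f i))
      (b : P ⟶ pullback prod.fst (𝒱.f j)) (hc : a ≫ pullback.fst _ _ = b ≫ pullback.fst _ _) :
      a ≫ t i ≫ s i = b ≫ t j ≫ s j := by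
    rw [← Category.assoc, ← Category.assoc]
    refine key i j _ _ ?_ ?_
    · rw [Category.assoc a, ht, Category.assoc b, ht, Category.assoc, Category.assoc,
        ← pullback.condition, ← pullback.condition, ← Category.assoc, hc, Category.assoc]
    · rw [Category.assoc, ht', Category.assoc, ht', ← Category.assoc, hc, Category.assoc]
  have hglue (i j : 𝒱.I₀) := key' i j (pullback.fst _ _) (pullback.snd _ _) pullback.condition
  refine ⟨Scheme.Cover.glueMorphisms (𝒱.pullback₁ prod.fst) (fun i => t i ≫ s i) hglue, ?_⟩
  · intro i
    have e : prod.map (𝒱.f i) (𝟙 E) = pullback.lift (f := prod.fst) (g := 𝒱.f i)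
        (prod.map (𝒱.f i) (𝟙 E)) prod.fst (by simp) ≫ pullback.fst _ _ :=
      (pullback.lift_fst _ _ _).symm
    have hg := Scheme.Cover.ι_glueMorphisms (𝒱.pullback₁ (prod.fst : W ⨯ E ⟶ W))
      (fun i => t i ≫ s i) hglue i
    refine (congr($e ≫ _)).trans ((Category.assoc _ _ _).trans ((congrArg _ hg).trans ?_))
    refine (Category.assoc _ _ _).symm.trans ((congrArg (· ≫ _) ?_).trans (Category.id_comp _))
    apply Limits.prod.hom_ext
    · rw [Category.assoc, ht, pullback.lift_snd, Category.id_comp]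
    · rw [Category.assoc, ht', pullback.lift_fst_assoc, prod.map_snd, Category.id_comp,
        Category.comp_id]

end Glue

/-! ### `W × D(ι)` as an amalgamated sum of copies of `W × D` -/

section Existence

variable {ι : Type} [Fintype ι] [DecidableEq ι] {W Z : Scheme.{u}}

/-- If `x_i : B → R[ε]` have the same constant term, this is
`b ↦ x₀ b + Σ_i (x_i b)₁ ε_i`. -/
def multiGlue {B R : Type u} [CommRing B] [CommRing R] (x₀ : B →+* R) (x : ι → B →+* DualNumber R)
    (h : ∀ i b, (x i b).fst = x₀ b) : B →+* MultiDual ι R where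
  toFun b := TrivSqZeroExt.inl (x₀ b) + TrivSqZeroExt.inr (fun i => (x i b).snd)
  map_one' := TrivSqZeroExt.ext (by simp) (funext fun i => by simp)
  map_zero' := TrivSqZeroExt.ext (by simp) (funext fun i => by simp)
  map_add' b c := TrivSqZeroExt.ext (by simp) (funext fun i => by simp)
  map_mul' b c := TrivSqZeroExt.ext (by simp) (funext fun i => by
    simp [h, mul_comm])

/-- The unit vectors `v` recover the `x i`, so the axes of the combined homomorphism are the given
ones; the vector with all entries `1` adds their `ε`-coefficients, which is the sum of tangent
vectors. -/
lemma linHom_multiGlue {B : Type u} [CommRing B] {R : CommRingCat.{u}} (x₀ : B →+* R)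
    (x : ι → B →+* DualNumber R) (h : ∀ i b, (x i b).fst = x₀ b) (v : ι → ℤ) (b : B) :
    linHom R v (multiGlue x₀ x h b) =
      TrivSqZeroExt.inl (x₀ b) + TrivSqZeroExt.inr (∑ i, v i • (x i b).snd) := by
  refine TrivSqZeroExt.ext ?_ ?_
  · simp [linHom_fst, multiGlue]
  · simp [linHom_snd, multiGlue]

/-- A cover of `W` by affine schemes that are mapped by `z` into affine open subschemes. -/
lemma exists_affine_cover (z : W ⟶ Z) : ∃ (R B : W → CommRingCat.{u}) (k : ∀ x, Spec (R x) ⟶ W)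
    (_ : ∀ x, IsOpenImmersion (k x)) (_ : ∀ x, x ∈ Set.range (k x))
    (j : ∀ x, Spec (B x) ⟶ Z) (k' : ∀ x, Spec (R x) ⟶ Spec (B x)),
    (∀ x, IsOpenImmersion (j x)) ∧ ∀ x, k x ≫ z = k' x ≫ j x := by
  choose R k hk i k' hx hkk using exists_local (𝟙 Z) z
  exact ⟨R, _, k, hk, hx, fun x => (i x).hU.fromSpec, k', fun x => inferInstance, hkk⟩

/-- Morphisms `W × D(ι) ⟶ Z` are determined by their restrictions along the axes. -/
lemma multi_hom_ext [Nonempty ι] {s s' : W ⨯ multiSpec.{u} ι ⟶ Z}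
    (h : ∀ i : ι, linSec W (Pi.single i 1) ≫ s = linSec W (Pi.single i 1) ≫ s') : s = s' := by
  -- The common restriction to `W` is read off any one axis; this is where `ι` must be nonempty.
  have h₀ : multiZero ι W ≫ s = multiZero ι W ≫ s' := by
    obtain ⟨i⟩ := ‹Nonempty ι›
    rw [← zeroSec_linSec W (Pi.single i 1), Category.assoc, h, Category.assoc]
  obtain ⟨R, B, k, hk, hx, j, k', hj, hkj⟩ := exists_affine_cover (multiZero ι W ≫ s)
  refine prod_hom_ext_of_openCover (coverOfLocal R k hk hx) fun (x : W) => ?_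
  change prod.map (k x) (𝟙 _) ≫ s = prod.map (k x) (𝟙 _) ≫ s'
  have := hj x
  rw [← cancel_epi (specMultiIso ι (R x)).hom]
  refine specMulti_hom_ext (j x) (k' x) ?_ ?_ (fun _ : ι => .of (DualNumber (R x)))
    (fun i => CommRingCat.ofHom (linHom (R x) (Pi.single i 1))) ?_ fun i => ?_
  · rw [reassoc_of% @specMap_multiFst, reassoc_of% @multiZero_map, hkj]
  · rw [reassoc_of% @specMap_multiFst, reassoc_of% @multiZero_map, ← h₀, hkj]
  -- The `i`-th axis detects exactly the coefficient of `ε_i`.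
  · intro c c' h₁ h₂
    refine TrivSqZeroExt.ext h₁ (funext fun i => ?_)
    have := congrArg TrivSqZeroExt.snd (h₂ i)
    change TrivSqZeroExt.snd (linHom _ _ c) = TrivSqZeroExt.snd (linHom _ _ c') at this
    simpa [linHom_snd, Pi.single_apply] using this
  · rw [reassoc_of% @specMap_linHom, reassoc_of% @specMap_linHom, ← reassoc_of% @map_linSec,
      ← reassoc_of% @map_linSec, h]

/-- Morphisms `W × D ⟶ Z` with the same restriction to `W` can be combined to a morphism
`W × D(ι) ⟶ Z`. -/
lemma exists_multi (z : W ⟶ Z) (a : ι → (W ⨯ dualSpec.{u} ⟶ Z)) (h : ∀ i, zeroSec W ≫ a i = z)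
    [Nonempty ι] : ∃ s : W ⨯ multiSpec.{u} ι ⟶ Z, ∀ i, linSec W (Pi.single i 1) ≫ s = a i := by
  obtain ⟨R, B, k, hk, hx, j, k', hj, hkj⟩ := exists_affine_cover z
  have key (x : W) : ∃ s : Spec (R x) ⨯ multiSpec.{u} ι ⟶ Z,
      ∀ i, linSec _ (Pi.single i 1) ≫ s = prod.map (k x) (𝟙 _) ≫ a i := by
    have := hj x
    have hz (i : ι) : zeroSec _ ≫ prod.map (k x) (𝟙 _) ≫ a i = k' x ≫ j x := by
      rw [reassoc_of% @zeroSec_map, h, hkj]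
    -- At `ε = 0` every `a i` maps into the same affine open, so each of them factors through it
    -- entirely.
    choose g hg using fun i => exists_lift_of_zeroSec (prod.map (k x) (𝟙 _) ≫ a i) (j x) (k' x)
      (hz i)
    choose y hy using fun i => Spec.map_surjective ((specDualIso (R x)).hom ≫ g i)
    obtain ⟨y₀, hy₀⟩ := Spec.map_surjective (k' x)
    -- The homomorphisms `y i : B ⟶ R[ε]` share the constant term `y₀`, which is what `multiGlue`
    -- requires.
    have hyy (i : ι) : y i ≫ dualFst (R x) = y₀ := Spec.map_injective (by
      rw [Spec.map_comp, hy, reassoc_of% @SpecMap_dualFst_iso, hy₀, ← cancel_mono (j x),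
        Category.assoc, hg, hz])
    have hyy' (i : ι) (b) : ((y i).hom b).fst = y₀.hom b := congr($(hyy i) b)
    refine ⟨(specMultiIso ι (R x)).inv ≫ Spec.map (CommRingCat.ofHom
      (multiGlue y₀.hom (fun i => (y i).hom) hyy')) ≫ j x, fun i => ?_⟩
    rw [← cancel_epi (specDualIso _).hom, ← reassoc_of% @specMap_linHom, Iso.hom_inv_id_assoc,
      ← hg, ← Category.assoc _ (g i), ← hy, ← Spec.map_comp_assoc]
    congr 2
    refine CommRingCat.hom_ext (RingHom.ext fun b => ?_)
    refine (linHom_multiGlue y₀.hom (fun i => (y i).hom) hyy' _ b).trans ?_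
    refine TrivSqZeroExt.ext ?_ ?_
    · simpa using (hyy' i b).symm
    · simp [Pi.single_apply]
  choose s hs using key
  -- The local solutions agree on overlaps because they are determined by their axes.
  obtain ⟨g, hg⟩ := exists_glue_prod (coverOfLocal R k hk hx) s (fun (x : W) (y : W) => by
    refine multi_hom_ext fun i => ?_
    change _ ≫ prod.map (pullback.fst (k x) (k y)) (𝟙 _) ≫ s x =
      _ ≫ prod.map (pullback.snd (k x) (k y)) (𝟙 _) ≫ s y
    rw [← reassoc_of% @map_linSec, ← reassoc_of% @map_linSec, hs, hs, prod.map_map_assoc,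
      prod.map_map_assoc, pullback.condition])
  refine ⟨g, fun i => prod_hom_ext_of_cover (coverOfLocal R k hk hx) fun (x : W) => ?_⟩
  change prod.map (k x) (𝟙 _) ≫ _ ≫ g = prod.map (k x) (𝟙 _) ≫ a i
  rw [reassoc_of% @map_linSec, ← hs, ← hg]

end Existence

/-! ### Addition in terms of `D(2)` -/

section Addition

lemma globalHom_injective {C : CommRingCat.{u}} {W : Scheme.{u}} {a b : W ⟶ Spec C}
    (h : globalHom a = globalHom b) : a = b := by
  rw [← toSpecΓ_globalHom a, h, toSpecΓ_globalHom]

/-- `affineAdd` passes through global sections; on an affine source this can be undone, which leaves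
the sum at the level of rings. -/
lemma affineAdd_specMap {A B R : CommRingCat.{u}} (φ : A ⟶ B) (α β : symKaehler φ ⟶ R)
    (h : symKaehlerIncl φ ≫ α = symKaehlerIncl φ ≫ β)
    (h' : Spec.map α ≫ Spec.map (symKaehlerIncl φ) = Spec.map β ≫ Spec.map (symKaehlerIncl φ)) :
    affineAdd φ (Spec.map α) (Spec.map β) h' = Spec.map (symKaehlerAdd φ α β h) := by
  apply globalHom_injective
  rw [affineAdd, globalHom_toSpecΓ]
  refine symKaehler_hom_ext (fun c => ?_) (fun c => ?_)
  · rw [symKaehlerAdd_incl, globalHom_specMap, globalHom_specMap, symKaehlerAdd_incl]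
  · rw [symKaehlerAdd_d, globalHom_specMap, globalHom_specMap, globalHom_specMap, symKaehlerAdd_d,
      map_add]

variable {ι : Type} [Fintype ι] [DecidableEq ι]

lemma specDualIso_linSec_specMap {B R : CommRingCat.{u}} (v : ι → ℤ)
    (x : B ⟶ .of (MultiDual ι R)) (y : B ⟶ .of (DualNumber R))
    (h : ∀ b, linHom R v (x b) = y b) :
    (specDualIso R).hom ≫ linSec _ v ≫ (specMultiIso ι R).inv ≫ Spec.map x = Spec.map y := by
  rw [← reassoc_of% @specMap_linHom, Iso.hom_inv_id_assoc, ← Spec.map_comp]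
  congr 1
  exact CommRingCat.hom_ext (RingHom.ext h)

variable {Z S W : Scheme.{u}} {f : Z ⟶ S}

/-- The sum `a + b` corresponds to the restriction along `D ⟶ D(2)`, `ε_i ↦ ε`, of the morphism
that combines the morphisms belonging to `a` and `b`. -/
lemma map_addHom_tangentUniv (a b : W ⟶ tangentScheme f)
    (h : a ≫ tangentProj f = b ≫ tangentProj f) (s : W ⨯ multiSpec.{u} (Fin 2) ⟶ Z)
    (ha : linSec W (Pi.single 0 1) ≫ s = prod.map a (𝟙 _) ≫ tangentUniv f)
    (hb : linSec W (Pi.single 1 1) ≫ s = prod.map b (𝟙 _) ≫ tangentUniv f) :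
    prod.map (addHom a b h) (𝟙 _) ≫ tangentUniv f = linSec W (fun _ => 1) ≫ s := by
  choose R k hk i k' hx hkk using exists_local f (a ≫ tangentProj f)
  refine prod_hom_ext_of_cover (coverOfLocal R k hk hx) fun (x : W) => ?_
  change prod.map (k x) (𝟙 _) ≫ _ = prod.map (k x) (𝟙 _) ≫ _
  -- Locally `a` and `b` take values in one chart and become homomorphisms `α`, `β` out of `Sym(Ω)`
  -- that agree on functions of `U`; by construction the sum is then `symKaehlerAdd`.
  let t : Spec (R x) ⟶ pullback (a ≫ tangentProj f) (i x).hU.fromSpec :=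
    pullback.lift (k x) (k' x) (hkk x)
  obtain ⟨α, hα⟩ := Spec.map_surjective (t ≫ restr a _ rfl (i x))
  obtain ⟨β, hβ⟩ := Spec.map_surjective (t ≫ restr b _ h.symm (i x))
  have hαa : Spec.map α ≫ chart (i x) = k x ≫ a := by
    rw [hα, Category.assoc, restr_chart, pullback.lift_fst_assoc]
  have hβb : Spec.map β ≫ chart (i x) = k x ≫ b := by
    rw [hβ, Category.assoc, restr_chart, pullback.lift_fst_assoc]
  have hαβ' : Spec.map α ≫ Spec.map (symKaehlerIncl (i x).ringHom) =
      Spec.map β ≫ Spec.map (symKaehlerIncl (i x).ringHom) := by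
    rw [hα, hβ, Category.assoc, Category.assoc, restr_incl, restr_incl]
  have hαβ : symKaehlerIncl (i x).ringHom ≫ α = symKaehlerIncl (i x).ringHom ≫ β :=
    Spec.map_injective (by rw [Spec.map_comp, Spec.map_comp, hαβ'])
  have hadd : k x ≫ addHom a b h =
      Spec.map (symKaehlerAdd _ α β hαβ) ≫ chart (i x) := by
    have : k x = t ≫ pullback.fst _ _ := (pullback.lift_fst _ _ _).symm
    rw [this, Category.assoc, fst_addHom, addAux, ← Category.assoc, comp_affineAdd]
    simp only [← hα, ← hβ]
    rw [affineAdd_specMap _ _ _ hαβ]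
  -- In the chart, the morphism belonging to a tangent vector `γ` is the homomorphism `b ↦ γ(b) +
  -- γ(db)ε`.
  have key (c : W ⟶ tangentScheme f) (γ : symKaehler (i x).ringHom ⟶ R x)
      (hc : Spec.map γ ≫ chart (i x) = k x ≫ c) :
      (specDualIso _).hom ≫ prod.map (k x) (𝟙 _) ≫ prod.map c (𝟙 _) ≫ tangentUniv f =
        Spec.map (CommRingCat.ofHom ((dualMap γ.hom).comp (symKaehlerUniv (i x).ringHom))) ≫
          (i x).hU.fromSpec := by
    rw [prod.map_map_assoc, ← hc, ← prod.map_map_assoc, chart_tangentUniv,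
      ← reassoc_of% @map_specDualIso, reassoc_of% @specDualIso_affineUniv, ← Spec.map_comp_assoc]
    rfl
  let y : Fin 2 → Γ(Z, (i x).U) →+* DualNumber (R x) :=
    ![(dualMap α.hom).comp (symKaehlerUniv (i x).ringHom),
      (dualMap β.hom).comp (symKaehlerUniv (i x).ringHom)]
  have hy (l : Fin 2) (c) : (y l c).fst = (symKaehlerIncl (i x).ringHom ≫ α).hom c := by
    fin_cases l
    · rfl
    · exact congr($hαβ c).symm
  let y' : Γ(Z, (i x).U) ⟶ .of (MultiDual (Fin 2) (R x)) := CommRingCat.ofHom (multiGlue _ y hy)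
  -- The local form of `s` is forced, since a morphism on `D(2)` is determined by its two axes.
  have hs : prod.map (k x) (𝟙 _) ≫ s = (specMultiIso (Fin 2) (R x)).inv ≫
      Spec.map y' ≫ (i x).hU.fromSpec := by
    refine multi_hom_ext fun l => ?_
    have e := congr($(specDualIso_linSec_specMap (Pi.single l 1) y' (CommRingCat.ofHom (y l))
      fun c => (linHom_multiGlue _ y hy _ c).trans (TrivSqZeroExt.ext
        (by simpa using (hy l c).symm) (by simp [Pi.single_apply]))) ≫ (i x).hU.fromSpec)
    simp only [Category.assoc] at e
    rw [← cancel_epi (specDualIso _).hom, e, ← reassoc_of% @map_linSec]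
    fin_cases l
    · exact congr(_ ≫ _ ≫ $ha).trans (key a α hαa)
    · exact congr(_ ≫ _ ≫ $hb).trans (key b β hβb)
  rw [← cancel_epi (specDualIso _).hom, key _ _ hadd.symm, reassoc_of% @map_linSec, hs]
  -- On the diagonal the coefficient of `ε` is `α(db) + β(db)`, the value of `symKaehlerAdd` on
  -- `db`.
  have e := congr($(specDualIso_linSec_specMap (fun _ => 1) y' (CommRingCat.ofHom
    ((dualMap (symKaehlerAdd _ α β hαβ).hom).comp (symKaehlerUniv (i x).ringHom)))
      fun c => (linHom_multiGlue _ y hy _ c).trans (TrivSqZeroExt.ext ?_ ?_)) ≫ (i x).hU.fromSpec)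
  · simp only [Category.assoc] at e
    exact e.symm
  · refine Eq.trans ?_ (symKaehlerAdd_incl _ α β hαβ c).symm
    simp
  · refine Eq.trans ?_ (symKaehlerAdd_d _ α β hαβ c).symm
    simp
    rfl

end Addition

/-! ### The coequalizer presentation of `D(2)` -/

section Vertical

/-- `Spec R[ε₁][ε₂] ≅ Spec R × D × D`. -/
def specDualIso₂ (R : CommRingCat.{u}) :
    Spec (.of (DualNumber (DualNumber R))) ≅ (Spec R ⨯ dualSpec.{u}) ⨯ dualSpec.{u} :=
  specDualIso (.of (DualNumber R)) ≪≫ prod.mapIso (specDualIso R) (Iso.refl _)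

lemma specDualIso₂_hom (R : CommRingCat.{u}) : (specDualIso₂ R).hom =
    (specDualIso (.of (DualNumber R))).hom ≫ prod.map (specDualIso R).hom (𝟙 _) := rfl

/-- The ring homomorphism `R[ε_0, ε_1] → R[ε₁][ε₂]`, `ε_0 ↦ ε₁ε₂`, `ε_1 ↦ ε₂`. -/
def vertHom (R : CommRingCat.{u}) : MultiDual (Fin 2) R →+* DualNumber (DualNumber R) :=
  MultiDual.desc (dualIncl R ≫ dualIncl (.of (DualNumber R))).hom
    (fun i => (if i = 0 then TrivSqZeroExt.inl DualNumber.eps else 1) *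
      (DualNumber.eps : DualNumber (DualNumber R)))
    (fun i j => by
      refine (mul_mul_mul_comm _ (DualNumber.eps : DualNumber (DualNumber R)) _ _).trans ?_
      rw [DualNumber.eps_mul_eps, mul_zero])

/-- The outer `fst` and `snd` separate by powers of `ε₂`, the inner ones by powers of `ε₁`. The
formula shows that `vertHom` is injective and that its image consists of the elements without
`ε₁`-term, the algebraic core of the universality of the vertical lift. -/
lemma vertHom_apply (R : CommRingCat.{u}) (c : MultiDual (Fin 2) R) :
    vertHom R c = (TrivSqZeroExt.inl (TrivSqZeroExt.inl c.fst) + TrivSqZeroExt.inr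
      (TrivSqZeroExt.inl (c.snd 1) + TrivSqZeroExt.inr (c.snd 0)) :
        DualNumber (DualNumber R)) := by
  change (TrivSqZeroExt.inl (TrivSqZeroExt.inl c.fst) +
    ∑ i : Fin 2, TrivSqZeroExt.inl (TrivSqZeroExt.inl (c.snd i)) *
      ((if i = 0 then TrivSqZeroExt.inl DualNumber.eps else 1) *
      (DualNumber.eps : DualNumber (DualNumber R))) : DualNumber (DualNumber R)) = _
  rw [Fin.sum_univ_two]
  refine TrivSqZeroExt.ext ?_ ?_
  · simp
  · refine TrivSqZeroExt.ext ?_ ?_ <;> simp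

lemma specMap_appTop_inv {R Q : CommRingCat.{u}} (g : R ⟶ Q) (r : R) :
    (Spec.map g).appTop ((Scheme.ΓSpecIso R).inv r) = (Scheme.ΓSpecIso Q).inv (g r) :=
  congr($(Scheme.ΓSpecIso_inv_naturality g) r).symm

lemma specDualIso₂_fst (R : CommRingCat.{u}) : (specDualIso₂ R).hom ≫ prod.fst =
    Spec.map (dualIncl (.of (DualNumber R))) ≫ (specDualIso R).hom := by
  rw [specDualIso₂_hom, Category.assoc, prod.map_fst, reassoc_of% @specDualIso_hom_fst]

lemma specDualIso₂_dualGen (R : CommRingCat.{u}) :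
    (specDualIso₂ R).hom.appTop (dualGen (Spec R ⨯ dualSpec.{u})) =
      (Scheme.ΓSpecIso (.of (DualNumber (DualNumber R)))).inv
        (DualNumber.eps : DualNumber (DualNumber R)) := by
  rw [specDualIso₂_hom, appTop_comp_apply, map_dualGen]
  exact specDualIso_dualGen (.of (DualNumber R))

lemma specDualIso₂_fst_dualGen (R : CommRingCat.{u}) :
    (specDualIso₂ R).hom.appTop ((prod.fst :
        (Spec R ⨯ dualSpec.{u}) ⨯ dualSpec.{u} ⟶ _).appTop (dualGen (Spec R))) =
      (Scheme.ΓSpecIso (.of (DualNumber (DualNumber R)))).inv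
        (TrivSqZeroExt.inl DualNumber.eps : DualNumber (DualNumber R)) := by
  rw [← appTop_comp_apply, specDualIso₂_fst, appTop_comp_apply, specDualIso_dualGen]
  exact specMap_appTop_inv (dualIncl (.of (DualNumber R))) _

lemma map_ite_mul {A B C : Type*} [CommRing A] [CommRing B] [CommRing C] (F : A →+* C)
    (G : B →+* C) {x y : A} {x' y' : B} (hx : F x = G x') (hy : F y = G y') (P : Prop)
    [Decidable P] : F ((if P then x else 1) * y) = G ((if P then x' else 1) * y') := by
  split_ifs <;> simp [hx, hy]

lemma specMap_vertHom (R : CommRingCat.{u}) :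
    Spec.map (CommRingCat.ofHom (vertHom R)) ≫ (specMultiIso (Fin 2) R).hom =
      (specDualIso₂ R).hom ≫ vertSec (Spec R) := by
  refine (specMap_desc (dualIncl R ≫ dualIncl (.of (DualNumber R))) _ _).trans ?_
  rw [vertSec, comp_multiLift]
  refine multiLift_congr ?_ fun i => ?_
  · rw [reassoc_of% @specDualIso₂_fst, specDualIso_hom_fst, Spec.map_comp]
  · exact map_ite_mul _ _ (specDualIso₂_fst_dualGen R).symm (specDualIso₂_dualGen R).symm _

variable {W Z : Scheme.{u}}

/-- The morphism `W × {0} ⟶ W × D × D`. -/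
def zeroSec₂ (W : Scheme.{u}) : W ⟶ (W ⨯ dualSpec.{u}) ⨯ dualSpec.{u} :=
  zeroSec W ≫ zeroSec _

lemma zeroSec₂_map {W W' : Scheme.{u}} (k : W ⟶ W') :
    zeroSec₂ W ≫ prod.map (prod.map k (𝟙 _)) (𝟙 _) = k ≫ zeroSec₂ W' := by
  rw [zeroSec₂, zeroSec₂, Category.assoc, zeroSec_map, reassoc_of% @zeroSec_map]

lemma zeroSec₂_vertSec (W : Scheme.{u}) : zeroSec₂ W ≫ vertSec W = multiZero (Fin 2) W := by
  rw [vertSec, comp_multiLift, multiZero]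
  refine multiLift_congr ?_ fun i => ?_
  · rw [zeroSec₂, Category.assoc, reassoc_of% @zeroSec_fst, zeroSec_fst]
  · rw [map_mul, zeroSec₂, appTop_comp_apply _ _ (dualGen _), zeroSec_dualGen]
    simp

lemma specMap_dualFst_comp (R : CommRingCat.{u}) :
    Spec.map (dualFst (.of (DualNumber R)) ≫ dualFst R) ≫ (specDualIso₂ R).hom =
      zeroSec₂ (Spec R) := by
  rw [Spec.map_comp, specDualIso₂_hom, Category.assoc, reassoc_of% @SpecMap_dualFst_iso,
    zeroSec_map, reassoc_of% @SpecMap_dualFst_iso, zeroSec₂]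

lemma zeroSec₂_surjective (R : CommRingCat.{u}) : Function.Surjective (zeroSec₂ (Spec R)) := by
  -- The second zero section starts from the product `Spec R × D`, which must be replaced by `Spec
  -- R[ε]` before the affine statement applies to it.
  have h : zeroSec₂ (Spec R) = zeroSec (Spec R) ≫ (specDualIso R).inv ≫
      zeroSec (Spec (.of (DualNumber R))) ≫ prod.map (specDualIso R).hom (𝟙 _) := by
    rw [zeroSec_map, Iso.inv_hom_id_assoc, zeroSec₂]
  have h' : Function.Surjective (prod.map (specDualIso R).hom (𝟙 dualSpec.{u})) :=
    Scheme.Hom.surjective (prod.mapIso (specDualIso R) (Iso.refl dualSpec.{u})).hom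
  have h'' : Function.Surjective (specDualIso R).inv := Scheme.Hom.surjective _
  intro x
  obtain ⟨x, rfl⟩ := h' x
  obtain ⟨x, rfl⟩ := zeroSec_surjective _ x
  obtain ⟨x, rfl⟩ := h'' x
  obtain ⟨x, rfl⟩ := zeroSec_surjective _ x
  exact ⟨x, by rw [h]; rfl⟩

/-- Since `vertHom` is injective, `W × D × D ⟶ W × D(2)` is an epimorphism: the restriction to `W`
is recovered at `ε₁ = ε₂ = 0`, and locally on `W` both morphisms then land in one affine open. -/
lemma vertSec_hom_ext {s s' : W ⨯ multiSpec.{u} (Fin 2) ⟶ Z}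
    (h : vertSec W ≫ s = vertSec W ≫ s') : s = s' := by
  have h₀ : multiZero (Fin 2) W ≫ s = multiZero (Fin 2) W ≫ s' := by
    rw [← zeroSec₂_vertSec, Category.assoc, h, Category.assoc]
  obtain ⟨R, B, k, hk, hx, j, k', hj, hkj⟩ := exists_affine_cover (multiZero (Fin 2) W ≫ s)
  refine prod_hom_ext_of_openCover (coverOfLocal R k hk hx) fun (x : W) => ?_
  change prod.map (k x) (𝟙 _) ≫ s = prod.map (k x) (𝟙 _) ≫ s'
  have := hj x
  rw [← cancel_epi (specMultiIso (Fin 2) (R x)).hom]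
  refine specMulti_hom_ext (j x) (k' x) ?_ ?_
    (fun _ : Unit => .of (DualNumber (DualNumber (R x))))
    (fun _ => CommRingCat.ofHom (vertHom (R x))) ?_ fun i => ?_
  · rw [reassoc_of% @specMap_multiFst, reassoc_of% @multiZero_map, hkj]
  · rw [reassoc_of% @specMap_multiFst, reassoc_of% @multiZero_map, ← h₀, hkj]
  · intro c c' h₁ h₂
    have := congrArg TrivSqZeroExt.snd (h₂ ())
    change TrivSqZeroExt.snd (vertHom _ c) = TrivSqZeroExt.snd (vertHom _ c') at this
    rw [vertHom_apply, vertHom_apply] at this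
    have h₀ := congrArg TrivSqZeroExt.fst this
    have h₁ := congrArg TrivSqZeroExt.snd this
    refine TrivSqZeroExt.ext ‹_› (funext fun i => ?_)
    fin_cases i
    · simpa using h₁
    · simpa using h₀
  · rw [reassoc_of% @specMap_vertHom, reassoc_of% @specMap_vertHom, ← reassoc_of% @map_vertSec,
      ← reassoc_of% @map_vertSec, h]

/-- For `x : B → R[ε₁][ε₂]` with vanishing coefficient of `ε₁`, the homomorphism
`B → R[ε_0, ε_1]` whose `ε_0`-coefficient is that of `ε₁ε₂` and whose `ε_1`-coefficient is that
of `ε₂`. -/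
def vertDesc {B R : Type u} [CommRing B] [CommRing R] (x : B →+* DualNumber (DualNumber R))
    (h : ∀ b, (x b).fst.snd = 0) : B →+* MultiDual (Fin 2) R where
  toFun b := TrivSqZeroExt.inl (x b).fst.fst +
    TrivSqZeroExt.inr ![(x b).snd.snd, (x b).snd.fst]
  map_one' := by
    refine TrivSqZeroExt.ext (by simp) (funext fun i => ?_)
    fin_cases i <;> simp
  map_zero' := by
    refine TrivSqZeroExt.ext (by simp) (funext fun i => ?_)
    fin_cases i <;> simp
  map_add' b c := by
    refine TrivSqZeroExt.ext (by simp) (funext fun i => ?_)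
    fin_cases i <;> simp
  map_mul' b c := by
    refine TrivSqZeroExt.ext (by simp) (funext fun i => ?_)
    fin_cases i <;> simp [h]

/-- The hypothesis says that the restriction of `g` to `ε₂ = 0` does not depend on `ε₁`. On rings,
the coefficient of `ε₁` vanishes, so the homomorphism takes values in the image of `vertHom`; the
local factorizations are unique and therefore glue. -/
lemma exists_vertSec_comp (g : (W ⨯ dualSpec.{u}) ⨯ dualSpec.{u} ⟶ Z)
    (hg : zeroSec _ ≫ g = prod.fst ≫ zeroSec₂ W ≫ g) :
    ∃ s : W ⨯ multiSpec.{u} (Fin 2) ⟶ Z, vertSec W ≫ s = g := by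
  obtain ⟨R, B, k, hk, hx, j, k', hj, hkj⟩ := exists_affine_cover (zeroSec₂ W ≫ g)
  have key (x : W) : ∃ s : Spec (R x) ⨯ multiSpec.{u} (Fin 2) ⟶ Z,
      vertSec _ ≫ s = prod.map (prod.map (k x) (𝟙 _)) (𝟙 _) ≫ g := by
    have := hj x
    obtain ⟨g', hg'⟩ := exists_lift_of_surjective _ (zeroSec₂_surjective (R x))
      (prod.map (prod.map (k x) (𝟙 _)) (𝟙 _) ≫ g) (j x) (k' x)
      (by rw [reassoc_of% @zeroSec₂_map, hkj])
    obtain ⟨y, hy⟩ := Spec.map_surjective ((specDualIso₂ (R x)).hom ≫ g')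
    -- `hg` in terms of rings: modulo `ε₂`, the homomorphism `y` equals its constant term.
    have hy' : y ≫ dualFst (.of (DualNumber (R x))) = y ≫
        (dualFst (.of (DualNumber (R x))) ≫ dualFst (R x)) ≫ dualIncl (R x) := by
      apply Spec.map_injective
      rw [Spec.map_comp, Spec.map_comp, Spec.map_comp (_ ≫ _), hy, Category.assoc,
        reassoc_of% @specMap_dualFst_comp, specDualIso₂_hom, Category.assoc,
        reassoc_of% @SpecMap_dualFst_iso, reassoc_of% @zeroSec_map, ← specDualIso_hom_fst,
        Category.assoc]
      congr 1
      rw [← cancel_mono (j x)]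
      simp only [Category.assoc]
      rw [hg', reassoc_of% @zeroSec_map, hg, reassoc_of% @zeroSec₂_map, prod.map_fst_assoc]
    have h₀ (b) : (y.hom b).fst.snd = 0 := congr(($hy' b).snd)
    refine ⟨(specMultiIso (Fin 2) (R x)).inv ≫
      Spec.map (CommRingCat.ofHom (vertDesc y.hom h₀)) ≫ j x, ?_⟩
    rw [← cancel_epi (specDualIso₂ _).hom, ← reassoc_of% @specMap_vertHom, Iso.hom_inv_id_assoc,
      ← hg', ← Category.assoc _ g', ← hy, ← Spec.map_comp_assoc]
    congr 2
    refine CommRingCat.hom_ext (RingHom.ext fun b => ?_)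
    refine (vertHom_apply _ _).trans ?_
    have hv : (CommRingCat.ofHom (vertDesc y.hom h₀)).hom' b =
      TrivSqZeroExt.inl (y.hom b).fst.fst +
        TrivSqZeroExt.inr ![(y.hom b).snd.snd, (y.hom b).snd.fst] := rfl
    refine TrivSqZeroExt.ext (TrivSqZeroExt.ext ?_ ?_) (TrivSqZeroExt.ext ?_ ?_)
    · simp [hv]
    · simpa using (h₀ b).symm
    · simp [hv]
    · simp [hv]
  choose s hs using key
  obtain ⟨t, ht⟩ := exists_glue_prod (coverOfLocal R k hk hx) s (fun (x : W) (y : W) => by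
    refine vertSec_hom_ext ?_
    change _ ≫ prod.map (pullback.fst (k x) (k y)) (𝟙 _) ≫ s x =
      _ ≫ prod.map (pullback.snd (k x) (k y)) (𝟙 _) ≫ s y
    rw [← reassoc_of% @map_vertSec, ← reassoc_of% @map_vertSec, hs, hs]
    rw [prod.map_map_assoc, prod.map_map, prod.map_map_assoc, prod.map_map,
      pullback.condition])
  -- The required equality lives on `(W × D) × D`, so the cover of `W` is first pulled back to `W ×
  -- D`.
  refine ⟨t, prod_hom_ext_of_openCover ((coverOfLocal R k hk hx).pullback₁ prod.fst)
    fun (x : W) => ?_⟩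
  change prod.map (pullback.fst (prod.fst : W ⨯ dualSpec.{u} ⟶ W) ((coverOfLocal R k hk hx).f x))
    (𝟙 _) ≫ _ = prod.map (pullback.fst (prod.fst : W ⨯ dualSpec.{u} ⟶ W)
    ((coverOfLocal R k hk hx).f x)) (𝟙 _) ≫ _
  have hm (l : pullback (prod.fst : W ⨯ dualSpec.{u} ⟶ W) (k x) ⟶ Spec (R x) ⨯ dualSpec.{u}) :
      prod.map (l ≫ prod.map (k x) (𝟙 _)) (𝟙 dualSpec.{u}) =
        prod.map l (𝟙 _) ≫ prod.map (prod.map (k x) (𝟙 _)) (𝟙 _) := by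
    rw [prod.map_map, Category.comp_id]
  rw [pullback_fst_eq_lift_map]
  refine congr($(hm _) ≫ _).trans (Eq.trans ?_ congr($(hm _) ≫ _).symm)
  rw [Category.assoc, Category.assoc, reassoc_of% @map_vertSec, ← hs]
  exact congr(_ ≫ _ ≫ $(ht x))

end Vertical

/-! ### Infinitesimal neighbourhoods over a base -/

lemma dualCoord_map_dualMul {V W : Scheme.{u}} (v : V ⟶ (W ⨯ dualSpec.{u}) ⨯ dualSpec.{u}) :
    dualCoord (v ≫ prod.map prod.snd (𝟙 _) ≫ dualMul) =
      dualCoord (v ≫ prod.fst ≫ prod.snd) * dualCoord (v ≫ prod.snd) := by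
  rw [← dualCoord_lift_dualMul]
  congr 1
  rw [← Category.assoc]
  congr 1
  apply Limits.prod.hom_ext
  · rw [prod.lift_fst, Category.assoc, prod.map_fst]
  · rw [prod.lift_snd, Category.assoc, prod.map_snd, Category.comp_id]

lemma dualSwap_proj {W : Scheme.{u}} :
    (prod.lift (prod.map prod.fst (𝟙 _)) (prod.fst ≫ prod.snd) : (W ⨯ dualSpec.{u}) ⨯ dualSpec.{u} ⟶
      (W ⨯ dualSpec.{u}) ⨯ dualSpec.{u}) ≫ prod.fst ≫ prod.snd = prod.snd := by
  rw [prod.lift_fst_assoc, prod.map_snd, Category.comp_id]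

lemma multiCoord_linSec {ι : Type} [Fintype ι] [DecidableEq ι] {V W : Scheme.{u}}
    (v : V ⟶ W ⨯ dualSpec.{u}) (c : ι → ℤ) (i : ι) :
    multiCoord (v ≫ linSec W c ≫ prod.snd) i = c i • dualCoord (v ≫ prod.snd) := by
  rw [linSec, multiLift, prod.lift_snd, multiCoord_comp, multiCoord_multiPoint, map_zsmul,
    dualCoord_comp]
  rfl

lemma multiCoord_vertSec {V W : Scheme.{u}} (v : V ⟶ (W ⨯ dualSpec.{u}) ⨯ dualSpec.{u})
    (i : Fin 2) : multiCoord (v ≫ vertSec W ≫ prod.snd) i =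
      (if i = 0 then dualCoord (v ≫ prod.fst ≫ prod.snd) else 1) * dualCoord (v ≫ prod.snd) := by
  rw [vertSec, multiLift, prod.lift_snd, multiCoord_comp, multiCoord_multiPoint, map_mul,
    dualCoord_comp v prod.snd]
  refine congrArg (· * _) ?_
  split_ifs
  · rw [dualCoord_comp, dualCoord_comp]
    rfl
  · exact map_one _

section OverBase

variable {S : Scheme.{u}} {ι κ : Type} [Fintype ι] [DecidableEq ι] [Fintype κ] [DecidableEq κ]
  {V W W' Z : Over S}

/-- The coordinate `ε` of a generalized element of `W[ε]`. -/
def coord (a : V ⟶ (dualFunctor S).obj W) : Γ(V.left, ⊤) :=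
  dualCoord (a.left ≫ (prod.snd : W.left ⨯ dualSpec.{u} ⟶ dualSpec.{u}))

/-- The main tool for the axioms: used repeatedly, it reduces an equality of morphisms into
`W[ε₁]…[ε_n]` to one of morphisms into `W` and identities in `Γ(V)`. The `comp_…` and `coord_…`
lemmas below evaluate both sides. -/
lemma dual_ext {a b : V ⟶ (dualFunctor S).obj W} (h : a ≫ dualProj W = b ≫ dualProj W)
    (h' : coord a = coord b) : a = b := by
  refine Over.OverMorphism.ext (Limits.prod.hom_ext ?_ ?_)
  · exact congr(($h).left)
  · exact dualCoord_ext h'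

lemma coord_mul_self (a : V ⟶ (dualFunctor S).obj W) : coord a * coord a = 0 :=
  dualCoord_mul_self _

lemma coord_comp (k : V ⟶ W) (a : W ⟶ (dualFunctor S).obj W') :
    coord (k ≫ a) = k.left.appTop (coord a) :=
  (congrArg dualCoord (Category.assoc _ _ _)).trans (dualCoord_comp _ _)

/-- The section `W ⟶ W[ε]`, `ε ↦ 0`. -/
def dualZ (W : Over S) : W ⟶ (dualFunctor S).obj W :=
  Over.homMk (zeroSec W.left) ((prod.lift_fst_assoc _ _ _).trans (Category.id_comp _))

lemma comp_map_dualProj (v : V ⟶ (dualFunctor S).obj W) (k : W ⟶ W') :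
    (v ≫ (dualFunctor S).map k) ≫ dualProj W' = (v ≫ dualProj W) ≫ k :=
  Over.OverMorphism.ext ((Category.assoc _ _ _).trans
    ((congr(v.left ≫ $(prod.map_fst k.left (𝟙 dualSpec.{u})))).trans (Category.assoc _ _ _).symm))

lemma coord_comp_map (v : V ⟶ (dualFunctor S).obj W) (k : W ⟶ W') :
    coord (v ≫ (dualFunctor S).map k) = coord v :=
  congrArg dualCoord ((Category.assoc _ _ _).trans
    (congr(v.left ≫ $((prod.map_snd k.left (𝟙 dualSpec.{u})).trans (Category.comp_id _)))))

lemma comp_dualZ_dualProj (v : V ⟶ W) : (v ≫ dualZ W) ≫ dualProj W = v :=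
  Over.OverMorphism.ext ((Category.assoc _ _ _).trans
    ((congr(v.left ≫ $(zeroSec_fst _))).trans (Category.comp_id _)))

lemma coord_comp_dualZ (v : V ⟶ W) : coord (v ≫ dualZ W) = 0 := by
  refine (congrArg dualCoord ((Category.assoc _ _ _).trans
    (congr(v.left ≫ $(prod.lift_snd _ _))))).trans ?_
  rw [comp_dualZero, dualCoord_dualZero]

lemma comp_dualDiag_dualProj (v : V ⟶ (dualFunctor S).obj ((dualFunctor S).obj W)) :
    (v ≫ dualDiag W) ≫ dualProj W = (v ≫ dualProj _) ≫ dualProj W :=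
  Over.OverMorphism.ext ((Category.assoc _ _ _).trans
    ((congr(v.left ≫ $(prod.lift_fst _ _))).trans (Category.assoc _ _ _).symm))

lemma coord_comp_dualDiag (v : V ⟶ (dualFunctor S).obj ((dualFunctor S).obj W)) :
    coord (v ≫ dualDiag W) = coord (v ≫ dualProj _) * coord v :=
  (congrArg dualCoord ((Category.assoc _ _ _).trans (congr(v.left ≫ $(prod.lift_snd _ _))))).trans
    ((dualCoord_map_dualMul v.left).trans
      (congrArg₂ (· * ·) (congrArg dualCoord (Category.assoc _ _ _).symm) rfl))

lemma comp_dualSwap_dualProj_dualProj (v : V ⟶ (dualFunctor S).obj ((dualFunctor S).obj W)) :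
    ((v ≫ dualSwap W) ≫ dualProj _) ≫ dualProj W = (v ≫ dualProj _) ≫ dualProj W := by
  rw [Category.assoc, Category.assoc, Category.assoc]
  refine congrArg (v ≫ ·) (Over.OverMorphism.ext ?_)
  exact (prod.lift_fst_assoc _ _ _).trans (prod.map_fst _ _)

lemma coord_comp_dualSwap (v : V ⟶ (dualFunctor S).obj ((dualFunctor S).obj W)) :
    coord (v ≫ dualSwap W) = coord (v ≫ dualProj _) :=
  congrArg dualCoord ((Category.assoc _ _ _).trans
    ((congr(v.left ≫ $(prod.lift_snd _ _))).trans (Category.assoc _ _ _).symm))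

lemma coord_comp_dualSwap_dualProj (v : V ⟶ (dualFunctor S).obj ((dualFunctor S).obj W)) :
    coord ((v ≫ dualSwap W) ≫ dualProj _) = coord v := by
  rw [Category.assoc]
  exact congrArg dualCoord ((Category.assoc _ _ _).trans (congr(v.left ≫ $((Category.assoc _ _ _).trans
    dualSwap_proj))))

variable (S ι) in
/-- The functor `W ↦ W × D(ι)` on `S`-schemes. -/
def multiFunctor : Over S ⥤ Over S where
  obj W := Over.mk ((prod.fst : W.left ⨯ multiSpec.{u} ι ⟶ W.left) ≫ W.hom)
  map k := Over.homMk (prod.map k.left (𝟙 _)) (by simp)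

/-- The projection `W × D(ι) ⟶ W`. -/
def multiProj (ι : Type) [Fintype ι] [DecidableEq ι] (W : Over S) :
    (multiFunctor S ι).obj W ⟶ W := Over.homMk prod.fst

/-- The coordinates `ε_i` of a generalized element of `W × D(ι)`. -/
def mcoord (a : V ⟶ (multiFunctor S ι).obj W) (i : ι) : Γ(V.left, ⊤) :=
  multiCoord (a.left ≫ (prod.snd : W.left ⨯ multiSpec.{u} ι ⟶ multiSpec.{u} ι)) i

lemma multi_ext {a b : V ⟶ (multiFunctor S ι).obj W} (h : a ≫ multiProj ι W = b ≫ multiProj ι W)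
    (h' : ∀ i, mcoord a i = mcoord b i) : a = b := by
  refine Over.OverMorphism.ext (Limits.prod.hom_ext ?_ ?_)
  · exact congr(($h).left)
  · exact multiCoord_ext h'

lemma mcoord_mul (a : V ⟶ (multiFunctor S ι).obj W) (i j : ι) : mcoord a i * mcoord a j = 0 :=
  multiCoord_mul _ _ _

lemma mcoord_comp (k : V ⟶ W) (a : W ⟶ (multiFunctor S ι).obj W') (i : ι) :
    mcoord (k ≫ a) i = k.left.appTop (mcoord a i) :=
  (congrArg (multiCoord · i) (Category.assoc _ _ _)).trans (multiCoord_comp _ _ _)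

lemma comp_map_multiProj (v : V ⟶ (multiFunctor S ι).obj W) (k : W ⟶ W') :
    (v ≫ (multiFunctor S ι).map k) ≫ multiProj ι W' = (v ≫ multiProj ι W) ≫ k :=
  Over.OverMorphism.ext ((Category.assoc _ _ _).trans
    ((congr(v.left ≫ $(prod.map_fst k.left (𝟙 (multiSpec.{u} ι))))).trans
      (Category.assoc _ _ _).symm))

lemma mcoord_comp_map (v : V ⟶ (multiFunctor S ι).obj W) (k : W ⟶ W') (i : ι) :
    mcoord (v ≫ (multiFunctor S ι).map k) i = mcoord v i :=
  congrArg (multiCoord · i) ((Category.assoc _ _ _).trans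
    (congr(v.left ≫ $((prod.map_snd k.left (𝟙 (multiSpec.{u} ι))).trans (Category.comp_id _)))))

/-- The generalized element of `W × D(ι)` with given coordinates. -/
def mlift (k : V ⟶ W) (e : ι → Γ(V.left, ⊤)) (he : ∀ i j, e i * e j = 0) :
    V ⟶ (multiFunctor S ι).obj W :=
  Over.homMk (multiLift k.left e he)
    ((prod.lift_fst_assoc k.left (multiPoint e he) _).trans (Over.w k))

lemma mlift_multiProj (k : V ⟶ W) (e : ι → Γ(V.left, ⊤)) (he : ∀ i j, e i * e j = 0) :
    mlift k e he ≫ multiProj ι W = k :=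
  Over.OverMorphism.ext (prod.lift_fst _ _)

lemma mcoord_mlift (k : V ⟶ W) (e : ι → Γ(V.left, ⊤)) (he : ∀ i j, e i * e j = 0) (i : ι) :
    mcoord (mlift k e he) i = e i :=
  (congrArg (multiCoord · i) (prod.lift_snd _ _)).trans (multiCoord_multiPoint e he i)

lemma comp_mlift_multiProj (v : V ⟶ W) (k : W ⟶ W') (e : ι → Γ(W.left, ⊤))
    (he : ∀ i j, e i * e j = 0) : (v ≫ mlift k e he) ≫ multiProj ι W' = v ≫ k := by
  rw [Category.assoc, mlift_multiProj]

lemma mcoord_comp_mlift (v : V ⟶ W) (k : W ⟶ W') (e : ι → Γ(W.left, ⊤))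
    (he : ∀ i j, e i * e j = 0) (i : ι) : mcoord (v ≫ mlift k e he) i = v.left.appTop (e i) := by
  rw [mcoord_comp, mcoord_mlift]

/-- The morphism `W[ε] ⟶ W × D(ι)`, `ε_i ↦ c_i ε`. -/
def lin (c : ι → ℤ) (W : Over S) : (dualFunctor S).obj W ⟶ (multiFunctor S ι).obj W :=
  Over.homMk (linSec W.left c) ((prod.lift_fst_assoc _ _ _).trans (by rfl))

lemma comp_lin_multiProj (v : V ⟶ (dualFunctor S).obj W) (c : ι → ℤ) :
    (v ≫ lin c W) ≫ multiProj ι W = v ≫ dualProj W := by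
  rw [Category.assoc]
  exact congrArg (v ≫ ·) (Over.OverMorphism.ext (prod.lift_fst _ _))

lemma mcoord_comp_lin (v : V ⟶ (dualFunctor S).obj W) (c : ι → ℤ) (i : ι) :
    mcoord (v ≫ lin c W) i = c i • coord v :=
  (congrArg (multiCoord · i) (Category.assoc _ _ _)).trans (multiCoord_linSec v.left c i)

/-- The morphism `W[ε₁][ε₂] ⟶ W × D(2)`, `ε_0 ↦ ε₁ε₂`, `ε_1 ↦ ε₂`. -/
def vert (W : Over S) :
    (dualFunctor S).obj ((dualFunctor S).obj W) ⟶ (multiFunctor S (Fin 2)).obj W :=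
  Over.homMk (vertSec W.left) ((prod.lift_fst_assoc _ _ _).trans (Category.assoc _ _ _))

lemma comp_vert_multiProj (v : V ⟶ (dualFunctor S).obj ((dualFunctor S).obj W)) :
    (v ≫ vert W) ≫ multiProj _ W = (v ≫ dualProj _) ≫ dualProj W := by
  rw [Category.assoc, Category.assoc]
  exact congrArg (v ≫ ·) (Over.OverMorphism.ext (prod.lift_fst _ _))

lemma mcoord_comp_vert (v : V ⟶ (dualFunctor S).obj ((dualFunctor S).obj W)) (i : Fin 2) :
    mcoord (v ≫ vert W) i = (if i = 0 then coord (v ≫ dualProj _) else 1) * coord v :=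
  (congrArg (multiCoord · i) (Category.assoc _ _ _)).trans ((multiCoord_vertSec v.left i).trans
    (congrArg (fun u => (if i = 0 then dualCoord u else 1) * _) (Category.assoc _ _ _).symm))

/-- The morphism `W × D(κ) ⟶ W × D(ι)`, `ε_i ↦ Σ_k N_{ik} ε_k`. -/
def mmat (N : ι → κ → ℤ) (W : Over S) : (multiFunctor S κ).obj W ⟶ (multiFunctor S ι).obj W :=
  mlift (multiProj κ W) (fun i => ∑ k, N i k • mcoord (𝟙 ((multiFunctor S κ).obj W)) k)
    (fun i j => by
      rw [Finset.sum_mul_sum]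
      refine Finset.sum_eq_zero fun _ _ => Finset.sum_eq_zero fun _ _ => ?_
      rw [smul_mul_smul_comm, mcoord_mul, smul_zero])

/-- Passing to generalized elements brings composites into the form `v ≫ _`, to which the coordinate
lemmas apply. -/
lemma hom_ext_of_comp {A B : Over S} {x y : A ⟶ B}
    (h : ∀ (V : Over S) (v : V ⟶ A), v ≫ x = v ≫ y) : x = y := by
  simpa using h _ (𝟙 _)

lemma comp_mmat_multiProj (N : ι → κ → ℤ) (v : V ⟶ (multiFunctor S κ).obj W) :
    (v ≫ mmat N W) ≫ multiProj ι W = v ≫ multiProj κ W :=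
  comp_mlift_multiProj _ _ _ _

lemma mcoord_comp_mmat (N : ι → κ → ℤ) (v : V ⟶ (multiFunctor S κ).obj W) (i : ι) :
    mcoord (v ≫ mmat N W) i = ∑ k, N i k • mcoord v k := by
  rw [mmat, mcoord_comp_mlift, map_sum]
  refine Finset.sum_congr rfl fun k _ => ?_
  rw [map_zsmul, ← mcoord_comp, Category.comp_id]

/-- A linear substitution of the `ε_i` carries the direction `c` to the direction `N c`. -/
lemma lin_mmat (N : ι → κ → ℤ) (c : κ → ℤ) (W : Over S) :
    lin c W ≫ mmat N W = lin (fun i => ∑ k, N i k * c k) W := by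
  refine hom_ext_of_comp fun V v => ?_
  simp only [← Category.assoc]
  refine multi_ext ?_ fun i => ?_
  · rw [comp_mmat_multiProj, comp_lin_multiProj, comp_lin_multiProj]
  · rw [mcoord_comp_mmat, mcoord_comp_lin, Finset.sum_smul]
    refine Finset.sum_congr rfl fun k _ => ?_
    rw [mcoord_comp_lin, smul_smul]

/-- The morphism `W × D(ι) × D ⟶ W × D(ι)`, `ε_i ↦ ε_i ε`. -/
def mscale (W : Over S) : (dualFunctor S).obj ((multiFunctor S ι).obj W) ⟶
    (multiFunctor S ι).obj W :=
  mlift (dualProj _ ≫ multiProj ι W) (fun i => mcoord (dualProj _) i * coord (𝟙 _))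
    (fun i j => by rw [mul_mul_mul_comm, coord_mul_self, mul_zero])

/-- The morphism `W × D(ι) × D ⟶ W × D × D(ι)` that interchanges the factors. -/
def mswap (W : Over S) : (dualFunctor S).obj ((multiFunctor S ι).obj W) ⟶
    (multiFunctor S ι).obj ((dualFunctor S).obj W) :=
  mlift ((dualFunctor S).map (multiProj ι W)) (fun i => mcoord (dualProj _) i)
    (fun i j => mcoord_mul _ i j)

/-- The morphism `W × D × D(2) ⟶ W × D(2)`, `ε_0 ↦ ε ε_0`, `ε_1 ↦ ε_1`. -/
def mvert (W : Over S) : (multiFunctor S (Fin 2)).obj ((dualFunctor S).obj W) ⟶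
    (multiFunctor S (Fin 2)).obj W :=
  mlift (multiProj _ _ ≫ dualProj W)
    (fun i => (if i = 0 then coord (multiProj (Fin 2) _) else 1) * mcoord (𝟙 _) i)
    (fun i j => by rw [mul_mul_mul_comm, mcoord_mul, mul_zero])

lemma comp_mscale_multiProj (v : V ⟶ (dualFunctor S).obj ((multiFunctor S ι).obj W)) :
    (v ≫ mscale W) ≫ multiProj ι W = (v ≫ dualProj _) ≫ multiProj ι W := by
  rw [mscale, comp_mlift_multiProj, Category.assoc]

lemma mcoord_comp_mscale (v : V ⟶ (dualFunctor S).obj ((multiFunctor S ι).obj W)) (i : ι) :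
    mcoord (v ≫ mscale W) i = mcoord (v ≫ dualProj _) i * coord v := by
  rw [mscale, mcoord_comp_mlift, map_mul, ← mcoord_comp, ← coord_comp, Category.comp_id]

lemma comp_mswap_multiProj (v : V ⟶ (dualFunctor S).obj ((multiFunctor S ι).obj W)) :
    (v ≫ mswap W) ≫ multiProj ι _ = v ≫ (dualFunctor S).map (multiProj ι W) :=
  comp_mlift_multiProj _ _ _ _

lemma mcoord_comp_mswap (v : V ⟶ (dualFunctor S).obj ((multiFunctor S ι).obj W)) (i : ι) :
    mcoord (v ≫ mswap W) i = mcoord (v ≫ dualProj _) i := by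
  rw [mswap, mcoord_comp_mlift, ← mcoord_comp]

lemma comp_mvert_multiProj (v : V ⟶ (multiFunctor S (Fin 2)).obj ((dualFunctor S).obj W)) :
    (v ≫ mvert W) ≫ multiProj _ _ = (v ≫ multiProj _ _) ≫ dualProj W := by
  rw [mvert, comp_mlift_multiProj, Category.assoc]

lemma mcoord_comp_mvert (v : V ⟶ (multiFunctor S (Fin 2)).obj ((dualFunctor S).obj W))
    (i : Fin 2) : mcoord (v ≫ mvert W) i =
      (if i = 0 then coord (v ≫ multiProj (Fin 2) _) else 1) * mcoord v i := by
  rw [mvert, mcoord_comp_mlift, map_mul, ← mcoord_comp, Category.comp_id]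
  split_ifs
  · rw [coord_comp]
  · rw [map_one]

lemma map_lin (k : W ⟶ W') (c : ι → ℤ) :
    (dualFunctor S).map k ≫ lin c W' = lin c W ≫ (multiFunctor S ι).map k := by
  refine hom_ext_of_comp fun V v => ?_
  simp only [← Category.assoc]
  refine multi_ext ?_ fun i => ?_
  · rw [comp_lin_multiProj, comp_map_dualProj, comp_map_multiProj, comp_lin_multiProj]
  · rw [mcoord_comp_lin, coord_comp_map, mcoord_comp_map, mcoord_comp_lin]

lemma map_vert (k : W ⟶ W') :
    (dualFunctor S).map ((dualFunctor S).map k) ≫ vert W' =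
      vert W ≫ (multiFunctor S (Fin 2)).map k := by
  refine hom_ext_of_comp fun V v => ?_
  simp only [← Category.assoc]
  refine multi_ext ?_ fun i => ?_
  · rw [comp_vert_multiProj, comp_map_dualProj, comp_map_dualProj, comp_map_multiProj,
      comp_vert_multiProj]
  · rw [mcoord_comp_vert, comp_map_dualProj, coord_comp_map, coord_comp_map, mcoord_comp_map,
      mcoord_comp_vert]

/-- Both sides send `ε_i` to `c_i ε₁ε₂`. One morphism `mscale` thus extends `ε ↦ ε₁ε₂` to all
directions at once, which makes `ℓ` additive. -/
lemma map_lin_mscale (c : ι → ℤ) (W : Over S) :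
    (dualFunctor S).map (lin c W) ≫ mscale W = dualDiag W ≫ lin c W := by
  refine hom_ext_of_comp fun V v => ?_
  simp only [← Category.assoc]
  refine multi_ext ?_ fun i => ?_
  · rw [comp_mscale_multiProj, comp_map_dualProj, comp_lin_multiProj, comp_lin_multiProj,
      comp_dualDiag_dualProj]
  · rw [mcoord_comp_mscale, comp_map_dualProj, coord_comp_map, mcoord_comp_lin, mcoord_comp_lin,
      coord_comp_dualDiag, smul_mul_assoc]

/-- The interchange of two infinitesimals likewise extends to all directions at once; this makes `c`
additive. -/
lemma map_lin_mswap (c : ι → ℤ) (W : Over S) :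
    (dualFunctor S).map (lin c W) ≫ mswap W = dualSwap W ≫ lin c _ := by
  refine hom_ext_of_comp fun V v => ?_
  simp only [← Category.assoc]
  refine multi_ext (dual_ext ?_ ?_) fun i => ?_
  · rw [comp_mswap_multiProj, comp_map_dualProj, comp_map_dualProj, comp_lin_multiProj,
      comp_lin_multiProj, comp_dualSwap_dualProj_dualProj]
  · rw [comp_mswap_multiProj, coord_comp_map, coord_comp_map, comp_lin_multiProj,
      coord_comp_dualSwap_dualProj]
  · rw [mcoord_comp_mswap, comp_map_dualProj, mcoord_comp_lin, mcoord_comp_lin,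
      coord_comp_dualSwap]

/-- The diagonal of `mvert` is `vert`; by the next two lemmas its axes are the substitutions behind
`ℓ ∘ π₁` and `0 ∘ π₂`. Hence `vert` describes the fibrewise sum of these two. -/
lemma lin_mvert (W : Over S) : lin (fun _ => 1) _ ≫ mvert W = vert W := by
  refine hom_ext_of_comp fun V v => ?_
  simp only [← Category.assoc]
  refine multi_ext ?_ fun i => ?_
  · rw [comp_mvert_multiProj, comp_lin_multiProj, comp_vert_multiProj]
  · rw [mcoord_comp_mvert, comp_lin_multiProj, mcoord_comp_lin, mcoord_comp_vert, one_smul]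

lemma lin_zero_mvert (W : Over S) :
    lin (Pi.single 0 1) _ ≫ mvert W = dualDiag W ≫ lin (Pi.single 0 1) W := by
  refine hom_ext_of_comp fun V v => ?_
  simp only [← Category.assoc]
  refine multi_ext ?_ fun i => ?_
  · rw [comp_mvert_multiProj, comp_lin_multiProj, comp_lin_multiProj, comp_dualDiag_dualProj]
  · rw [mcoord_comp_mvert, comp_lin_multiProj, mcoord_comp_lin, mcoord_comp_lin,
      coord_comp_dualDiag]
    fin_cases i <;> simp

lemma lin_one_mvert (W : Over S) :
    lin (Pi.single 1 1) _ ≫ mvert W =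
      (dualFunctor S).map (dualProj W) ≫ lin (Pi.single 1 1) W := by
  refine hom_ext_of_comp fun V v => ?_
  simp only [← Category.assoc]
  refine multi_ext ?_ fun i => ?_
  · rw [comp_mvert_multiProj, comp_lin_multiProj, comp_lin_multiProj, comp_map_dualProj]
  · rw [mcoord_comp_mvert, comp_lin_multiProj, mcoord_comp_lin, mcoord_comp_lin, coord_comp_map]
    fin_cases i <;> simp

lemma dualZ_lin (c c' : ι → ℤ) (W : Over S) : dualZ W ≫ lin c W = dualZ W ≫ lin c' W := by
  refine hom_ext_of_comp fun V v => ?_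
  simp only [← Category.assoc]
  refine multi_ext ?_ fun i => ?_
  · rw [comp_lin_multiProj, comp_lin_multiProj]
  · rw [mcoord_comp_lin, mcoord_comp_lin, coord_comp_dualZ, smul_zero, smul_zero]

lemma lin_zero (W : Over S) (c : ι → ℤ) :
    lin (fun _ => 0) W = dualProj W ≫ dualZ W ≫ lin c W := by
  refine hom_ext_of_comp fun V v => ?_
  simp only [← Category.assoc]
  refine multi_ext ?_ fun i => ?_
  · rw [comp_lin_multiProj, comp_lin_multiProj, comp_dualZ_dualProj]
  · rw [mcoord_comp_lin, mcoord_comp_lin, coord_comp_dualZ, smul_zero, zero_smul]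

/-- Both coordinates `ε₁ε₂` and `ε₂` vanish at `ε₂ = 0`, so nothing there depends on `ε₁`. -/
lemma dualZ_vert (W : Over S) :
    dualZ _ ≫ vert W = dualProj _ ≫ dualZ W ≫ dualZ _ ≫ vert W := by
  refine hom_ext_of_comp fun V v => ?_
  simp only [← Category.assoc]
  refine multi_ext ?_ fun i => ?_
  · simp only [comp_vert_multiProj, comp_dualZ_dualProj]
  · simp only [mcoord_comp_vert, coord_comp_dualZ, mul_zero]

end OverBase

/-! ### Morphisms into the tangent scheme -/

section Flat

variable {S : Scheme.{u}} {ι : Type} [Fintype ι] [DecidableEq ι] {V W Z Z' : Over S}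

/-- The morphism `W[ε] ⟶ Z` that corresponds to `W ⟶ T_{Z/S}`. -/
def flat (a : W ⟶ tangentObj Z) : (dualFunctor S).obj W ⟶ Z :=
  (dualFunctor S).map a ≫ tangentEval Z

lemma flat_injective {a b : W ⟶ tangentObj Z} (h : flat a = flat b) : a = b :=
  (tangentEval_bijective W Z).1 h

lemma flat_comp (k : V ⟶ W) (a : W ⟶ tangentObj Z) :
    flat (k ≫ a) = (dualFunctor S).map k ≫ flat a := by
  rw [flat, flat, Functor.map_comp, Category.assoc]

lemma flat_id (Z : Over S) : flat (𝟙 (tangentObj Z)) = tangentEval Z := by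
  rw [flat, CategoryTheory.Functor.map_id, Category.id_comp]

/-- The morphism `T(g)`. -/
def tangentMap (g : Z ⟶ Z') : tangentObj Z ⟶ tangentObj Z' := (tangentFunctor S).map g

lemma flat_map (a : W ⟶ tangentObj Z) (g : Z ⟶ Z') : flat (a ≫ tangentMap g) = flat a ≫ g := by
  have : (dualFunctor S).map (tangentMap g) ≫ tangentEval Z' = tangentEval Z ≫ g :=
    map_tangentFunctor_map g
  rw [flat, Functor.map_comp, Category.assoc, this, flat, Category.assoc]

lemma flat_tangentEquiv (g : (dualFunctor S).obj W ⟶ Z) : flat (tangentEquiv W Z g) = g :=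
  map_tangentEquiv g

/-- The base point of a tangent vector is its value at `ε = 0`. -/
lemma comp_tangentP (a : W ⟶ tangentObj Z) : a ≫ tangentP Z = dualZ W ≫ flat a := by
  have h : zeroSec W.left ≫ prod.map a.left (𝟙 _) ≫ tangentUniv Z.hom =
      a.left ≫ tangentProj Z.hom := by
    rw [reassoc_of% @zeroSec_map]
    exact congr(a.left ≫ $(zeroSec_tangentUniv Z.hom))
  exact Over.OverMorphism.ext h.symm

lemma flat_comp_tangentZero (k : W ⟶ Z) : flat (k ≫ tangentZero Z) = dualProj W ≫ k := by
  rw [flat_comp, tangentZero, flat_tangentEquiv]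
  have := comp_map_dualProj (𝟙 _) k
  rwa [Category.id_comp, Category.id_comp] at this

lemma map_dualDiag (k : V ⟶ W) :
    (dualFunctor S).map ((dualFunctor S).map k) ≫ dualDiag W =
      dualDiag V ≫ (dualFunctor S).map k := by
  refine hom_ext_of_comp fun V v => ?_
  simp only [← Category.assoc]
  refine dual_ext ?_ ?_
  · simp only [comp_dualDiag_dualProj, comp_map_dualProj]
  · simp only [coord_comp_dualDiag, comp_map_dualProj, coord_comp_map]

lemma map_dualSwap (k : V ⟶ W) :
    (dualFunctor S).map ((dualFunctor S).map k) ≫ dualSwap W =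
      dualSwap V ≫ (dualFunctor S).map ((dualFunctor S).map k) := by
  refine hom_ext_of_comp fun V v => ?_
  simp only [← Category.assoc]
  refine dual_ext (dual_ext ?_ ?_) ?_
  · simp only [comp_dualSwap_dualProj_dualProj, comp_map_dualProj]
  · simp only [coord_comp_dualSwap_dualProj, comp_map_dualProj, coord_comp_map]
  · simp only [coord_comp_dualSwap, comp_map_dualProj, coord_comp_map]

/-- Transposition is contravariant in the infinitesimals: following `a` by `ℓ` means substituting `ε
↦ ε₁ε₂` before `flat a`. The same holds for the flip below, so composites of structure maps appear
in reverse order. -/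
lemma flat_flat_comp_lift (a : W ⟶ tangentObj Z) :
    flat (flat (a ≫ tangentLift Z)) = dualDiag W ≫ flat a := by
  rw [flat_comp, flat_comp, tangentLift, flat_tangentEquiv, flat_tangentEquiv, ← Category.assoc,
    map_dualDiag, Category.assoc, flat]

lemma flat_flat_comp_flip (a : W ⟶ tangentObj (tangentObj Z)) :
    flat (flat (a ≫ tangentFlip Z)) = dualSwap W ≫ flat (flat a) := by
  rw [flat_comp, flat_comp, tangentFlip, flat_tangentEquiv, flat_tangentEquiv, ← Category.assoc,
    map_dualSwap, Category.assoc, flat, flat, Functor.map_comp, Category.assoc]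

/-- Morphisms on `W × D(ι)` over the base are determined by their restrictions to the axes. -/
lemma multi_ext_of_lin [Nonempty ι] {s s' : (multiFunctor S ι).obj W ⟶ Z}
    (h : ∀ i : ι, lin (Pi.single i 1) W ≫ s = lin (Pi.single i 1) W ≫ s') : s = s' :=
  Over.OverMorphism.ext (multi_hom_ext fun i => congr(($(h i)).left))

lemma exists_of_lin [Nonempty ι] (z : W ⟶ Z) (a : ι → ((dualFunctor S).obj W ⟶ Z))
    (h : ∀ i, dualZ W ≫ a i = z) :
    ∃ s : (multiFunctor S ι).obj W ⟶ Z, ∀ i, lin (Pi.single i 1) W ≫ s = a i := by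
  obtain ⟨s, hs⟩ := exists_multi z.left (fun i => (a i).left) fun i => congr(($(h i)).left)
  -- The combined morphism lies over the base because it does so along every axis.
  refine ⟨Over.homMk s (multi_hom_ext fun i => ?_), fun i => Over.OverMorphism.ext (hs i)⟩
  refine (Category.assoc _ _ _).symm.trans ((congr($(hs i) ≫ _)).trans ((Over.w (a i)).trans ?_))
  exact (Over.w (lin (Pi.single i 1) W)).symm

lemma vert_hom_ext {s s' : (multiFunctor S (Fin 2)).obj W ⟶ Z} (h : vert W ≫ s = vert W ≫ s') :
    s = s' :=
  Over.OverMorphism.ext (vertSec_hom_ext congr(($h).left))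

lemma exists_vert_comp (g : (dualFunctor S).obj ((dualFunctor S).obj W) ⟶ Z)
    (h : dualZ _ ≫ g = dualProj W ≫ dualZ W ≫ dualZ _ ≫ g) :
    ∃ s : (multiFunctor S (Fin 2)).obj W ⟶ Z, vert W ≫ s = g := by
  obtain ⟨s, hs⟩ := exists_vertSec_comp g.left
    (congr(($h).left).trans (congrArg (prod.fst ≫ ·) (Category.assoc _ _ _).symm))
  refine ⟨Over.homMk s (vertSec_hom_ext ?_), Over.OverMorphism.ext hs⟩
  refine (Category.assoc _ _ _).symm.trans ((congr($hs ≫ _)).trans ((Over.w g).trans ?_))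
  exact (Over.w (vert W)).symm

/-! ### The sum -/

lemma comp_tangentAdd (v : W ⟶ pullback (tangentP Z) (tangentP Z))
    (s : (multiFunctor S (Fin 2)).obj W ⟶ Z)
    (h₀ : lin (Pi.single 0 1) W ≫ s = flat (v ≫ pullback.fst _ _))
    (h₁ : lin (Pi.single 1 1) W ≫ s = flat (v ≫ pullback.snd _ _)) :
    flat (v ≫ tangentAdd Z) = lin (fun _ => 1) W ≫ s := by
  let P := pullback (tangentP Z) (tangentP Z)
  -- The universal pair of tangent vectors is treated first; uniqueness along the axes then shows
  -- that `s` is the pullback of `t` along `v`.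
  obtain ⟨t, ht⟩ := exists_of_lin (ι := Fin 2) (pullback.fst (tangentP Z) (tangentP Z) ≫ tangentP Z)
    ![flat (pullback.fst _ _), flat (pullback.snd _ _)] (fun i => by
      fin_cases i
      · exact (comp_tangentP _).symm
      · exact (comp_tangentP _).symm.trans pullback.condition.symm)
  have hadd : flat (tangentAdd Z) = lin (fun _ => 1) P ≫ t :=
    Over.OverMorphism.ext (map_addHom_tangentUniv (pullback.fst (tangentP Z) (tangentP Z)).left
      (pullback.snd (tangentP Z) (tangentP Z)).left
      congr(($(pullback.condition (f := tangentP Z) (g := tangentP Z))).left) t.left congr(($(ht 0)).left)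
      congr(($(ht 1)).left))
  have hs : s = (multiFunctor S (Fin 2)).map v ≫ t := by
    refine multi_ext_of_lin fun i => ?_
    rw [← Category.assoc, ← map_lin, Category.assoc]
    fin_cases i
    · exact h₀.trans ((flat_comp _ _).trans congr(_ ≫ $(ht 0)).symm)
    · exact h₁.trans ((flat_comp _ _).trans congr(_ ≫ $(ht 1)).symm)
  rw [flat_comp, hadd, hs, ← Category.assoc, map_lin, Category.assoc]

/-- The sum of two tangent vectors. -/
def tangentSum (a b : W ⟶ tangentObj Z) (h : a ≫ tangentP Z = b ≫ tangentP Z) : W ⟶ tangentObj Z :=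
  pullback.lift a b h ≫ tangentAdd Z

/-- If `a` and `b` are restrictions of the same morphism `W × D(ι) ⟶ Z`, then so is `a + b`. -/
lemma flat_sum {a b : W ⟶ tangentObj Z} {h : a ≫ tangentP Z = b ≫ tangentP Z}
    (s : (multiFunctor S ι).obj W ⟶ Z) (c d : ι → ℤ) (ha : flat a = lin c W ≫ s)
    (hb : flat b = lin d W ≫ s) : flat (tangentSum a b h) = lin (c + d) W ≫ s := by
  -- Precompose `s` with `D(2) ⟶ D(ι)`, `ε_i ↦ c_i ε_0 + d_i ε_1`: its axes are the directions `c`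
  -- and `d`, its diagonal is `c + d`.
  refine (comp_tangentAdd (pullback.lift a b h) (mmat (fun i => ![c i, d i]) W ≫ s) ?_ ?_).trans ?_
  · rw [← Category.assoc, lin_mmat]
    refine Eq.trans ?_ (ha.symm.trans (congrArg flat (pullback.lift_fst a b h).symm))
    congr 2
    ext i
    simp [Fin.sum_univ_two]
  · rw [← Category.assoc, lin_mmat]
    refine Eq.trans ?_ (hb.symm.trans (congrArg flat (pullback.lift_snd a b h).symm))
    congr 2
    ext i
    simp [Fin.sum_univ_two]
  · rw [← Category.assoc, lin_mmat]
    congr 2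
    ext i
    simp [Fin.sum_univ_two]

/-- Vectors with a common base point become the axis directions of a single morphism, so equations
between their sums can be checked on integer vectors by `flat_sum`. -/
lemma exists_of_flat [Nonempty ι] (a : ι → (W ⟶ tangentObj Z)) (z : W ⟶ Z)
    (h : ∀ i, a i ≫ tangentP Z = z) :
    ∃ s : (multiFunctor S ι).obj W ⟶ Z, ∀ i, flat (a i) = lin (Pi.single i 1) W ≫ s := by
  obtain ⟨s, hs⟩ := exists_of_lin z (fun i => flat (a i)) fun i => (comp_tangentP _).symm.trans (h i)
  exact ⟨s, fun i => (hs i).symm⟩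

lemma exists_of_flat₂ (a b : W ⟶ tangentObj Z) (h : a ≫ tangentP Z = b ≫ tangentP Z) :
    ∃ s : (multiFunctor S (Fin 2)).obj W ⟶ Z, flat a = lin (Pi.single 0 1) W ≫ s ∧
      flat b = lin (Pi.single 1 1) W ≫ s := by
  obtain ⟨s, hs⟩ := exists_of_flat ![a, b] (a ≫ tangentP Z) (fun i => by
    fin_cases i
    · rfl
    · exact h.symm)
  exact ⟨s, hs 0, hs 1⟩

lemma single_add_single : (Pi.single 0 1 + Pi.single 1 1 : Fin 2 → ℤ) = fun _ => 1 := by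
  ext i
  fin_cases i <;> simp

lemma tangentAdd_eq_sum : tangentAdd Z = tangentSum (pullback.fst (tangentP Z) (tangentP Z))
    (pullback.snd (tangentP Z) (tangentP Z)) pullback.condition := by
  refine Eq.trans ?_ (congrArg (· ≫ tangentAdd Z)
    (show 𝟙 _ = pullback.lift (pullback.fst _ _) (pullback.snd _ _) pullback.condition from ?_))
  · exact (Category.id_comp _).symm
  · apply pullback.hom_ext <;> simp

/-- The morphism `T_{Z/S} ×_Z T_{Z/S} × D(2) ⟶ Z` that represents the pairs of tangent vectors. -/
lemma exists_universal_pair (Z : Over S) :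
    ∃ s : (multiFunctor S (Fin 2)).obj (pullback (tangentP Z) (tangentP Z)) ⟶ Z,
      flat (pullback.fst (tangentP Z) (tangentP Z)) = lin (Pi.single 0 1) _ ≫ s ∧
      flat (pullback.snd (tangentP Z) (tangentP Z)) = lin (Pi.single 1 1) _ ≫ s ∧
      flat (tangentAdd Z) = lin (fun _ => 1) _ ≫ s := by
  obtain ⟨s, h₀, h₁⟩ := exists_of_flat₂ (pullback.fst (tangentP Z) (tangentP Z))
    (pullback.snd (tangentP Z) (tangentP Z)) pullback.condition
  refine ⟨s, h₀, h₁, ?_⟩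
  rw [tangentAdd_eq_sum, flat_sum s _ _ h₀ h₁, single_add_single]

end Flat

/-! ### The axioms of a tangent structure -/

section Axioms

variable {S : Scheme.{u}} {W Z Z' : Over S}

lemma tangentP_eq (Z : Over S) : tangentP Z = dualZ _ ≫ tangentEval Z := by
  rw [← flat_id, ← comp_tangentP, Category.id_comp]

lemma flat_tangentMap (g : Z ⟶ Z') : flat (tangentMap g) = tangentEval Z ≫ g := by
  rw [← Category.id_comp (tangentMap g), flat_map, flat_id]

lemma tangentMap_tangentP (g : Z ⟶ Z') : tangentMap g ≫ tangentP Z' = tangentP Z ≫ g := by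
  rw [comp_tangentP, flat_tangentMap, tangentP_eq, Category.assoc]

lemma flat_tangentZero (Z : Over S) : flat (tangentZero Z) = dualProj Z := flat_tangentEquiv _

lemma flat_flat_tangentLift (Z : Over S) :
    flat (flat (tangentLift Z)) = dualDiag _ ≫ tangentEval Z := by
  rw [tangentLift, flat_tangentEquiv, flat_tangentEquiv]

lemma flat_flat_tangentFlip (Z : Over S) :
    flat (flat (tangentFlip Z)) = dualSwap _ ≫ flat (tangentEval (tangentObj Z)) := by
  rw [← Category.id_comp (tangentFlip Z), flat_flat_comp_flip, flat_id]

lemma tangentZero_naturality (g : Z ⟶ Z') :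
    tangentZero Z ≫ tangentMap g = g ≫ tangentZero Z' := by
  apply flat_injective
  rw [flat_map, flat_comp_tangentZero, flat_tangentZero]

lemma tangentLift_naturality (g : Z ⟶ Z') :
    tangentLift Z ≫ tangentMap (tangentMap g) = tangentMap g ≫ tangentLift Z' := by
  apply flat_injective
  apply flat_injective
  rw [flat_map, flat_map, flat_flat_comp_lift, flat_flat_tangentLift, flat_tangentMap,
    Category.assoc]

lemma tangentFlip_naturality (g : Z ⟶ Z') :
    tangentFlip Z ≫ tangentMap (tangentMap g) = tangentMap (tangentMap g) ≫ tangentFlip Z' := by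
  apply flat_injective
  apply flat_injective
  rw [flat_map, flat_map, flat_flat_comp_flip, flat_flat_tangentFlip, flat_tangentMap, flat_map,
    Category.assoc]

lemma dualZ_dualProj (W : Over S) : dualZ W ≫ dualProj W = 𝟙 W := by
  simpa using comp_dualZ_dualProj (𝟙 W)

lemma tangentZero_tangentP (Z : Over S) : tangentZero Z ≫ tangentP Z = 𝟙 Z := by
  rw [comp_tangentP, flat_tangentZero, dualZ_dualProj]

lemma tangentAdd_tangentP (Z : Over S) :
    tangentAdd Z ≫ tangentP Z = pullback.fst _ _ ≫ tangentP Z := by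
  obtain ⟨s, h₀, h₁, h⟩ := exists_universal_pair Z
  rw [comp_tangentP, comp_tangentP, h, h₀, ← Category.assoc, ← Category.assoc, dualZ_lin]

lemma tangentSum_zero (a : W ⟶ tangentObj Z)
    (h : a ≫ tangentP Z = ((a ≫ tangentP Z) ≫ tangentZero Z) ≫ tangentP Z) :
    tangentSum a ((a ≫ tangentP Z) ≫ tangentZero Z) h = a := by
  -- One variable suffices: `a` has direction `1`, and the zero vector at the same point has
  -- direction `0`.
  obtain ⟨s, hs⟩ := exists_of_flat (fun _ : Fin 1 => a) (a ≫ tangentP Z) fun _ => rfl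
  have hz : flat ((a ≫ tangentP Z) ≫ tangentZero Z) = lin (fun _ => 0) W ≫ s := by
    rw [flat_comp_tangentZero, comp_tangentP, hs 0, lin_zero W (Pi.single 0 1)]
    simp only [Category.assoc]
  apply flat_injective
  rw [flat_sum s _ _ (hs 0) hz, hs 0]
  congr 2
  exact add_zero _

lemma tangentSum_comm (a b : W ⟶ tangentObj Z) (h : a ≫ tangentP Z = b ≫ tangentP Z) :
    tangentSum a b h = tangentSum b a h.symm := by
  obtain ⟨s, ha, hb⟩ := exists_of_flat₂ a b h
  apply flat_injective
  rw [flat_sum s _ _ ha hb, flat_sum s _ _ hb ha, add_comm]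

lemma tangentSum_assoc (a b c : W ⟶ tangentObj Z) (h : a ≫ tangentP Z = b ≫ tangentP Z)
    (h' : b ≫ tangentP Z = c ≫ tangentP Z)
    (h₁ : tangentSum a b h ≫ tangentP Z = c ≫ tangentP Z)
    (h₂ : a ≫ tangentP Z = tangentSum b c h' ≫ tangentP Z) :
    tangentSum (tangentSum a b h) c h₁ = tangentSum a (tangentSum b c h') h₂ := by
  -- All three vectors are directions of one morphism on `D(3)`, so associativity is that of integer
  -- vectors.
  obtain ⟨s, hs⟩ := exists_of_flat ![a, b, c] (a ≫ tangentP Z) (fun i => by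
    fin_cases i
    · rfl
    · exact h.symm
    · exact (h.trans h').symm)
  have ha : flat a = _ := hs 0
  have hb : flat b = _ := hs 1
  have hc : flat c = _ := hs 2
  apply flat_injective
  rw [flat_sum s _ _ (flat_sum s _ _ ha hb) hc, flat_sum s _ _ ha (flat_sum s _ _ hb hc),
    add_assoc]

lemma tangentAdd_naturality (g : Z ⟶ Z')
    (h : (pullback.fst (tangentP Z) (tangentP Z) ≫ tangentMap g) ≫ tangentP Z' =
      (pullback.snd (tangentP Z) (tangentP Z) ≫ tangentMap g) ≫ tangentP Z') :
    tangentAdd Z ≫ tangentMap g = tangentSum (pullback.fst _ _ ≫ tangentMap g)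
      (pullback.snd _ _ ≫ tangentMap g) h := by
  obtain ⟨s, h₀, h₁, hadd⟩ := exists_universal_pair Z
  apply flat_injective
  rw [flat_sum (s ≫ g) (Pi.single 0 1) (Pi.single 1 1), single_add_single, flat_map, hadd,
    Category.assoc]
  · rw [flat_map, h₀, Category.assoc]
  · rw [flat_map, h₁, Category.assoc]

lemma tangentLift_map_tangentP (Z : Over S) :
    tangentLift Z ≫ tangentMap (tangentP Z) = tangentP Z ≫ tangentZero Z := by
  apply flat_injective
  rw [flat_map, flat_comp_tangentZero, comp_tangentP, flat_flat_tangentLift, tangentP_eq,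
    ← Category.assoc, ← Category.assoc]
  congr 1
  refine hom_ext_of_comp fun V v => ?_
  simp only [← Category.assoc]
  refine dual_ext ?_ ?_
  · simp only [comp_dualDiag_dualProj, comp_dualZ_dualProj]
  · simp only [coord_comp_dualDiag, coord_comp_dualZ, mul_zero]

/-- `ε₁ε₂` vanishes at `ε₁ = 0` just as at `ε₂ = 0`. This supplies the common base point needed to
state the additivity of `ℓ`. -/
lemma tangentLift_tangentP (Z : Over S) :
    tangentLift Z ≫ tangentP (tangentObj Z) = tangentP Z ≫ tangentZero Z := by
  apply flat_injective
  rw [comp_tangentP, flat_comp, flat_comp_tangentZero, flat_flat_tangentLift, tangentP_eq,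
    ← Category.assoc, ← Category.assoc]
  congr 1
  refine hom_ext_of_comp fun V v => ?_
  simp only [← Category.assoc]
  refine dual_ext ?_ ?_
  · simp only [comp_dualDiag_dualProj, comp_dualZ_dualProj, comp_map_dualProj]
  · simp only [coord_comp_dualDiag, coord_comp_dualZ, comp_map_dualProj, zero_mul]

lemma tangentLift_add (Z : Over S)
    (h : (pullback.fst (tangentP Z) (tangentP Z) ≫ tangentLift Z) ≫ tangentP (tangentObj Z) =
      (pullback.snd (tangentP Z) (tangentP Z) ≫ tangentLift Z) ≫ tangentP (tangentObj Z)) :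
    tangentSum (pullback.fst (tangentP Z) (tangentP Z) ≫ tangentLift Z)
      (pullback.snd (tangentP Z) (tangentP Z) ≫ tangentLift Z) h = tangentAdd Z ≫ tangentLift Z := by
  obtain ⟨s, h₀, h₁, hadd⟩ := exists_universal_pair Z
  -- If `a` is the direction `c` of `s`, then `a ≫ ℓ` is the direction `c` of one fixed morphism.
  -- Applying this to both projections and to their sum gives additivity.
  have key (c : Fin 2 → ℤ) (a : pullback (tangentP Z) (tangentP Z) ⟶ tangentObj Z)
      (ha : flat a = lin c _ ≫ s) : flat (a ≫ tangentLift Z) =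
      lin c _ ≫ tangentEquiv _ _ (mscale _ ≫ s) := by
    apply flat_injective
    rw [flat_flat_comp_lift, flat_comp, flat_tangentEquiv, ha, ← Category.assoc, ← map_lin_mscale,
      Category.assoc]
  apply flat_injective
  rw [flat_sum _ _ _ (key _ _ h₀) (key _ _ h₁), single_add_single, key _ _ hadd]

lemma tangentZero_tangentZero (Z : Over S) :
    tangentZero Z ≫ tangentZero (tangentObj Z) = tangentZero Z ≫ tangentLift Z := by
  apply flat_injective
  apply flat_injective
  rw [flat_flat_comp_lift, flat_comp_tangentZero, flat_comp_tangentZero, flat_tangentZero]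
  refine hom_ext_of_comp fun V v => ?_
  simp only [← Category.assoc, comp_dualDiag_dualProj]

lemma tangentFlip_tangentP (Z : Over S) :
    tangentFlip Z ≫ tangentP (tangentObj Z) = tangentMap (tangentP Z) := by
  apply flat_injective
  rw [comp_tangentP, flat_comp, flat_flat_tangentFlip, flat_tangentMap, comp_tangentP,
    ← Category.assoc]
  congr 1
  refine hom_ext_of_comp fun V v => ?_
  simp only [← Category.assoc]
  refine dual_ext (dual_ext ?_ ?_) ?_
  · simp only [comp_dualSwap_dualProj_dualProj, comp_dualZ_dualProj, comp_map_dualProj]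
  · simp only [coord_comp_dualSwap_dualProj, coord_comp_map, comp_dualZ_dualProj]
  · simp only [coord_comp_dualSwap, coord_comp_dualZ, comp_map_dualProj]

lemma tangentFlip_add (Z : Over S)
    (h : (tangentMap (pullback.fst (tangentP Z) (tangentP Z)) ≫ tangentFlip Z) ≫
        tangentP (tangentObj Z) =
      (tangentMap (pullback.snd (tangentP Z) (tangentP Z)) ≫ tangentFlip Z) ≫
        tangentP (tangentObj Z)) :
    tangentSum (tangentMap (pullback.fst (tangentP Z) (tangentP Z)) ≫ tangentFlip Z)
      (tangentMap (pullback.snd (tangentP Z) (tangentP Z)) ≫ tangentFlip Z) h =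
      tangentMap (tangentAdd Z) ≫ tangentFlip Z := by
  obtain ⟨s, h₀, h₁, hadd⟩ := exists_universal_pair Z
  -- As for `ℓ`: `T(a) ≫ c_Z` is again the direction `c` of one fixed morphism, now obtained by
  -- moving `D` past `D(2)`.
  have key (c : Fin 2 → ℤ) (a : pullback (tangentP Z) (tangentP Z) ⟶ tangentObj Z)
      (ha : flat a = lin c _ ≫ s) : flat (tangentMap a ≫ tangentFlip Z) =
      lin c _ ≫ tangentEquiv _ _ (mswap _ ≫ (multiFunctor S (Fin 2)).map (tangentEval _) ≫ s) := by
    apply flat_injective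
    rw [flat_flat_comp_flip, flat_tangentMap, flat_comp, ha, flat_comp, flat_tangentEquiv,
      ← Category.assoc _ (lin c _), map_lin, ← Category.assoc _ (mswap _), map_lin_mswap]
    simp only [Category.assoc]
  apply flat_injective
  rw [flat_sum _ _ _ (key _ _ h₀) (key _ _ h₁), single_add_single, key _ _ hadd]

lemma tangentMap_zero_flip (Z : Over S) :
    tangentMap (tangentZero Z) ≫ tangentFlip Z = tangentZero (tangentObj Z) := by
  apply flat_injective
  apply flat_injective
  have h : flat (dualProj (tangentObj Z)) = (dualFunctor S).map (dualProj _) ≫ tangentEval Z := rfl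
  rw [flat_flat_comp_flip, flat_tangentMap, flat_comp_tangentZero, flat_tangentZero, h,
    ← Category.assoc]
  congr 1
  refine hom_ext_of_comp fun V v => ?_
  simp only [← Category.assoc]
  refine dual_ext ?_ ?_
  · simp only [comp_dualSwap_dualProj_dualProj, comp_map_dualProj]
  · simp only [coord_comp_dualSwap_dualProj, coord_comp_map]

lemma tangentFlip_flip (Z : Over S) : tangentFlip Z ≫ tangentFlip Z = 𝟙 _ := by
  apply flat_injective
  apply flat_injective
  rw [flat_flat_comp_flip, flat_flat_tangentFlip, flat_id, ← Category.assoc]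
  refine (congrArg (· ≫ _) ?_).trans (Category.id_comp _)
  refine hom_ext_of_comp fun V v => ?_
  simp only [← Category.assoc, Category.comp_id]
  refine dual_ext (dual_ext ?_ ?_) ?_
  · simp only [comp_dualSwap_dualProj_dualProj]
  · simp only [coord_comp_dualSwap_dualProj, coord_comp_dualSwap]
  · simp only [coord_comp_dualSwap, coord_comp_dualSwap_dualProj]

lemma tangentLift_flip (Z : Over S) : tangentLift Z ≫ tangentFlip Z = tangentLift Z := by
  apply flat_injective
  apply flat_injective
  rw [flat_flat_comp_flip, flat_flat_tangentLift, ← Category.assoc]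
  congr 1
  refine hom_ext_of_comp fun V v => ?_
  simp only [← Category.assoc]
  refine dual_ext ?_ ?_
  · simp only [comp_dualDiag_dualProj, comp_dualSwap_dualProj_dualProj]
  · simp only [coord_comp_dualDiag, coord_comp_dualSwap_dualProj, coord_comp_dualSwap]
    exact mul_comm _ _

lemma tangentLift_lift (Z : Over S) :
    tangentLift Z ≫ tangentMap (tangentLift Z) = tangentLift Z ≫ tangentLift (tangentObj Z) := by
  apply flat_injective
  apply flat_injective
  apply flat_injective
  rw [flat_map, flat_flat_comp_lift, flat_flat_comp_lift, flat_comp, flat_flat_tangentLift,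
    ← Category.assoc, ← Category.assoc]
  congr 1
  refine hom_ext_of_comp fun V v => ?_
  simp only [← Category.assoc]
  refine dual_ext ?_ ?_
  · simp only [comp_dualDiag_dualProj, comp_map_dualProj]
  · simp only [coord_comp_dualDiag, comp_dualDiag_dualProj, comp_map_dualProj, coord_comp_map,
      mul_assoc]

lemma flat_flat_flat_comp_map_flip (a : W ⟶ tangentObj (tangentObj (tangentObj Z))) :
    flat (flat (flat (a ≫ tangentMap (tangentFlip Z)))) =
      dualSwap _ ≫ flat (flat (flat a)) := by
  rw [flat_map, flat_flat_comp_flip]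

lemma flat_flat_flat_comp_flip (a : W ⟶ tangentObj (tangentObj (tangentObj Z))) :
    flat (flat (flat (a ≫ tangentFlip (tangentObj Z)))) =
      (dualFunctor S).map (dualSwap _) ≫ flat (flat (flat a)) := by
  rw [flat_flat_comp_flip, flat_comp]

/-- On transposes `T(c)` and `c_T` are the two adjacent transpositions of `ε₁, ε₂, ε₃`, and the
claim is the braid relation. -/
lemma tangentFlip_hexagon (Z : Over S) :
    tangentMap (tangentFlip Z) ≫ tangentFlip (tangentObj Z) ≫ tangentMap (tangentFlip Z) =
      tangentFlip (tangentObj Z) ≫ tangentMap (tangentFlip Z) ≫ tangentFlip (tangentObj Z) := by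
  suffices h : ∀ a : tangentObj (tangentObj (tangentObj Z)) ⟶ _,
      ((a ≫ tangentMap (tangentFlip Z)) ≫ tangentFlip (tangentObj Z)) ≫
        tangentMap (tangentFlip Z) =
      ((a ≫ tangentFlip (tangentObj Z)) ≫ tangentMap (tangentFlip Z)) ≫
        tangentFlip (tangentObj Z) by
    simpa only [Category.id_comp, Category.assoc] using h (𝟙 _)
  intro a
  apply flat_injective
  apply flat_injective
  apply flat_injective
  simp only [flat_flat_flat_comp_map_flip, flat_flat_flat_comp_flip]
  simp only [← Category.assoc]
  congr 1
  refine hom_ext_of_comp fun V v => ?_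
  simp only [← Category.assoc]
  refine dual_ext (dual_ext (dual_ext ?_ ?_) ?_) ?_
  · simp only [comp_map_dualProj, comp_dualSwap_dualProj_dualProj]
  · simp only [comp_map_dualProj, comp_dualSwap_dualProj_dualProj, coord_comp_map,
      coord_comp_dualSwap_dualProj]
  · simp only [comp_map_dualProj, comp_dualSwap_dualProj_dualProj, coord_comp_map,
      coord_comp_dualSwap_dualProj, coord_comp_dualSwap]
  · simp only [comp_map_dualProj, comp_dualSwap_dualProj_dualProj, coord_comp_map,
      coord_comp_dualSwap]

/-- On transposes both sides are the substitution of `(ε₂ε₃, ε₁)` for the pair of infinitesimals of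
`T²`. -/
lemma tangentLift_flip_pentagon (Z : Over S) :
    tangentLift (tangentObj Z) ≫ tangentMap (tangentFlip Z) ≫ tangentFlip (tangentObj Z) =
      tangentFlip Z ≫ tangentMap (tangentLift Z) := by
  apply flat_injective
  apply flat_injective
  apply flat_injective
  rw [← Category.assoc, flat_flat_flat_comp_flip, flat_flat_flat_comp_map_flip, flat_map,
    flat_flat_comp_lift, ← Category.id_comp (tangentLift (tangentObj Z)), flat_flat_comp_lift,
    flat_comp, ← Category.id_comp (tangentFlip Z), flat_flat_comp_flip]
  simp only [← Category.assoc]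
  congr 1
  refine hom_ext_of_comp fun V v => ?_
  simp only [← Category.assoc]
  refine dual_ext (dual_ext ?_ ?_) ?_
  · simp only [comp_dualDiag_dualProj, comp_map_dualProj, comp_dualSwap_dualProj_dualProj]
  · simp only [comp_map_dualProj, coord_comp_map, coord_comp_dualSwap_dualProj,
      coord_comp_dualDiag, comp_dualSwap_dualProj_dualProj]
  · simp only [comp_dualDiag_dualProj, comp_map_dualProj, coord_comp_map, coord_comp_dualSwap]

/-! ### Universality of the vertical lift -/

/-- The morphism `⟨ℓ ∘ π₁, 0 ∘ π₂⟩` exists. -/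
lemma exists_lift_zero (Z : Over S) : ∃ v : pullback (tangentP Z) (tangentP Z) ⟶
      tangentObj (pullback (tangentP Z) (tangentP Z)),
    v ≫ tangentMap (pullback.fst _ _) = pullback.fst _ _ ≫ tangentLift Z ∧
    v ≫ tangentMap (pullback.snd _ _) = pullback.snd _ _ ≫ tangentZero (tangentObj Z) := by
  let P := pullback (tangentP Z) (tangentP Z)
  have h : flat (pullback.fst (tangentP Z) (tangentP Z) ≫ tangentLift Z) ≫ tangentP Z =
      flat (pullback.snd (tangentP Z) (tangentP Z) ≫ tangentZero (tangentObj Z)) ≫ tangentP Z := by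
    rw [← flat_map, Category.assoc, tangentLift_map_tangentP, flat_comp_tangentZero,
      pullback.condition_assoc, ← Category.assoc, flat_comp_tangentZero, Category.assoc]
  -- A morphism into `T(TZ ×_Z TZ)` is by adjunction one into `TZ ×_Z TZ`, so it can be given by
  -- components.
  refine ⟨tangentEquiv _ _ (pullback.lift _ _ h), ?_, ?_⟩
  · apply flat_injective
    rw [flat_map, flat_tangentEquiv, pullback.lift_fst]
  · apply flat_injective
    rw [flat_map, flat_tangentEquiv, pullback.lift_snd]

lemma eq_tangentSum_comp {P : Over S} (u : P ⟶ pullback (tangentP Z) (tangentP Z))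
    (h : (u ≫ pullback.fst _ _) ≫ tangentP Z = (u ≫ pullback.snd _ _) ≫ tangentP Z) :
    u ≫ tangentAdd Z = tangentSum (u ≫ pullback.fst _ _) (u ≫ pullback.snd _ _) h := by
  rw [tangentSum]
  congr 1
  apply pullback.hom_ext
  · rw [pullback.lift_fst]
  · rw [pullback.lift_snd]

/-- After one transposition `T(+)` is an ordinary sum, of two vectors that are the axes of `mvert ≫
s`. The sum is the diagonal, and the diagonal of `mvert` is `vert`. -/
lemma flat_flat_vertical (v : pullback (tangentP Z) (tangentP Z) ⟶
      tangentObj (pullback (tangentP Z) (tangentP Z)))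
    (hv₁ : v ≫ tangentMap (pullback.fst _ _) = pullback.fst _ _ ≫ tangentLift Z)
    (hv₂ : v ≫ tangentMap (pullback.snd _ _) = pullback.snd _ _ ≫ tangentZero (tangentObj Z))
    (s : (multiFunctor S (Fin 2)).obj (pullback (tangentP Z) (tangentP Z)) ⟶ Z)
    (h₀ : flat (pullback.fst (tangentP Z) (tangentP Z)) = lin (Pi.single 0 1) _ ≫ s)
    (h₁ : flat (pullback.snd (tangentP Z) (tangentP Z)) = lin (Pi.single 1 1) _ ≫ s) :
    flat (flat (v ≫ tangentMap (tangentAdd Z))) = vert _ ≫ s := by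
  rw [flat_map, eq_tangentSum_comp _ (by simp [pullback.condition]),
    flat_sum (mvert _ ≫ s) (Pi.single 0 1) (Pi.single 1 1), single_add_single, ← Category.assoc,
    lin_mvert]
  · rw [← flat_map, hv₁, flat_flat_comp_lift, h₀, ← Category.assoc, ← Category.assoc,
      lin_zero_mvert]
  · rw [← flat_map, hv₂, flat_comp_tangentZero, flat_comp, h₁, ← Category.assoc, ← Category.assoc,
      lin_one_mvert]

lemma flat_comp_map_tangentP (a : W ⟶ tangentObj (tangentObj Z)) :
    flat (a ≫ tangentMap (tangentP Z)) = dualZ _ ≫ flat (flat a) := by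
  rw [flat_map, comp_tangentP]

/-- Together with `flat_comp_map_tangentP` this translates the parallel pair: one arrow restricts to
`ε₂ = 0`, the other evaluates at `ε₁ = ε₂ = 0` and extends this constantly. -/
lemma flat_comp_zero_tangentP (a : W ⟶ tangentObj (tangentObj Z)) :
    flat (a ≫ tangentP (tangentObj Z) ≫ tangentP Z ≫ tangentZero Z) =
      dualProj W ≫ dualZ W ≫ dualZ _ ≫ flat (flat a) := by
  have h : dualZ W ≫ (dualFunctor S).map (dualZ W) = dualZ W ≫ dualZ _ := by
    refine hom_ext_of_comp fun V v => ?_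
    simp only [← Category.assoc]
    refine dual_ext ?_ ?_
    · simp only [comp_map_dualProj, comp_dualZ_dualProj]
    · simp only [coord_comp_map, coord_comp_dualZ]
  rw [← Category.assoc, ← Category.assoc, flat_comp_tangentZero, comp_tangentP, comp_tangentP,
    flat_comp, reassoc_of% h]

lemma vertical_condition (v : pullback (tangentP Z) (tangentP Z) ⟶
      tangentObj (pullback (tangentP Z) (tangentP Z)))
    (hv₁ : v ≫ tangentMap (pullback.fst _ _) = pullback.fst _ _ ≫ tangentLift Z)
    (hv₂ : v ≫ tangentMap (pullback.snd _ _) = pullback.snd _ _ ≫ tangentZero (tangentObj Z)) :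
    (v ≫ tangentMap (tangentAdd Z)) ≫ tangentMap (tangentP Z) =
      (v ≫ tangentMap (tangentAdd Z)) ≫ tangentP (tangentObj Z) ≫ tangentP Z ≫ tangentZero Z := by
  obtain ⟨s, h₀, h₁, hadd⟩ := exists_universal_pair Z
  apply flat_injective
  rw [flat_comp_map_tangentP, flat_comp_zero_tangentP, flat_flat_vertical v hv₁ hv₂ s h₀ h₁]
  simpa only [Category.assoc] using congrArg (· ≫ s) (dualZ_vert _)

lemma existsUnique_vertical (v : pullback (tangentP Z) (tangentP Z) ⟶
      tangentObj (pullback (tangentP Z) (tangentP Z)))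
    (hv₁ : v ≫ tangentMap (pullback.fst _ _) = pullback.fst _ _ ≫ tangentLift Z)
    (hv₂ : v ≫ tangentMap (pullback.snd _ _) = pullback.snd _ _ ≫ tangentZero (tangentObj Z))
    (k : W ⟶ tangentObj (tangentObj Z)) (hk : k ≫ tangentMap (tangentP Z) =
      k ≫ tangentP (tangentObj Z) ≫ tangentP Z ≫ tangentZero Z) :
    ∃! l : W ⟶ pullback (tangentP Z) (tangentP Z), l ≫ v ≫ tangentMap (tangentAdd Z) = k := by
  obtain ⟨s, h₀, h₁, hadd⟩ := exists_universal_pair Z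
  have hm (l : W ⟶ pullback (tangentP Z) (tangentP Z)) :
      flat (flat (l ≫ v ≫ tangentMap (tangentAdd Z))) =
        vert _ ≫ (multiFunctor S (Fin 2)).map l ≫ s := by
    rw [flat_comp, flat_comp, flat_flat_vertical v hv₁ hv₂ s h₀ h₁, ← Category.assoc, map_vert,
      Category.assoc]
  have hl₀ (l : W ⟶ pullback (tangentP Z) (tangentP Z)) : flat (l ≫ pullback.fst _ _) =
      lin (Pi.single 0 1) _ ≫ (multiFunctor S (Fin 2)).map l ≫ s := by
    rw [flat_comp, h₀, ← Category.assoc, map_lin, Category.assoc]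
  have hl₁ (l : W ⟶ pullback (tangentP Z) (tangentP Z)) : flat (l ≫ pullback.snd _ _) =
      lin (Pi.single 1 1) _ ≫ (multiFunctor S (Fin 2)).map l ≫ s := by
    rw [flat_comp, h₁, ← Category.assoc, map_lin, Category.assoc]
  -- `hk` is precisely the condition for the transpose of `k` to factor through `W × D(2)`; the axes
  -- of the factor `t` are the two tangent vectors sought.
  obtain ⟨t, ht⟩ := exists_vert_comp (flat (flat k)) ((flat_comp_map_tangentP k).symm.trans
    ((congrArg flat hk).trans (flat_comp_zero_tangentP k)))
  refine ⟨pullback.lift (tangentEquiv _ _ (lin (Pi.single 0 1) _ ≫ t))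
    (tangentEquiv _ _ (lin (Pi.single 1 1) _ ≫ t)) ?_, ?_, fun l hl => ?_⟩
  · rw [comp_tangentP, comp_tangentP, flat_tangentEquiv, flat_tangentEquiv, ← Category.assoc,
      ← Category.assoc, dualZ_lin]
  · apply flat_injective
    apply flat_injective
    rw [hm, ← ht]
    congr 1
    refine multi_ext_of_lin fun i => ?_
    fin_cases i
    · exact (hl₀ _).symm.trans ((congrArg flat (pullback.lift_fst _ _ _)).trans
        (flat_tangentEquiv _))
    · exact (hl₁ _).symm.trans ((congrArg flat (pullback.lift_snd _ _ _)).trans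
        (flat_tangentEquiv _))
  -- Uniqueness: `vert` is an epimorphism, so `l` determines `t`, and the axes of `t` are the
  -- components of `l`.
  · have hs : (multiFunctor S (Fin 2)).map l ≫ s = t := by
      apply vert_hom_ext
      rw [← hm, hl, ht]
    apply pullback.hom_ext
    · apply flat_injective
      rw [hl₀, hs, pullback.lift_fst, flat_tangentEquiv]
    · apply flat_injective
      rw [hl₁, hs, pullback.lift_snd, flat_tangentEquiv]

/-! ### The tangent functor as a right adjoint -/

variable (S) in
/-- The functor `W ↦ W[ε]` is left adjoint to the tangent functor. -/
def dualAdjTangent : dualFunctor S ⊣ tangentFunctor S :=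
  Adjunction.mkOfHomEquiv
    { homEquiv := fun W Z => tangentEquiv W Z
      homEquiv_naturality_left_symm := fun k a => by
        exact flat_comp k a
      homEquiv_naturality_right := fun g k => by
        apply flat_injective
        exact (flat_tangentEquiv _).trans ((flat_map _ k).trans
          (congrArg (· ≫ k) (flat_tangentEquiv g))).symm }

instance (n : ℕ) : ((zariski S).iter n).IsRightAdjoint := by
  induction n with
  | zero => exact inferInstanceAs (𝟭 (Over S)).IsRightAdjoint
  | succ n ih =>
    have : (tangentFunctor S).IsRightAdjoint := (dualAdjTangent S).isRightAdjoint
    exact inferInstanceAs ((zariski S).iter n ⋙ tangentFunctor S).IsRightAdjoint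

variable (S) in
theorem zariski_isTangentStructure : (zariski S).IsTangentStructure where
  p_naturality := tangentMap_tangentP
  hasLimit_power n X := inferInstance
  -- Each iterate `T^m` is a right adjoint and so preserves every limit.
  preservesLimit_power m n X := inferInstance
  zero_naturality := tangentZero_naturality
  add_naturality g := tangentAdd_naturality g _
  lift_naturality := tangentLift_naturality
  flip_naturality := tangentFlip_naturality
  zero_p := tangentZero_tangentP
  add_p := tangentAdd_tangentP
  sum_zero a := tangentSum_zero a _
  sum_comm := tangentSum_comm
  sum_assoc a b c h h' := tangentSum_assoc a b c h h' _ _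
  lift_p := tangentLift_map_tangentP
  lift_add X :=
    have h : (pullback.fst (tangentP X) (tangentP X) ≫ tangentLift X) ≫ tangentP (tangentObj X) =
        (pullback.snd (tangentP X) (tangentP X) ≫ tangentLift X) ≫ tangentP (tangentObj X) := by
      rw [Category.assoc, Category.assoc, tangentLift_tangentP, pullback.condition_assoc]
    ⟨h, tangentLift_add X h⟩
  lift_zero := tangentZero_tangentZero
  flip_p := tangentFlip_tangentP
  flip_add X := tangentFlip_add X _
  flip_zero := tangentMap_zero_flip
  flip_flip := tangentFlip_flip
  lift_flip := tangentLift_flip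
  lift_lift := tangentLift_lift
  flip_hexagon := tangentFlip_hexagon
  lift_flip_pentagon := tangentLift_flip_pentagon
  universality X := by
    obtain ⟨v, hv₁, hv₂⟩ := exists_lift_zero X
    exact ⟨v, hv₁, hv₂, vertical_condition v hv₁ hv₂, ⟨Fork.IsLimit.ofExistsUnique fun k =>
      existsUnique_vertical v hv₁ hv₂ k.ι k.condition⟩⟩

end Axioms

/-! ### Base change -/

section BaseChange

variable {X Y : Scheme.{u}} (f : X ⟶ Y) {V W : Over X} {Z Z' : Over Y}

/-- The morphism `V ⟶ Z` over `Y` that corresponds to a morphism `V ⟶ f^*Z` over `X`. -/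
def push (a : V ⟶ (Over.pullback f).obj Z) : (Over.map f).obj V ⟶ Z :=
  Over.homMk (a.left ≫ pullback.fst Z.hom f) (by
    have h : a.left ≫ pullback.snd Z.hom f = V.hom := Over.w a
    rw [Category.assoc, pullback.condition, reassoc_of% h]
    rfl)

-- The other component of a morphism into `f^*Z` is the structure morphism to `X`, which is fixed.
variable {f} in
lemma hom_ext_of_fst {a b : V ⟶ (Over.pullback f).obj Z}
    (h : a.left ≫ pullback.fst Z.hom f = b.left ≫ pullback.fst Z.hom f) : a = b :=
  Over.OverMorphism.ext (pullback.hom_ext h ((Over.w a).trans (Over.w b).symm))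

lemma exists_push (b : (Over.map f).obj V ⟶ Z) : ∃ a : V ⟶ (Over.pullback f).obj Z, push f a = b :=
  ⟨Over.homMk (pullback.lift b.left V.hom (Over.w b)) (pullback.lift_snd _ _ _),
    Over.OverMorphism.ext (pullback.lift_fst _ _ _)⟩

lemma push_comp_map (a : V ⟶ (Over.pullback f).obj Z) (g : Z ⟶ Z') :
    push f (a ≫ (Over.pullback f).map g) = push f a ≫ g :=
  Over.OverMorphism.ext ((Category.assoc _ _ _).trans ((congrArg (a.left ≫ ·)
    (pullback.lift_fst _ _ _)).trans (Category.assoc _ _ _).symm))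

lemma push_map (g : Z ⟶ Z') :
    push f ((Over.pullback f).map g) = push f (𝟙 _) ≫ g := by
  rw [← push_comp_map, Category.id_comp]

/-- The base change morphism `f^*T_{Z/Y} ⟶ T_{f^*Z/X}`. -/
def baseChangeApp (Z : Over Y) :
    (Over.pullback f).obj (tangentObj Z) ⟶ tangentObj ((Over.pullback f).obj Z) :=
  tangentEquiv _ _ (baseChangeEval f Z)

/-- On transposes the base change morphism does nothing: both sides are the same morphism from `V ×
D` to `Z`. The equality concerns underlying schemes, because the two sources carry structure
morphisms to different bases. -/
lemma flat_comp_baseChangeApp (a : V ⟶ (Over.pullback f).obj (tangentObj Z)) :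
    (flat (a ≫ baseChangeApp f Z)).left ≫ pullback.fst Z.hom f = (flat (push f a)).left := by
  rw [flat_comp, baseChangeApp, flat_tangentEquiv]
  have h : prod.map a.left (𝟙 _) ≫ baseChangeUniv Z.hom f ≫ pullback.fst Z.hom f =
      prod.map (a.left ≫ pullback.fst (tangentProj Z.hom ≫ Z.hom) f) (𝟙 _) ≫
        tangentUniv Z.hom := by
    rw [baseChangeUniv, pullback.lift_fst, prod.map_map_assoc, Category.comp_id]
  exact (Category.assoc _ _ _).trans h

lemma flat_flat_comp_baseChangeApp
    (a : V ⟶ (Over.pullback f).obj (tangentObj (tangentObj Z))) :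
    (flat (flat (a ≫ baseChangeApp f (tangentObj Z) ≫ tangentMap (baseChangeApp f Z)))).left ≫
      pullback.fst Z.hom f = (flat (flat (push f a))).left := by
  rw [← Category.assoc, flat_map, flat_comp_baseChangeApp]
  exact congrArg (fun x => prod.map x (𝟙 _) ≫ tangentUniv Z.hom) (flat_comp_baseChangeApp f a)

lemma baseChangeApp_tangentP (Z : Over Y) :
    baseChangeApp f Z ≫ tangentP _ = (Over.pullback f).map (tangentP Z) := by
  apply hom_ext_of_fst
  rw [comp_tangentP]
  have h₁ := flat_comp_baseChangeApp f (𝟙 ((Over.pullback f).obj (tangentObj Z)))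
  rw [Category.id_comp] at h₁
  have h₂ := congr(($(comp_tangentP (push f (𝟙 ((Over.pullback f).obj (tangentObj Z)))))).left)
  have h₃ := congr(($(push_map f (tangentP Z))).left)
  exact (Category.assoc _ _ _).trans ((congrArg (zeroSec _ ≫ ·) h₁).trans (h₂.symm.trans h₃.symm))

lemma map_tangentZero_baseChangeApp (Z : Over Y) :
    (Over.pullback f).map (tangentZero Z) ≫ baseChangeApp f Z = tangentZero _ := by
  apply flat_injective
  apply hom_ext_of_fst
  rw [flat_comp_baseChangeApp, push_map, flat_comp_tangentZero, flat_tangentZero]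
  exact congrArg (prod.fst ≫ ·) (Category.id_comp _)

lemma map_tangentLift_baseChangeApp (Z : Over Y) :
    (Over.pullback f).map (tangentLift Z) ≫ baseChangeApp f (tangentObj Z) ≫
      tangentMap (baseChangeApp f Z) = baseChangeApp f Z ≫ tangentLift _ := by
  apply flat_injective
  apply flat_injective
  apply hom_ext_of_fst
  rw [flat_flat_comp_baseChangeApp, push_map, flat_flat_comp_lift, flat_flat_comp_lift]
  have h := flat_comp_baseChangeApp f (𝟙 ((Over.pullback f).obj (tangentObj Z)))
  rw [Category.id_comp] at h
  exact ((Category.assoc _ _ _).trans (congrArg ((dualDiag _).left ≫ ·) h)).symm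

lemma map_tangentFlip_baseChangeApp (Z : Over Y) :
    (Over.pullback f).map (tangentFlip Z) ≫ baseChangeApp f (tangentObj Z) ≫
      tangentMap (baseChangeApp f Z) =
      (baseChangeApp f (tangentObj Z) ≫ tangentMap (baseChangeApp f Z)) ≫ tangentFlip _ := by
  apply flat_injective
  apply flat_injective
  apply hom_ext_of_fst
  rw [flat_flat_comp_baseChangeApp, push_map, flat_flat_comp_flip, flat_flat_comp_flip]
  have h := flat_flat_comp_baseChangeApp f (𝟙 ((Over.pullback f).obj (tangentObj (tangentObj Z))))
  rw [Category.id_comp] at h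
  exact ((Category.assoc _ _ _).trans (congrArg ((dualSwap _).left ≫ ·) h)).symm

lemma map_tangentAdd_baseChangeApp (Z : Over Y)
    (h : ((Over.pullback f).map (pullback.fst (tangentP Z) (tangentP Z)) ≫ baseChangeApp f Z) ≫
        tangentP _ =
      ((Over.pullback f).map (pullback.snd (tangentP Z) (tangentP Z)) ≫ baseChangeApp f Z) ≫
        tangentP _) :
    (Over.pullback f).map (tangentAdd Z) ≫ baseChangeApp f Z =
      tangentSum ((Over.pullback f).map (pullback.fst (tangentP Z) (tangentP Z)) ≫
        baseChangeApp f Z) ((Over.pullback f).map (pullback.snd (tangentP Z) (tangentP Z)) ≫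
        baseChangeApp f Z) h := by
  obtain ⟨s, h₀, h₁⟩ := exists_of_flat₂ _ _ h
  let P := (Over.pullback f).obj (pullback (tangentP Z) (tangentP Z))
  -- The `Z`-component of `s`, regarded as a morphism over `Y`. Its axes are the transposes of the
  -- two projections, so `comp_tangentAdd` computes the sum over `Y` from the same morphism that
  -- gives the sum over `X`.
  let s' : (multiFunctor Y (Fin 2)).obj ((Over.map f).obj P) ⟶ Z :=
    Over.homMk (push f s).left ((Over.w (push f s)).trans (Category.assoc _ _ _))
  have hs (c : Fin 2 → ℤ) : (lin c _ ≫ s).left ≫ pullback.fst Z.hom f = (lin c _ ≫ s').left :=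
    Category.assoc _ _ _
  apply flat_injective
  apply hom_ext_of_fst
  rw [flat_comp_baseChangeApp, flat_sum s _ _ h₀ h₁, single_add_single, push_map,
    comp_tangentAdd _ s', hs]
  · refine Over.OverMorphism.ext ?_
    rw [← hs, ← h₀, flat_comp_baseChangeApp, push_map]
  · refine Over.OverMorphism.ext ?_
    rw [← hs, ← h₁, flat_comp_baseChangeApp, push_map]

/-- By Yoneda: for `V` over `X`, morphisms from `V` to `f^*T_{Z/Y}` and to `T_{f^*Z/X}` both
correspond to morphisms `V × D ⟶ Z` over `Y`, and `baseChangeApp` respects these identifications. -/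
instance (Z : Over Y) : IsIso (baseChangeApp f Z) := by
  refine isIso_of_yoneda_map_bijective _ fun V => ⟨fun a b h => ?_, fun k => ?_⟩
  · have h' : push f a = push f b := by
      apply flat_injective
      refine Over.OverMorphism.ext ?_
      rw [← flat_comp_baseChangeApp, ← flat_comp_baseChangeApp]
      exact congrArg (fun x => (flat x).left ≫ pullback.fst Z.hom f) h
    exact hom_ext_of_fst congr(($h').left)
  · let g : (dualFunctor Y).obj ((Over.map f).obj V) ⟶ Z :=
      Over.homMk (push f (flat k)).left
        ((Over.w (push f (flat k))).trans (Category.assoc _ _ _))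
    obtain ⟨a, ha⟩ := exists_push f (tangentEquiv _ _ g)
    refine ⟨a, flat_injective (hom_ext_of_fst ?_)⟩
    refine (flat_comp_baseChangeApp f a).trans ?_
    rw [ha, flat_tangentEquiv]
    rfl

theorem baseChange_isStrongTangentMorphism :
    TangentData.IsStrongTangentMorphism (zariski Y) (zariski X) (Over.pullback f)
      (baseChange f) where
  app_p := baseChangeApp_tangentP f
  zero_app := map_tangentZero_baseChangeApp f
  add_app Z := map_tangentAdd_baseChangeApp f Z _
  lift_app := map_tangentLift_baseChangeApp f
  flip_app := map_tangentFlip_baseChangeApp f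
  isIso := by
    have (Z : Over Y) : IsIso ((baseChange f).app Z) := inferInstanceAs (IsIso (baseChangeApp f Z))
    exact NatIso.isIso_of_isIso_app _
  -- Base change is right adjoint to `Over.map f`, so it preserves all limits.
  preservesLimit_power _ _ _ := inferInstance
  preservesLimit_pullback _ := inferInstance
  preservesLimit_verticalPair _ := inferInstance

end BaseChange

end ZariskiTangent

end

theorem mainTheorem7 {X Y : Scheme.{u}} (f : X ⟶ Y) :
    (ZariskiTangent.zariski X).IsTangentStructure ∧
      (ZariskiTangent.zariski Y).IsTangentStructure ∧
      ZariskiTangent.TangentData.IsStrongTangentMorphism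
        (ZariskiTangent.zariski Y) (ZariskiTangent.zariski X)
        (Over.pullback f) (ZariskiTangent.baseChange f) :=
  ⟨ZariskiTangent.zariski_isTangentStructure X, ZariskiTangent.zariski_isTangentStructure Y,
    ZariskiTangent.baseChange_isStrongTangentMorphism f⟩
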